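/- Write $\mathbb{T}=\mathbb{R}/\mathbb{Z}$. For a finite Borel measure $\mu$ on $\mathbb{T}$ let $\widehat{\mu}(\xi)=\int_{\mathbb{T}} e^{-2\pi i\xi x}\,d\mu(x)$ for $\xi\in\mathbb{Z}$, and let $\dim_{\mathbb{F}}(\mu)$ be the supremum of all $s\in[0,1]$ such that $\sup_{\xi\in\mathbb{Z}}|\widehat{\mu}(\xi)|\,|\xi|^{s/2}<\infty$. The Fourier dimension $\dim_{\mathbb{F}}(A)$ of a Borel set $A\subset\mathbb{T}$ is the supremum of $\dim_{\mathbb{F}}(\mu)$ over all Borel probability measures $\mu$ on $\mathbb{T}$ with $\operatorname{supp}(\mu)\subset A$, and $A$ is a Salem set if $\dim_{\mathbb{F}}(A)$ equals the Hausdorff dimension of $A$. A set $E\subset[0,1]$ is called a Salem set, and its Fourier dimension is defined, through its image in $\mathbb{T}$. Theorem. Let $\gamma:[0,1]\to\mathbb{R}^d$ be a smooth ($C^\infty$) map with $\gamma'(t)\neq 0$ for all $t\in[0,1]$. Then there exists a Salem set $E\subset[0,1]$ with $\dim_{\mathbb{F}}(E)=4/9$ which avoids isosceles triangles on $\gamma$,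 that is, $|\gamma(t_1)-\gamma(t_2)|\neq|\gamma(t_2)-\gamma(t_3)|$ for all distinct $t_1,t_2,t_3\in E$, where $|\cdot|$ is the Euclidean norm. -/

import Mathlib

open scoped ENNReal ContDiff
open MeasureTheory Set

/-- The Fourier coefficient `∫ exp (-2 π i ξ x) dμ(x)` of a measure on the circle `ℝ / ℤ`. -/
noncomputable def measureFourierCoeff (μ : Measure UnitAddCircle) (ξ : ℤ) : ℂ :=
  ∫ x, fourier (-ξ) x ∂μ

/-- The exponents `s ∈ [0, 1]` such that `|μ̂(ξ)| |ξ| ^ (s / 2)` is bounded over `ξ ∈ ℤ`. -/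
def fourierDecayExponents (μ : Measure UnitAddCircle) : Set ℝ :=
  {s | s ∈ Icc (0 : ℝ) 1 ∧
    ∃ C : ℝ, ∀ ξ : ℤ, ‖measureFourierCoeff μ ξ‖ * |(ξ : ℝ)| ^ (s / 2) ≤ C}

/-- The Fourier dimension of a measure on the circle. -/
noncomputable def measureFourierDim (μ : Measure UnitAddCircle) : ℝ≥0∞ :=
  ⨆ s ∈ fourierDecayExponents μ, ENNReal.ofReal s

/-- The Fourier dimension of a subset of the circle: the supremum of the Fourier dimensions of the
Borel probability measures whose (closed) support is contained in the set. -/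
noncomputable def setFourierDim (A : Set UnitAddCircle) : ℝ≥0∞ :=
  ⨆ (μ : ProbabilityMeasure UnitAddCircle) (_ : (μ : Measure UnitAddCircle).support ⊆ A),
    measureFourierDim (μ : Measure UnitAddCircle)

/-- A Salem set: a Borel set whose Fourier dimension agrees with its Hausdorff dimension. -/
def IsSalemSet (A : Set UnitAddCircle) : Prop :=
  MeasurableSet A ∧ setFourierDim A = dimH A

/-- The set of points of the circle `ℝ / ℤ` represented by a set of real numbers. -/
def circleImage (E : Set ℝ) : Set UnitAddCircle :=
  (fun t : ℝ => (t : UnitAddCircle)) '' E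

/-- The parameter set `E` avoids isosceles triangles on the curve `γ`. -/
def AvoidsIsoscelesTriangles {d : ℕ} (γ : ℝ → EuclideanSpace ℝ (Fin d)) (E : Set ℝ) : Prop :=
  ∀ t₁ ∈ E, ∀ t₂ ∈ E, ∀ t₃ ∈ E, t₁ ≠ t₂ → t₂ ≠ t₃ → t₁ ≠ t₃ →
    ‖γ t₁ - γ t₂‖ ≠ ‖γ t₂ - γ t₃‖

/-! Near `t = 1/2` the curve is almost straight, so distances along it grow at a definite rate.
Hence, for points in three well separated short intervals, fixing two members of a triple that is
isosceles up to `O(r)` confines the third to an interval of length `O(r)`.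

The exponent 4/9 comes from a discrete problem: choose `N` points in each of the three intervals,
and `N` more in the rest of the circle, without isosceles triples at scale `r`. Random points have
exponential sums of size `N^(-1/2)` up to logarithms. The `N²` pairs from two intervals forbid a
proportion `η ~ N² r` of the third, and merely discarding that part would bias the distribution by
`η`. Instead let `S z` count the pairs forbidding `z`, let `h z` be its mean, and sample `z` with
density proportional to `(1 + h) 1_{S = 0}`. The first-order term `h - S` is then a mere
fluctuation, and the remaining error is `η²`. So `η² = N^(-1/2)`, that is `r = N^(-9/4)`, is
affordable: about `N` balls of radius `r` have dimension `4/9`, and `N^(-1/2) = (1/r)^(-2/9)` is the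
matching Fourier decay. Randomness is replaced by a greedy choice that keeps an exponential
potential small. This is `exists_avoiding_samples` and `eventually_exists_grid_points`.

Tents of radius `r` at these points form a multiplier `F` with mean `1` and other coefficients at
most `δ |n|^(-s)`, for any `s < 2/9` (`exists_multiplier`). Multiplying a density with quadratically
decaying coefficients by `F` perturbs its coefficients by `O(δ (1 + |ξ|)^(-s))`. Countably many
rational triples of intervals catch all triples of distinct parameters; one is treated per stage,
with summable `δ` and `s` increasing to `2/9`. A weak limit has Fourier dimension at least `4/9`,
and its support lies in the cover of every stage, so it has Hausdorff dimension at most `4/9` and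
contains no isosceles triple. The general inequality `setFourierDim_le_dimH`, an energy argument,
closes the chain. -/

/-! ### Derandomised sampling by an exponential potential -/

section Sampling

variable {ι κ : Type*}

/-- Some point of positive weight takes a value at most the weighted average. -/
theorem exists_le_weighted_average (Ω : Finset ι) (w J : ι → ℝ) (hw : ∀ y ∈ Ω, 0 ≤ w y)
    (hw1 : ∑ y ∈ Ω, w y = 1) :
    ∃ y ∈ Ω, 0 < w y ∧ J y ≤ ∑ y ∈ Ω, w y * J y := by
  by_contra! h
  set a := ∑ y ∈ Ω, w y * J y with ha
  have h1 : ∑ y ∈ Ω, w y * a = a := by rw [← Finset.sum_mul, hw1, one_mul]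
  have hle : ∀ y ∈ Ω, w y * a ≤ w y * J y := by
    intro y hy
    rcases (hw y hy).eq_or_lt with h0 | h0
    · simp [← h0]
    · exact mul_le_mul_of_nonneg_left (h y hy h0).le h0.le
  obtain ⟨y, hy, hy0⟩ : ∃ y ∈ Ω, 0 < w y := by
    by_contra! h2
    have : ∑ y ∈ Ω, w y ≤ 0 := Finset.sum_nonpos h2
    linarith
  have hlt : ∑ y ∈ Ω, w y * a < ∑ y ∈ Ω, w y * J y :=
    Finset.sum_lt_sum hle ⟨y, hy, mul_lt_mul_of_pos_left (h y hy hy0) hy0⟩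
  rw [h1] at hlt
  exact lt_irrefl _ hlt

/-- Since `e^u ≤ 1 + u + u²` for `|u| ≤ 1`, the zero mean removes the linear term and only `l² h² ≤
4 l²` remains. This is the one-step factor in the potential argument below. -/
theorem weighted_exp_le (Ω : Finset ι) (w h : ι → ℝ) (hw : ∀ y ∈ Ω, 0 ≤ w y)
    (hw1 : ∑ y ∈ Ω, w y = 1) (hh : ∀ y ∈ Ω, |h y| ≤ 2) (hmean : ∑ y ∈ Ω, w y * h y = 0)
    {l : ℝ} (hl : |l| ≤ 1 / 2) :
    ∑ y ∈ Ω, w y * Real.exp (l * h y) ≤ Real.exp (4 * l ^ 2) := by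
  have hb : ∀ y ∈ Ω, w y * Real.exp (l * h y) ≤ w y * (1 + l * h y + 4 * l ^ 2) := by
    intro y hy
    refine mul_le_mul_of_nonneg_left ?_ (hw y hy)
    have h1 : |l * h y| ≤ 1 := by
      rw [abs_mul]
      have := mul_le_mul hl (hh y hy) (abs_nonneg _) (by norm_num)
      linarith
    have h2 := Real.abs_exp_sub_one_sub_id_le h1
    have h3 : (l * h y) ^ 2 ≤ 4 * l ^ 2 := by
      have : h y ^ 2 ≤ 4 := by
        have := hh y hy
        rw [← sq_abs]
        nlinarith [abs_nonneg (h y)]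
      rw [mul_pow]
      nlinarith [sq_nonneg l]
    have := (abs_le.mp h2).2
    linarith
  refine (Finset.sum_le_sum hb).trans ?_
  have : ∑ y ∈ Ω, w y * (1 + l * h y + 4 * l ^ 2)
      = (∑ y ∈ Ω, w y) * (1 + 4 * l ^ 2) + l * ∑ y ∈ Ω, w y * h y := by
    rw [Finset.sum_mul, Finset.mul_sum, ← Finset.sum_add_distrib]
    exact Finset.sum_congr rfl fun y _ => by ring
  rw [this, hw1, hmean]
  have := Real.add_one_le_exp (4 * l ^ 2)
  linarith

/-- Greedy selection controlling an exponential potential and a pair cost. -/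
theorem exists_greedy_sequence (Ω : Finset ι) (w : ι → ℝ) (hw : ∀ y ∈ Ω, 0 ≤ w y)
    (hw1 : ∑ y ∈ Ω, w y = 1) (T : Finset κ) (hT : T.Nonempty) (h : κ → ι → ℝ)
    (hh : ∀ m ∈ T, ∀ y ∈ Ω, |h m y| ≤ 2) (hmean : ∀ m ∈ T, ∑ y ∈ Ω, w y * h m y = 0)
    (O : ι → ι → ℝ) {o : ℝ} (ho : 0 < o)
    (hOo : ∀ y ∈ Ω, ∑ y' ∈ Ω, w y' * O y y' ≤ o) {l : ℝ} (hl : |l| ≤ 1 / 2)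
    {N : ℕ} (hN : 0 < N) (n : ℕ) (hn : n ≤ N) :
    ∃ y : ℕ → ι, (∀ j, y j ∈ Ω ∧ 0 < w (y j)) ∧
      (∑ m ∈ T, (Real.exp (l * ∑ j ∈ Finset.range n, h m (y j)) +
          Real.exp (-l * ∑ j ∈ Finset.range n, h m (y j)))) / (2 * T.card * Real.exp (4 * l ^ 2) ^ n)
        + (∑ j ∈ Finset.range n, ∑ i ∈ Finset.range j, O (y i) (y j)) / (N ^ 2 * o)
        ≤ 1 + n / N := by
  have hc : (0 : ℝ) < T.card := by exact_mod_cast hT.card_pos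
  have hN' : (0 : ℝ) < N := by exact_mod_cast hN
  induction n with
  | zero =>
    obtain ⟨y, hy, hy0, -⟩ := exists_le_weighted_average Ω w (fun _ => 0) hw hw1
    refine ⟨fun _ => y, fun _ => ⟨hy, hy0⟩, ?_⟩
    simp only [Finset.range_zero, Finset.sum_empty, mul_zero, Real.exp_zero, pow_zero, mul_one,
      zero_div, add_zero, Nat.cast_zero]
    rw [Finset.sum_const, nsmul_eq_mul, mul_comm, one_add_one_eq_two]
    exact div_self_le_one _
  | succ n ih =>
    obtain ⟨y, hy, hpot⟩ := ih (by omega)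
    set q := Real.exp (4 * l ^ 2) with hq
    have hqpos : 0 < q := Real.exp_pos _
    set H : κ → ℝ := fun m => ∑ j ∈ Finset.range n, h m (y j) with hH
    set Ov := ∑ j ∈ Finset.range n, ∑ i ∈ Finset.range j, O (y i) (y j) with hOv
    -- The potential after appending `x`. Its average over `x` exceeds the old value by at most `1 /
    -- N`: the exponential part grows on average by at most the factor `q` built into the new
    -- denominator, and the pair part gains at most `n * o ≤ N * o`. Some `x` does as well as the
    -- average.
    let J : ι → ℝ := fun x =>
      (∑ m ∈ T, (Real.exp (l * (H m + h m x)) + Real.exp (-l * (H m + h m x))))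
        / (2 * T.card * q ^ (n + 1)) + (Ov + ∑ i ∈ Finset.range n, O (y i) x) / (N ^ 2 * o)
    obtain ⟨x, hx, hx0, hJ⟩ := exists_le_weighted_average Ω w J hw hw1
    have e1 : ∀ a : ℝ, ∀ m ∈ T, ∑ z ∈ Ω, w z * (Real.exp (l * (a + h m z)) +
        Real.exp (-l * (a + h m z))) ≤ q * (Real.exp (l * a) + Real.exp (-l * a)) := by
      intro a m hm
      have a1 := weighted_exp_le Ω w (h m) hw hw1 (hh m hm) (hmean m hm) hl
      have a2 := weighted_exp_le Ω w (h m) hw hw1 (hh m hm) (hmean m hm) (l := -l)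
        (by rwa [abs_neg])
      rw [neg_sq] at a2
      calc ∑ z ∈ Ω, w z * (Real.exp (l * (a + h m z)) + Real.exp (-l * (a + h m z)))
          = Real.exp (l * a) * ∑ z ∈ Ω, w z * Real.exp (l * h m z)
            + Real.exp (-l * a) * ∑ z ∈ Ω, w z * Real.exp (-l * h m z) := by
            rw [Finset.mul_sum, Finset.mul_sum, ← Finset.sum_add_distrib]
            refine Finset.sum_congr rfl fun z _ => ?_
            rw [mul_add l, mul_add (-l), Real.exp_add, Real.exp_add]
            ring
        _ ≤ Real.exp (l * a) * q + Real.exp (-l * a) * q := by gcongr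
        _ = _ := by ring
    have e2 : ∑ z ∈ Ω, w z * J z ≤ 1 + ((n + 1 : ℕ) : ℝ) / N := by
      have s1 : ∑ z ∈ Ω, w z * J z =
          (∑ m ∈ T, ∑ z ∈ Ω, w z * (Real.exp (l * (H m + h m z)) +
            Real.exp (-l * (H m + h m z)))) / (2 * T.card * q ^ (n + 1)) +
          ((∑ z ∈ Ω, w z) * Ov + ∑ i ∈ Finset.range n, ∑ z ∈ Ω, w z * O (y i) z)
            / (N ^ 2 * o) := by
        rw [Finset.sum_comm (s := T), Finset.sum_comm (s := Finset.range n), Finset.sum_mul,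
          ← Finset.sum_add_distrib, Finset.sum_div, Finset.sum_div, ← Finset.sum_add_distrib]
        refine Finset.sum_congr rfl fun z _ => ?_
        simp only [J]
        rw [← Finset.mul_sum, ← Finset.mul_sum]
        ring
      rw [s1, hw1, one_mul]
      have s2 : (∑ m ∈ T, ∑ z ∈ Ω, w z * (Real.exp (l * (H m + h m z)) +
            Real.exp (-l * (H m + h m z)))) / (2 * T.card * q ^ (n + 1)) ≤
          (∑ m ∈ T, (Real.exp (l * H m) + Real.exp (-l * H m))) / (2 * T.card * q ^ n) := by
        rw [div_le_div_iff₀ (by positivity) (by positivity)]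
        have := Finset.sum_le_sum fun m hm => e1 (H m) m hm
        rw [← Finset.mul_sum] at this
        calc _ ≤ (q * ∑ m ∈ T, (Real.exp (l * H m) + Real.exp (-l * H m))) *
              (2 * T.card * q ^ n) := by gcongr
          _ = _ := by ring
      have s3 : (∑ i ∈ Finset.range n, ∑ z ∈ Ω, w z * O (y i) z) ≤ N * o := by
        calc _ ≤ ∑ i ∈ Finset.range n, o := Finset.sum_le_sum fun i _ => hOo _ (hy i).1
          _ = n * o := by simp
          _ ≤ N * o := by
            have : (n : ℝ) ≤ N := by exact_mod_cast (by omega : n ≤ N)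
            gcongr
      have s4 : (Ov + ∑ i ∈ Finset.range n, ∑ z ∈ Ω, w z * O (y i) z) / (N ^ 2 * o) ≤
          Ov / (N ^ 2 * o) + 1 / N := by
        have : (1 : ℝ) / N = (N * o) / (N ^ 2 * o) := by field_simp
        rw [this, ← add_div]
        gcongr
      have : (1 : ℝ) + ((n + 1 : ℕ) : ℝ) / N = 1 + n / N + 1 / N := by push_cast; ring
      rw [this]
      linarith
    -- Values beyond index `n` play no role; the constant `x` keeps every term in `Ω` with positive
    -- weight.
    refine ⟨fun j => if j < n then y j else x, ?_, ?_⟩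
    · intro j
      dsimp only
      split_ifs
      · exact hy j
      · exact ⟨hx, hx0⟩
    · refine le_trans (le_of_eq ?_) (hJ.trans e2)
      have k1 : ∀ (u : ι → ℝ), ∑ j ∈ Finset.range n, u (if j < n then y j else x)
          = ∑ j ∈ Finset.range n, u (y j) := fun u =>
        Finset.sum_congr rfl fun j hj => by rw [if_pos (Finset.mem_range.mp hj)]
      have k2 : ∑ j ∈ Finset.range n, ∑ i ∈ Finset.range j,
          O (if i < n then y i else x) (if j < n then y j else x) = Ov := by
        refine Finset.sum_congr rfl fun j hj => Finset.sum_congr rfl fun i hi => ?_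
        have hj := Finset.mem_range.mp hj
        have hi := Finset.mem_range.mp hi
        rw [if_pos hj, if_pos (by omega)]
      simp only [Finset.sum_range_succ, lt_irrefl, if_false, k2]
      simp only [J, H, k1, k1 (fun u => O u x)]

/-- Deterministic sampling: for any finite family of bounded test functions there are `N` points
whose empirical averages are close to the weighted means and whose total pair cost is at most
twice its expectation. -/
theorem exists_sample (Ω : Finset ι) (w : ι → ℝ) (hw : ∀ y ∈ Ω, 0 ≤ w y)
    (hw1 : ∑ y ∈ Ω, w y = 1) (T : Finset κ) (hT : T.Nonempty) (g : κ → ι → ℝ)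
    (hg : ∀ m ∈ T, ∀ y ∈ Ω, |g m y| ≤ 1)
    (O : ι → ι → ℝ) (hO : ∀ y ∈ Ω, ∀ y' ∈ Ω, 0 ≤ O y y') {o : ℝ} (ho : 0 < o)
    (hOo : ∀ y ∈ Ω, ∑ y' ∈ Ω, w y' * O y y' ≤ o)
    {N : ℕ} (hN : 4 ≤ N) :
    ∃ y : ℕ → ι, (∀ j, y j ∈ Ω ∧ 0 < w (y j)) ∧
      (∀ m ∈ T, |(∑ j ∈ Finset.range N, g m (y j)) / N - ∑ z ∈ Ω, w z * g m z| ≤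
        (Real.log (4 * T.card) + 4) / √N) ∧
      ∑ j ∈ Finset.range N, ∑ i ∈ Finset.range j, O (y i) (y j) ≤ 2 * N ^ 2 * o := by
  have hc : (0 : ℝ) < T.card := by exact_mod_cast hT.card_pos
  have hN' : (4 : ℝ) ≤ N := by exact_mod_cast hN
  have hN0 : (0 : ℝ) < N := by linarith
  -- This `l` makes the accumulated factor `exp (4 l²) ^ N` equal to `e⁴`, and a bound on `l |S|`
  -- becomes a deviation of order `1 / √N`. The condition `|l| ≤ 1/2` is what requires `4 ≤ N`.
  set l : ℝ := 1 / √N with hl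
  have hsq : (2 : ℝ) ≤ √N := Real.le_sqrt_of_sq_le (by linarith)
  have hl0 : 0 < l := by positivity
  have hl1 : |l| ≤ 1 / 2 := by
    rw [abs_of_pos hl0]
    exact one_div_le_one_div_of_le (by norm_num) hsq
  have hl2 : l ^ 2 = 1 / N := by rw [hl, div_pow, Real.sq_sqrt hN0.le]; norm_num
  set gm : κ → ℝ := fun m => ∑ z ∈ Ω, w z * g m z with hgm
  have hgm1 : ∀ m ∈ T, |gm m| ≤ 1 := by
    intro m hm
    calc |gm m| ≤ ∑ z ∈ Ω, |w z * g m z| := Finset.abs_sum_le_sum_abs _ _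
      _ ≤ ∑ z ∈ Ω, w z := by
        refine Finset.sum_le_sum fun z hz => ?_
        rw [abs_mul, abs_of_nonneg (hw z hz)]
        exact mul_le_of_le_one_right (hw z hz) (hg m hm z hz)
      _ = 1 := hw1
  obtain ⟨y, hy, hpot⟩ := exists_greedy_sequence Ω w hw hw1 T hT (fun m z => g m z - gm m)
    (fun m hm z hz => by
      have := abs_sub (g m z) (gm m)
      have := hg m hm z hz
      have := hgm1 m hm
      linarith)
    (fun m hm => by
      simp only [mul_sub, Finset.sum_sub_distrib, ← Finset.sum_mul, hw1, one_mul]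
      simp [gm]) O ho hOo hl1 (N := N) (by omega) N le_rfl
  have hqN : Real.exp (4 * l ^ 2) ^ N = Real.exp 4 := by
    rw [← Real.exp_nat_mul, hl2]; congr 1; field_simp
  rw [hqN, div_self hN0.ne'] at hpot
  have hOv0 : 0 ≤ ∑ j ∈ Finset.range N, ∑ i ∈ Finset.range j, O (y i) (y j) :=
    Finset.sum_nonneg fun j _ => Finset.sum_nonneg fun i _ => hO _ (hy i).1 _ (hy j).1
  have hP0 : ∀ m ∈ T, 0 ≤ (Real.exp (l * ∑ j ∈ Finset.range N, (g m (y j) - gm m)) +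
          Real.exp (-l * ∑ j ∈ Finset.range N, (g m (y j) - gm m))) := fun m _ => by positivity
  refine ⟨y, hy, ?_, ?_⟩
  · intro m hm
    set S := ∑ j ∈ Finset.range N, (g m (y j) - gm m) with hS
    -- Both parts of the potential are nonnegative with sum at most `2`, so each is bounded
    -- separately, and a single exponential is at most the whole sum.
    have h1 : (∑ m ∈ T, (Real.exp (l * ∑ j ∈ Finset.range N, (g m (y j) - gm m)) +
          Real.exp (-l * ∑ j ∈ Finset.range N, (g m (y j) - gm m)))) / (2 * T.card * Real.exp 4)
          ≤ 2 := by
      have : 0 ≤ (∑ j ∈ Finset.range N, ∑ i ∈ Finset.range j, O (y i) (y j)) / (N ^ 2 * o) := by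
        positivity
      linarith
    rw [div_le_iff₀ (by positivity)] at h1
    have h2 := Finset.single_le_sum hP0 hm
    have h3 : Real.exp (l * |S|) ≤ 4 * T.card * Real.exp 4 := by
      have : Real.exp (l * |S|) ≤ Real.exp (l * S) + Real.exp (-l * S) := by
        rcases abs_cases S with ⟨e, _⟩ | ⟨e, _⟩ <;> rw [e]
        · linarith [Real.exp_pos (-l * S)]
        · rw [mul_neg, ← neg_mul]; linarith [Real.exp_pos (l * S)]
      simp only [← hS] at h2
      linarith
    have h4 : l * |S| ≤ Real.log (4 * T.card) + 4 := by
      have := Real.log_le_log (Real.exp_pos _) h3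
      rwa [Real.log_mul (mul_pos four_pos hc).ne' (Real.exp_pos _).ne', Real.log_exp,
        Real.log_exp] at this
    have h5 : (∑ j ∈ Finset.range N, g m (y j)) / N - gm m = S / N := by
      rw [hS, Finset.sum_sub_distrib]
      simp
      field_simp
    rw [h5, abs_div, abs_of_pos hN0, div_le_div_iff₀ hN0 (by positivity)]
    calc |S| * √N = (l * |S|) * N := by
          rw [hl]
          field_simp
          rw [Real.sq_sqrt hN0.le]
      _ ≤ _ := by gcongr
  · have h1 : (∑ j ∈ Finset.range N, ∑ i ∈ Finset.range j, O (y i) (y j)) / (N ^ 2 * o) ≤ 2 := by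
      have : 0 ≤ (∑ m ∈ T, (Real.exp (l * ∑ j ∈ Finset.range N, (g m (y j) - gm m)) +
          Real.exp (-l * ∑ j ∈ Finset.range N, (g m (y j) - gm m)))) / (2 * T.card * Real.exp 4) :=
        div_nonneg (Finset.sum_nonneg hP0) (by positivity)
      linarith
    rw [div_le_iff₀ (by positivity)] at h1
    linarith

/-- Complex-valued version of `exists_sample`. -/
theorem exists_sample_complex (Ω : Finset ι) (w : ι → ℝ) (hw : ∀ y ∈ Ω, 0 ≤ w y)
    (hw1 : ∑ y ∈ Ω, w y = 1) (T : Finset κ) (hT : T.Nonempty) (g : κ → ι → ℂ)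
    (hg : ∀ m ∈ T, ∀ y ∈ Ω, ‖g m y‖ ≤ 1)
    (O : ι → ι → ℝ) (hO : ∀ y ∈ Ω, ∀ y' ∈ Ω, 0 ≤ O y y') {o : ℝ} (ho : 0 < o)
    (hOo : ∀ y ∈ Ω, ∑ y' ∈ Ω, w y' * O y y' ≤ o)
    {N : ℕ} (hN : 4 ≤ N) :
    ∃ y : ℕ → ι, (∀ j, y j ∈ Ω ∧ 0 < w (y j)) ∧
      (∀ m ∈ T, ‖(∑ j ∈ Finset.range N, g m (y j)) / N - ∑ z ∈ Ω, w z * g m z‖ ≤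
        2 * (Real.log (8 * T.card) + 4) / √N) ∧
      ∑ j ∈ Finset.range N, ∑ i ∈ Finset.range j, O (y i) (y j) ≤ 2 * N ^ 2 * o := by
  classical
  -- Real and imaginary parts are separate real test functions, which doubles both the family and
  -- the error.
  obtain ⟨y, hy, h1, h2⟩ := exists_sample Ω w hw hw1 (T ×ˢ (Finset.univ : Finset Bool))
    (hT.product Finset.univ_nonempty)
    (fun m z => if m.2 then (g m.1 z).re else (g m.1 z).im)
    (fun m hm z hz => by
      have hm' := hg m.1 (Finset.mem_product.mp hm).1 z hz
      split_ifs
      · exact (Complex.abs_re_le_norm _).trans hm'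
      · exact (Complex.abs_im_le_norm _).trans hm') O hO ho hOo hN
  refine ⟨y, hy, fun m hm => ?_, h2⟩
  have hcard : ((T ×ˢ (Finset.univ : Finset Bool)).card : ℝ) = T.card * 2 := by
    simp [Finset.card_product]
  have hre := h1 (m, true) (by simp [hm])
  have him := h1 (m, false) (by simp [hm])
  rw [hcard, show (4 : ℝ) * (T.card * 2) = 8 * T.card by ring] at hre him
  simp only [if_true, Bool.false_eq_true, if_false] at hre him
  refine (Complex.norm_le_abs_re_add_abs_im _).trans ?_
  have er : ((∑ j ∈ Finset.range N, g m (y j)) / N - ∑ z ∈ Ω, (w z : ℂ) * g m z).re =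
      (∑ j ∈ Finset.range N, (g m (y j)).re) / N - ∑ z ∈ Ω, w z * (g m z).re := by
    rw [Complex.sub_re, Complex.div_natCast_re, Complex.re_sum, Complex.re_sum]
    simp
  have ei : ((∑ j ∈ Finset.range N, g m (y j)) / N - ∑ z ∈ Ω, (w z : ℂ) * g m z).im =
      (∑ j ∈ Finset.range N, (g m (y j)).im) / N - ∑ z ∈ Ω, w z * (g m z).im := by
    rw [Complex.sub_im, Complex.div_natCast_im, Complex.im_sum, Complex.im_sum]
    simp
  rw [er, ei]
  refine (add_le_add hre him).trans (le_of_eq ?_)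
  ring

end Sampling

/-! ### Thinning with compensation of the first-order bias -/

section Thinning

variable {ι κ : Type*}

/-- The left side is `0` for `s = 0` and `s - 1` otherwise. Truncating inclusion-exclusion at first
order therefore costs no more than the number of ordered pairs of coincidences. -/
theorem abs_indicator_zero_sub_le (s : ℕ) :
    |(if s = 0 then (1 : ℝ) else 0) - (1 - s)| ≤ (s : ℝ) ^ 2 - s := by
  rcases Nat.eq_zero_or_pos s with rfl | hs
  · simp
  · have h1 : (1 : ℝ) ≤ s := by exact_mod_cast hs
    rw [if_neg hs.ne', zero_sub, neg_sub, abs_of_nonneg (by linarith)]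
    nlinarith

/-- Fourier-type averages of the compensated thinned density are close to those of the uniform
density. -/
theorem norm_thinned_average_sub_le (G : Finset ι) (hG : G.Nonempty) (S : ι → ℕ) (h : ι → ℝ) (e : ι → ℂ)
    (he : ∀ z ∈ G, ‖e z‖ ≤ 1) {η k : ℝ} (hη1 : η ≤ 1) (hh0 : ∀ z ∈ G, 0 ≤ h z)
    (hhη : ∀ z ∈ G, h z ≤ η) (hS : ∑ z ∈ G, (S z : ℝ) ≤ G.card * η)
    (hS2 : ∑ z ∈ G, ((S z : ℝ) ^ 2 - S z) ≤ G.card * (4 * η ^ 2))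
    (hk : ‖∑ z ∈ G, ((h z - S z : ℝ) : ℂ) * e z‖ ≤ G.card * k) :
    ‖∑ z ∈ G, (((1 + h z) * (if S z = 0 then (1 : ℝ) else 0) : ℝ) : ℂ) * e z - ∑ z ∈ G, e z‖
      ≤ G.card * (k + 9 * η ^ 2) := by
  have hη0 : 0 ≤ η := by
    obtain ⟨z, hz⟩ := hG
    exact (hh0 z hz).trans (hhη z hz)
  -- Pointwise, `(1 + h) 1_{S = 0} = 1 + (h - S) - h S + (1 + h) (1_{S = 0} - (1 - S))`. The factor
  -- `1 + h` compensates the mean of `S`; the last two terms are of second order in `η`, and `9 = 1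
  -- + 2 * 4`.
  have hdec : ∑ z ∈ G, (((1 + h z) * (if S z = 0 then (1 : ℝ) else 0) : ℝ) : ℂ) * e z
      - ∑ z ∈ G, e z = ∑ z ∈ G, ((h z - S z : ℝ) : ℂ) * e z
        - ∑ z ∈ G, ((h z * S z : ℝ) : ℂ) * e z
        + ∑ z ∈ G, (((1 + h z) * ((if S z = 0 then (1 : ℝ) else 0) - (1 - S z)) : ℝ) : ℂ) * e z := by
    rw [← Finset.sum_sub_distrib, ← Finset.sum_sub_distrib, ← Finset.sum_add_distrib]
    refine Finset.sum_congr rfl fun z _ => ?_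
    push_cast
    ring
  have b2 : ‖∑ z ∈ G, ((h z * S z : ℝ) : ℂ) * e z‖ ≤ G.card * η ^ 2 := by
    calc _ ≤ ∑ z ∈ G, ‖((h z * S z : ℝ) : ℂ) * e z‖ := norm_sum_le _ _
      _ ≤ ∑ z ∈ G, η * S z := by
        refine Finset.sum_le_sum fun z hz => ?_
        rw [norm_mul, Complex.norm_real, Real.norm_eq_abs,
          abs_of_nonneg (mul_nonneg (hh0 z hz) (Nat.cast_nonneg _))]
        refine (mul_le_of_le_one_right (mul_nonneg (hh0 z hz) (Nat.cast_nonneg _)) (he z hz)).trans ?_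
        exact mul_le_mul_of_nonneg_right (hhη z hz) (Nat.cast_nonneg _)
      _ = η * ∑ z ∈ G, (S z : ℝ) := by rw [Finset.mul_sum]
      _ ≤ η * (G.card * η) := mul_le_mul_of_nonneg_left hS hη0
      _ = _ := by ring
  have b3 : ‖∑ z ∈ G, (((1 + h z) * ((if S z = 0 then (1 : ℝ) else 0) - (1 - S z)) : ℝ) : ℂ) * e z‖
      ≤ G.card * (8 * η ^ 2) := by
    calc _ ≤ ∑ z ∈ G, ‖(((1 + h z) * ((if S z = 0 then (1 : ℝ) else 0) - (1 - S z)) : ℝ) : ℂ)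
          * e z‖ := norm_sum_le _ _
      _ ≤ ∑ z ∈ G, 2 * ((S z : ℝ) ^ 2 - S z) := by
        refine Finset.sum_le_sum fun z hz => ?_
        have h1 := hh0 z hz
        have h2 := hhη z hz
        rw [norm_mul, Complex.norm_real, Real.norm_eq_abs]
        refine (mul_le_of_le_one_right (abs_nonneg _) (he z hz)).trans ?_
        rw [abs_mul, abs_of_nonneg (by linarith : 0 ≤ 1 + h z)]
        exact mul_le_mul (by linarith) (abs_indicator_zero_sub_le (S z)) (abs_nonneg _) (by norm_num)
      _ = 2 * ∑ z ∈ G, ((S z : ℝ) ^ 2 - S z) := by rw [Finset.mul_sum]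
      _ ≤ 2 * (G.card * (4 * η ^ 2)) := mul_le_mul_of_nonneg_left hS2 (by norm_num)
      _ = _ := by ring
  rw [hdec]
  refine (norm_add_le _ _).trans ?_
  have := norm_sub_le (∑ z ∈ G, ((h z - S z : ℝ) : ℂ) * e z) (∑ z ∈ G, ((h z * S z : ℝ) : ℂ) * e z)
  linarith

/-- Sampling from a finite set while avoiding the points covered by `S`. -/
theorem exists_thinned_sample (G : Finset ι) (hG : G.Nonempty) (S : ι → ℕ) (h : ι → ℝ)
    (Q : Finset κ) (e : κ → ι → ℂ) {q₀ : κ} (hq₀ : q₀ ∈ Q) (he₀ : ∀ z ∈ G, e q₀ z = 1)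
    (he : ∀ q ∈ Q, ∀ z ∈ G, ‖e q z‖ ≤ 1) {η k : ℝ} (hη1 : η ≤ 1) (hh0 : ∀ z ∈ G, 0 ≤ h z)
    (hhη : ∀ z ∈ G, h z ≤ η) (hS : ∑ z ∈ G, (S z : ℝ) ≤ G.card * η)
    (hS2 : ∑ z ∈ G, ((S z : ℝ) ^ 2 - S z) ≤ G.card * (4 * η ^ 2))
    (hk : ∀ q ∈ Q, ‖∑ z ∈ G, ((h z - S z : ℝ) : ℂ) * e q z‖ ≤ G.card * k)
    (hsmall : k + 9 * η ^ 2 < 1) {N : ℕ} (hN : 4 ≤ N) :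
    ∃ z : ℕ → ι, (∀ j, z j ∈ G ∧ S (z j) = 0) ∧
      ∀ q ∈ Q, ‖(∑ j ∈ Finset.range N, e q (z j)) / N - (∑ z ∈ G, e q z) / G.card‖ ≤
        2 * (Real.log (8 * Q.card) + 4) / √N + 2 * (k + 9 * η ^ 2) := by
  have hc : (0 : ℝ) < G.card := by exact_mod_cast hG.card_pos
  set g : ι → ℝ := fun z => (1 + h z) * (if S z = 0 then (1 : ℝ) else 0) with hg
  have hg0 : ∀ z ∈ G, 0 ≤ g z := fun z hz => by
    have := hh0 z hz
    simp only [g]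
    split_ifs <;> linarith
  have hmain := fun q hq =>
    norm_thinned_average_sub_le G hG S h (e q) (he q hq) hη1 hh0 hhη hS hS2 (hk q hq)
  set err := k + 9 * η ^ 2 with herr
  set W := ∑ z ∈ G, g z with hW
  -- The trivial character `q₀` measures the total mass of the thinned density.
  have hW1 : |W - G.card| ≤ G.card * err := by
    have h1 := hmain q₀ hq₀
    have h2 : ∑ z ∈ G, (g z : ℂ) * e q₀ z - ∑ z ∈ G, e q₀ z = ((W - G.card : ℝ) : ℂ) := by
      rw [Finset.sum_congr rfl fun z hz => by rw [he₀ z hz, mul_one],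
        Finset.sum_congr rfl fun z hz => he₀ z hz]
      simp [hW]
    rw [h2, Complex.norm_real, Real.norm_eq_abs] at h1
    exact h1
  have hWpos : 0 < W := by
    have := (abs_le.mp hW1).1
    nlinarith
  have hw1 : ∑ z ∈ G, g z / W = 1 := by rw [← Finset.sum_div, div_self hWpos.ne']
  obtain ⟨z, hz, h1, -⟩ := exists_sample_complex G (fun z => g z / W)
    (fun z hz => div_nonneg (hg0 z hz) hWpos.le) hw1 Q ⟨q₀, hq₀⟩ e he (fun _ _ => 0)
    (fun _ _ _ _ => le_rfl) one_pos (fun _ _ => by simp) hN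
  refine ⟨z, fun j => ⟨(hz j).1, ?_⟩, fun q hq => ?_⟩
  · by_contra hne
    have := (hz j).2
    simp [g, hne] at this
  · set t := 2 * (Real.log (8 * Q.card) + 4) / √N
    have hA : ∑ z ∈ G, ((g z / W : ℝ) : ℂ) * e q z = (∑ z ∈ G, (g z : ℂ) * e q z) / W := by
      rw [Finset.sum_div]
      exact Finset.sum_congr rfl fun z _ => by push_cast; ring
    set P := ∑ z ∈ G, (g z : ℂ) * e q z with hP
    have hPW : ‖P‖ ≤ W := by
      refine (norm_sum_le _ _).trans (Finset.sum_le_sum fun z hz => ?_)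
      rw [norm_mul, Complex.norm_real, Real.norm_eq_abs, abs_of_nonneg (hg0 z hz)]
      exact mul_le_of_le_one_right (hg0 z hz) (he q hq z hz)
    have h2 := h1 q hq
    rw [hA] at h2
    have hW' : (W : ℂ) ≠ 0 := by exact_mod_cast hWpos.ne'
    have hc' : (G.card : ℂ) ≠ 0 := by exact_mod_cast hc.ne'
    -- The error `err` is paid twice: here to replace the normalisation `W` by `G.card`, then to
    -- replace the thinned density by the uniform one.
    have h3 : ‖P / W - P / G.card‖ ≤ err := by
      have : P / W - P / G.card = (P / W) * (((G.card - W : ℝ) : ℂ) / G.card) := by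
        push_cast
        field_simp
      rw [this, norm_mul, norm_div, norm_div, Complex.norm_real, Complex.norm_real,
        Complex.norm_natCast, Real.norm_eq_abs, Real.norm_eq_abs, abs_sub_comm, abs_of_pos hWpos]
      have a1 : ‖P‖ / W ≤ 1 := (div_le_one hWpos).mpr hPW
      have a2 : |W - G.card| / G.card ≤ err := by
        rw [div_le_iff₀ hc, mul_comm]
        exact hW1
      calc ‖P‖ / W * (|W - G.card| / G.card) ≤ 1 * (|W - G.card| / G.card) := by gcongr
        _ ≤ err := by rwa [one_mul]
    have h4 : ‖P / G.card - (∑ z ∈ G, e q z) / G.card‖ ≤ err := by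
      rw [← sub_div, norm_div, Complex.norm_natCast, div_le_iff₀ hc, mul_comm]
      exact hmain q hq
    have h5 : (∑ j ∈ Finset.range N, e q (z j)) / N - (∑ z ∈ G, e q z) / G.card
        = ((∑ j ∈ Finset.range N, e q (z j)) / N - P / W) + (P / W - P / G.card)
          + (P / G.card - (∑ z ∈ G, e q z) / G.card) := by ring
    rw [h5]
    refine (norm_add₃_le).trans ?_
    linarith

end Thinning

/-! ### Three families of samples without forbidden triples -/

section AvoidingSamples

variable {ι κ : Type*}

theorem sq_sum_range_eq (f : ℕ → ℝ) (N : ℕ) :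
    (∑ j ∈ Finset.range N, f j) ^ 2 = ∑ j ∈ Finset.range N, f j ^ 2 +
      2 * ∑ j ∈ Finset.range N, ∑ i ∈ Finset.range j, f i * f j := by
  induction N with
  | zero => simp
  | succ n ih =>
    rw [Finset.sum_range_succ, Finset.sum_range_succ, Finset.sum_range_succ, add_sq, ih,
      ← Finset.sum_mul]
    ring

/-- The number `1` if the configuration `(x, y, z)` is forbidden and `0` otherwise. -/
noncomputable def badCount (b : ι → ι → ι → Prop) (x y z : ι) : ℕ :=
  open Classical in if b x y z then 1 else 0

theorem badCount_eq_zero {b : ι → ι → ι → Prop} {x y z : ι} : badCount b x y z = 0 ↔ ¬ b x y z := by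
  simp [badCount]

/-- The average of `e` over the points `z` of `G` forbidden by `x` and `y`. -/
noncomputable def badAverage (b : ι → ι → ι → Prop) (G : Finset ι) (e : ι → ℂ) (x y : ι) : ℂ :=
  (∑ z ∈ G, (badCount b x y z : ℂ) * e z) / G.card

theorem norm_badAverage_le {b : ι → ι → ι → Prop} {G : Finset ι} (hG : G.Nonempty) {e : ι → ℂ}
    (he : ∀ z ∈ G, ‖e z‖ ≤ 1) {x y : ι} {σ : ℝ}
    (h : ∑ z ∈ G, (badCount b x y z : ℝ) ≤ σ * G.card) : ‖badAverage b G e x y‖ ≤ σ := by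
  have hc : (0 : ℝ) < G.card := by exact_mod_cast hG.card_pos
  rw [badAverage, norm_div, Complex.norm_natCast, div_le_iff₀ hc]
  refine ((norm_sum_le _ _).trans (Finset.sum_le_sum fun z hz => ?_)).trans h
  rw [norm_mul, Complex.norm_natCast]
  exact mul_le_of_le_one_right (Nat.cast_nonneg _) (he z hz)

/-- Choice of the first two families of points. The first family is `near`-separated; the
exponential averages of all forbidden pairs are close to their mean; the total overlap of the
forbidden sets is controlled. -/
theorem exists_pair_samples (G₁ G₂ G₃ : Finset ι) (hG₁ : G₁.Nonempty) (hG₂ : G₂.Nonempty)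
    (hG₃ : G₃.Nonempty) (b : ι → ι → ι → Prop) (near : ι → ι → Prop) {σ : ℝ} (hσ : 0 < σ)
    (h₃ : ∀ x ∈ G₁, ∀ y ∈ G₂, ∑ z ∈ G₃, (badCount b x y z : ℝ) ≤ σ * G₃.card)
    (h₂ : ∀ x ∈ G₁, ∀ z ∈ G₃, ∑ y ∈ G₂, (badCount b x y z : ℝ) ≤ σ * G₂.card)
    (h₁ : ∀ x ∈ G₁, open Classical in
      ((G₁.filter (fun x' => near x x')).card : ℝ) ≤ σ * G₁.card)
    (Q : Finset κ) (hQ : Q.Nonempty) (e : κ → ι → ℂ) (he : ∀ q ∈ Q, ∀ z, ‖e q z‖ ≤ 1)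
    {N : ℕ} (hN : 4 ≤ N) (hNσ : 2 * N ^ 2 * σ < 1) {t : ℝ}
    (ht : 2 * (Real.log (16 * Q.card) + 4) / √N = t) :
    ∃ x y : ℕ → ι, (∀ j, x j ∈ G₁) ∧ (∀ j, y j ∈ G₂) ∧
      (∀ j < N, ∀ i < j, ¬ near (x i) (x j)) ∧
      (∀ q ∈ Q, ‖(∑ j ∈ Finset.range N, e q (x j)) / N - (∑ z ∈ G₁, e q z) / G₁.card‖ ≤ t) ∧
      (∀ q ∈ Q, ‖(∑ j ∈ Finset.range N, e q (y j)) / N - (∑ z ∈ G₂, e q z) / G₂.card‖ ≤ t) ∧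
      (∀ q ∈ Q, ‖∑ j ∈ Finset.range N, ∑ i ∈ Finset.range N, badAverage b G₃ (e q) (x i) (y j)
        - N ^ 2 * ((∑ u ∈ G₁, ∑ v ∈ G₂, badAverage b G₃ (e q) u v) / (G₁.card * G₂.card))‖
          ≤ 2 * (N ^ 2 * σ) * t) ∧
      ∑ j ∈ Finset.range N, ∑ i ∈ Finset.range j, ∑ z ∈ G₃,
        (∑ k ∈ Finset.range N, (badCount b (x k) (y i) z : ℝ)) *
          (∑ k ∈ Finset.range N, (badCount b (x k) (y j) z : ℝ)) ≤
            G₃.card * (2 * (N ^ 2 * σ) ^ 2) := by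
  classical
  have hc₁ : (0 : ℝ) < G₁.card := by exact_mod_cast hG₁.card_pos
  have hc₂ : (0 : ℝ) < G₂.card := by exact_mod_cast hG₂.card_pos
  have hc₃ : (0 : ℝ) < G₃.card := by exact_mod_cast hG₃.card_pos
  have hN0 : (0 : ℝ) < N := by exact_mod_cast (by omega : 0 < N)
  have hN0' : (N : ℂ) ≠ 0 := by exact_mod_cast hN0.ne'
  have hσ' : (σ : ℂ) ≠ 0 := by exact_mod_cast hσ.ne'
  have hc₁' : (G₁.card : ℂ) ≠ 0 := by exact_mod_cast hc₁.ne'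
  have hc₂' : (G₂.card : ℂ) ≠ 0 := by exact_mod_cast hc₂.ne'
  have hB : ∀ q ∈ Q, ∀ x ∈ G₁, ∀ y ∈ G₂, ‖badAverage b G₃ (e q) x y‖ ≤ σ := fun q hq x hx y hy =>
    norm_badAverage_le hG₃ (fun z _ => he q hq z) (h₃ x hx y hy)
  have hcardT : ((Q.disjSum Q).card : ℝ) = 2 * Q.card := by
    rw [Finset.card_disjSum]; push_cast; ring
  have hTne : (Q.disjSum Q).Nonempty := by
    obtain ⟨q, hq⟩ := hQ
    exact ⟨Sum.inl q, by simp [hq]⟩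
  have hu : ∀ G : Finset ι, (0 : ℝ) < G.card → ∑ _y ∈ G, ((G.card : ℝ)⁻¹) = 1 := fun G hG => by
    rw [Finset.sum_const, nsmul_eq_mul, mul_inv_cancel₀ hG.ne']
  have havg : ∀ (G : Finset ι) (f : ι → ℂ), ∑ z ∈ G, (((G.card : ℝ)⁻¹ : ℝ) : ℂ) * f z
      = (∑ z ∈ G, f z) / G.card := fun G f => by
    rw [← Finset.mul_sum]; push_cast; rw [div_eq_inv_mul]
  -- the first family
  obtain ⟨x, hx, hx1, hx2⟩ := exists_sample_complex G₁ (fun _ => (G₁.card : ℝ)⁻¹)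
    (fun _ _ => by positivity) (hu G₁ hc₁) (Q.disjSum Q) hTne
    -- Besides the functions `e q`, the forbidden averages of `u` against a uniform `v` are tested;
    -- division by `σ` brings them to size at most `1`.
    (Sum.elim e (fun q u => ((∑ v ∈ G₂, badAverage b G₃ (e q) u v) / G₂.card) / σ))
    (by
      rintro (q | q) hq u hu
      · exact he q (by simpa using hq) u
      · have hq : q ∈ Q := by simpa using hq
        simp only [Sum.elim_inr]
        rw [norm_div, norm_div, Complex.norm_real, Complex.norm_natCast, Real.norm_eq_abs,
          abs_of_pos hσ, div_le_one hσ, div_le_iff₀ hc₂]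
        calc _ ≤ ∑ v ∈ G₂, ‖badAverage b G₃ (e q) u v‖ := norm_sum_le _ _
          _ ≤ ∑ v ∈ G₂, σ := Finset.sum_le_sum fun v hv => hB q hq u hu v hv
          _ = σ * G₂.card := by rw [Finset.sum_const, nsmul_eq_mul, mul_comm])
    -- The pair cost counts `near` pairs. Its total is at most `2 N² σ < 1`, and being an integer it
    -- vanishes.
    (fun u v => if near u v then 1 else 0) (fun _ _ _ _ => by split_ifs <;> norm_num) hσ
    (fun u hu => by
      rw [← Finset.mul_sum, Finset.sum_boole, inv_mul_le_iff₀ hc₁, mul_comm]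
      exact h₁ u hu) hN
  rw [hcardT, show (8 : ℝ) * (2 * Q.card) = 16 * Q.card by ring, ht] at hx1
  -- the second family
  set β : ι → ι → ℝ := fun v z => ∑ k ∈ Finset.range N, (badCount b (x k) v z : ℝ) with hβ
  have hβ0 : ∀ v z, 0 ≤ β v z := fun v z => Finset.sum_nonneg fun _ _ => Nat.cast_nonneg _
  have hNσpos : 0 < (N * σ) ^ 2 := by positivity
  have hβy : ∀ z ∈ G₃, ∑ v ∈ G₂, β v z ≤ N * (σ * G₂.card) := fun z hz => by
    rw [hβ, Finset.sum_comm]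
    calc _ ≤ ∑ k ∈ Finset.range N, σ * G₂.card := Finset.sum_le_sum fun k _ => h₂ _ (hx k).1 z hz
      _ = _ := by rw [Finset.sum_const, Finset.card_range, nsmul_eq_mul]
  have hβz : ∀ v ∈ G₂, ∑ z ∈ G₃, β v z ≤ N * (σ * G₃.card) := fun v hv => by
    rw [hβ, Finset.sum_comm]
    calc _ ≤ ∑ k ∈ Finset.range N, σ * G₃.card := Finset.sum_le_sum fun k _ => h₃ _ (hx k).1 v hv
      _ = _ := by rw [Finset.sum_const, Finset.card_range, nsmul_eq_mul]
  obtain ⟨y, hy, hy1, hy2⟩ := exists_sample_complex G₂ (fun _ => (G₂.card : ℝ)⁻¹)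
    (fun _ _ => by positivity) (hu G₂ hc₂) (Q.disjSum Q) hTne
    (Sum.elim e (fun q v => ((∑ i ∈ Finset.range N, badAverage b G₃ (e q) (x i) v) / N) / σ))
    (by
      rintro (q | q) hq v hv
      · exact he q (by simpa using hq) v
      · have hq : q ∈ Q := by simpa using hq
        simp only [Sum.elim_inr]
        rw [norm_div, norm_div, Complex.norm_real, Complex.norm_natCast, Real.norm_eq_abs,
          abs_of_pos hσ, div_le_one hσ, div_le_iff₀ hN0]
        calc _ ≤ ∑ i ∈ Finset.range N, ‖badAverage b G₃ (e q) (x i) v‖ := norm_sum_le _ _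
          _ ≤ ∑ i ∈ Finset.range N, σ := Finset.sum_le_sum fun i _ => hB q hq _ (hx i).1 v hv
          _ = σ * N := by rw [Finset.sum_const, Finset.card_range, nsmul_eq_mul, mul_comm])
    -- The pair cost is the overlap of the sets forbidden by two members of the second family. By
    -- Fubini its mean over the second variable is at most `(N σ)²`.
    (fun u v => (∑ z ∈ G₃, β u z * β v z) / G₃.card)
    (fun u _ v _ => div_nonneg (Finset.sum_nonneg fun z _ => mul_nonneg (hβ0 u z) (hβ0 v z)) hc₃.le)
    hNσpos
    (fun u hu => by
      rw [← Finset.mul_sum, ← Finset.sum_div, Finset.sum_comm, inv_mul_le_iff₀ hc₂,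
        div_le_iff₀ hc₃]
      calc ∑ z ∈ G₃, ∑ v ∈ G₂, β u z * β v z = ∑ z ∈ G₃, β u z * ∑ v ∈ G₂, β v z := by
            simp only [Finset.mul_sum]
        _ ≤ ∑ z ∈ G₃, β u z * (N * (σ * G₂.card)) :=
          Finset.sum_le_sum fun z hz => mul_le_mul_of_nonneg_left (hβy z hz) (hβ0 u z)
        _ = (∑ z ∈ G₃, β u z) * (N * (σ * G₂.card)) := by rw [Finset.sum_mul]
        _ ≤ (N * (σ * G₃.card)) * (N * (σ * G₂.card)) :=
          mul_le_mul_of_nonneg_right (hβz u hu) (by positivity)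
        _ = _ := by ring) hN
  rw [hcardT, show (8 : ℝ) * (2 * Q.card) = 16 * Q.card by ring, ht] at hy1
  refine ⟨x, y, fun j => (hx j).1, fun j => (hy j).1, ?_, ?_, ?_, ?_, ?_⟩
  · intro j hj i hi hnear
    have hle : (1 : ℝ) ≤ ∑ j ∈ Finset.range N, ∑ i ∈ Finset.range j,
        (if near (x i) (x j) then (1 : ℝ) else 0) := by
      have hnn : ∀ j ∈ Finset.range N, 0 ≤ ∑ i ∈ Finset.range j,
          (if near (x i) (x j) then (1 : ℝ) else 0) := fun j _ =>
        Finset.sum_nonneg fun i _ => by split_ifs <;> norm_num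
      refine le_trans ?_ (Finset.single_le_sum hnn (Finset.mem_range.mpr hj))
      refine le_trans ?_ (Finset.single_le_sum (fun i _ => ?_) (Finset.mem_range.mpr hi))
      · rw [if_pos hnear]
      · split_ifs <;> norm_num
    linarith
  · intro q hq
    have := hx1 (Sum.inl q) (by simp [hq])
    rwa [havg] at this
  · intro q hq
    have := hy1 (Sum.inl q) (by simp [hq])
    rwa [havg] at this
  · intro q hq
    have a1 := hx1 (Sum.inr q) (by simp [hq])
    have a2 := hy1 (Sum.inr q) (by simp [hq])
    rw [havg] at a1 a2
    simp only [Sum.elim_inr] at a1 a2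
    set P := ∑ j ∈ Finset.range N, ∑ i ∈ Finset.range N, badAverage b G₃ (e q) (x i) (y j) with hP
    set R := ∑ i ∈ Finset.range N, ∑ v ∈ G₂, badAverage b G₃ (e q) (x i) v with hR
    set L := ∑ u ∈ G₁, ∑ v ∈ G₂, badAverage b G₃ (e q) u v with hL
    have e1 : (∑ j ∈ Finset.range N, (∑ v ∈ G₂, badAverage b G₃ (e q) (x j) v) / G₂.card / σ) / N
        = R / (G₂.card * σ * N) := by
      rw [← Finset.sum_div, ← Finset.sum_div, div_div, div_div, ← mul_assoc]
    have e2 : (∑ u ∈ G₁, (∑ v ∈ G₂, badAverage b G₃ (e q) u v) / G₂.card / σ) / G₁.card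
        = L / (G₂.card * σ * G₁.card) := by
      rw [← Finset.sum_div, ← Finset.sum_div, div_div, div_div, ← mul_assoc]
    have e3 : (∑ j ∈ Finset.range N, (∑ i ∈ Finset.range N, badAverage b G₃ (e q) (x i) (y j))
        / N / σ) / N = P / (N * σ * N) := by
      rw [← Finset.sum_div, ← Finset.sum_div, div_div, div_div, ← mul_assoc]
    have e4 : (∑ v ∈ G₂, (∑ i ∈ Finset.range N, badAverage b G₃ (e q) (x i) v)
        / N / σ) / G₂.card = R / (N * σ * G₂.card) := by
      rw [← Finset.sum_div, ← Finset.sum_div, Finset.sum_comm, div_div, div_div, ← mul_assoc]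
    rw [e1, e2] at a1
    rw [e3, e4] at a2
    -- Comparison in two steps: the sampled double sum `P` against `R`, where `y` is averaged over
    -- `G₂`, then `R` against the full mean `L`. After normalisation by `N² σ` each step costs `t`.
    have e5 : P - N ^ 2 * (L / (G₁.card * G₂.card)) = ((N ^ 2 * σ : ℝ) : ℂ) *
        ((P / (N * σ * N) - R / (N * σ * G₂.card)) +
          (R / (G₂.card * σ * N) - L / (G₂.card * σ * G₁.card))) := by
      push_cast
      field_simp
      ring
    have hpos : 0 < N ^ 2 * σ := by positivity
    rw [e5, norm_mul, Complex.norm_real, Real.norm_eq_abs, abs_of_pos hpos]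
    have := norm_add_le (P / (N * σ * N) - R / (N * σ * G₂.card))
      (R / (G₂.card * σ * N) - L / (G₂.card * σ * G₁.card))
    calc _ ≤ (N ^ 2 * σ) * (t + t) := by gcongr; linarith
      _ = _ := by ring
  · simp only [← Finset.sum_div] at hy2
    rw [div_le_iff₀ hc₃] at hy2
    refine hy2.trans (le_of_eq ?_)
    ring

/-- Choice of three families of points, close to uniformly distributed in three finite sets with
respect to all test functions, which form no forbidden configuration. -/
theorem exists_avoiding_samples (G₁ G₂ G₃ : Finset ι) (hG₁ : G₁.Nonempty) (hG₂ : G₂.Nonempty)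
    (hG₃ : G₃.Nonempty) (b : ι → ι → ι → Prop) (near : ι → ι → Prop) {σ : ℝ} (hσ : 0 < σ)
    (h₃ : ∀ x ∈ G₁, ∀ y ∈ G₂, ∑ z ∈ G₃, (badCount b x y z : ℝ) ≤ σ * G₃.card)
    (h₂ : ∀ x ∈ G₁, ∀ z ∈ G₃, ∑ y ∈ G₂, (badCount b x y z : ℝ) ≤ σ * G₂.card)
    (h₁ : ∀ x ∈ G₁, open Classical in
      ((G₁.filter (fun x' => near x x')).card : ℝ) ≤ σ * G₁.card)
    (hnear : ∀ x ∈ G₁, ∀ x' ∈ G₁, ∀ y ∈ G₂, ∀ z ∈ G₃, b x y z → b x' y z → near x x')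
    (Q : Finset κ) (e : κ → ι → ℂ) (he : ∀ q ∈ Q, ∀ z, ‖e q z‖ ≤ 1)
    {q₀ : κ} (hq₀ : q₀ ∈ Q) (he₀ : ∀ z, e q₀ z = 1)
    {N : ℕ} (hN : 4 ≤ N) (hNσ : 2 * N ^ 2 * σ < 1) {t : ℝ}
    (ht : 2 * (Real.log (16 * Q.card) + 4) / √N = t) (hsmall : t + 9 * (N ^ 2 * σ) ^ 2 < 1) :
    ∃ x y z : ℕ → ι, (∀ j, x j ∈ G₁) ∧ (∀ j, y j ∈ G₂) ∧ (∀ j, z j ∈ G₃) ∧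
      (∀ i < N, ∀ j < N, ∀ k < N, ¬ b (x i) (y j) (z k)) ∧
      (∀ q ∈ Q, ‖(∑ j ∈ Finset.range N, e q (x j)) / N - (∑ z ∈ G₁, e q z) / G₁.card‖ ≤ t) ∧
      (∀ q ∈ Q, ‖(∑ j ∈ Finset.range N, e q (y j)) / N - (∑ z ∈ G₂, e q z) / G₂.card‖ ≤ t) ∧
      (∀ q ∈ Q, ‖(∑ j ∈ Finset.range N, e q (z j)) / N - (∑ z ∈ G₃, e q z) / G₃.card‖ ≤
        t + 2 * (t + 9 * (N ^ 2 * σ) ^ 2)) := by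
  classical
  have hc₁ : (0 : ℝ) < G₁.card := by exact_mod_cast hG₁.card_pos
  have hc₂ : (0 : ℝ) < G₂.card := by exact_mod_cast hG₂.card_pos
  have hc₃ : (0 : ℝ) < G₃.card := by exact_mod_cast hG₃.card_pos
  have hN0 : (0 : ℝ) < N := by exact_mod_cast (by omega : 0 < N)
  obtain ⟨x, y, hx, hy, hsep, hx1, hy1, hxy, hov⟩ := exists_pair_samples G₁ G₂ G₃ hG₁ hG₂ hG₃ b near
    hσ h₃ h₂ h₁ Q ⟨q₀, hq₀⟩ e he hN hNσ ht
  have hQ1 : (1 : ℝ) ≤ Q.card := by exact_mod_cast Finset.card_pos.mpr ⟨q₀, hq₀⟩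
  have ht0 : 0 ≤ t := by
    rw [← ht]
    have := Real.log_nonneg (by linarith : (1 : ℝ) ≤ 16 * Q.card)
    positivity
  set S : ι → ℕ := fun z => ∑ j ∈ Finset.range N, ∑ i ∈ Finset.range N, badCount b (x i) (y j) z
    with hS
  -- The value of `S` expected for uniform points of `G₁` and `G₂`; it serves as the compensator in
  -- the thinning.
  set h : ι → ℝ := fun z => N ^ 2 * ((∑ u ∈ G₁, ∑ v ∈ G₂, (badCount b u v z : ℝ)) /
    (G₁.card * G₂.card)) with hh
  set β : ℕ → ι → ℝ := fun j z => ∑ k ∈ Finset.range N, (badCount b (x k) (y j) z : ℝ) with hβ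
  have hSβ : ∀ z, (S z : ℝ) = ∑ j ∈ Finset.range N, β j z := fun z => by simp [hS, hβ]
  -- Two members of the first family forming forbidden triples with the same `y j` and `z` would be
  -- `near` each other, which their separation excludes. So `β` takes only the values `0` and `1`.
  have hβsq : ∀ z ∈ G₃, ∀ j, β j z ^ 2 = β j z := by
    intro z hz j
    have hor : β j z = 0 ∨ β j z = 1 := by
      by_cases hex : ∃ i ∈ Finset.range N, b (x i) (y j) z
      · right
        obtain ⟨i, hi, hbi⟩ := hex
        simp only [hβ]
        rw [Finset.sum_eq_single_of_mem i hi]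
        · simp [badCount, hbi]
        · intro k hk hki
          have : ¬ b (x k) (y j) z := by
            intro hbk
            rcases lt_or_gt_of_ne hki with hlt | hlt
            · exact hsep i (Finset.mem_range.mp hi) k hlt
                (hnear _ (hx k) _ (hx i) _ (hy j) z hz hbk hbi)
            · exact hsep k (Finset.mem_range.mp hk) i hlt
                (hnear _ (hx i) _ (hx k) _ (hy j) z hz hbi hbk)
          simp [badCount, this]
      · left
        push Not at hex
        exact Finset.sum_eq_zero fun k hk => by simp [badCount, hex k hk]
    rcases hor with h | h <;> simp [h]
  have hS2 : ∑ z ∈ G₃, ((S z : ℝ) ^ 2 - S z) ≤ G₃.card * (4 * (N ^ 2 * σ) ^ 2) := by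
    -- Since `β² = β`, the diagonal of `S²` cancels `S`, leaving exactly the overlaps controlled by
    -- the choice of the second family.
    have : ∀ z ∈ G₃, ((S z : ℝ) ^ 2 - S z) =
        2 * ∑ j ∈ Finset.range N, ∑ i ∈ Finset.range j, β i z * β j z := by
      intro z hz
      rw [hSβ, sq_sum_range_eq, Finset.sum_congr rfl fun j _ => hβsq z hz j]
      ring
    rw [Finset.sum_congr rfl this, ← Finset.mul_sum, Finset.sum_comm]
    simp only [Finset.sum_comm (s := G₃)]
    linarith
  have hS1 : ∑ z ∈ G₃, (S z : ℝ) ≤ G₃.card * (N ^ 2 * σ) := by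
    simp only [hSβ, hβ]
    rw [Finset.sum_comm]
    calc _ ≤ ∑ j ∈ Finset.range N, ∑ i ∈ Finset.range N, σ * G₃.card := by
          refine Finset.sum_le_sum fun j _ => ?_
          rw [Finset.sum_comm]
          exact Finset.sum_le_sum fun i _ => h₃ _ (hx i) _ (hy j)
      _ = _ := by
        simp only [Finset.sum_const, Finset.card_range, nsmul_eq_mul]
        ring
  have hh0 : ∀ z ∈ G₃, 0 ≤ h z := fun z _ => by positivity
  have hhη : ∀ z ∈ G₃, h z ≤ N ^ 2 * σ := by
    intro z hz
    refine mul_le_mul_of_nonneg_left ?_ (by positivity)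
    rw [div_le_iff₀ (by positivity)]
    calc _ ≤ ∑ u ∈ G₁, σ * G₂.card := Finset.sum_le_sum fun u hu => h₂ u hu z hz
      _ = _ := by rw [Finset.sum_const, nsmul_eq_mul]; ring
  have hη1 : N ^ 2 * σ ≤ 1 / 2 := by linarith
  have hk : ∀ q ∈ Q, ‖∑ z ∈ G₃, ((h z - S z : ℝ) : ℂ) * e q z‖ ≤ G₃.card * t := by
    intro q hq
    have a1 : ∑ z ∈ G₃, (S z : ℂ) * e q z = G₃.card *
        ∑ j ∈ Finset.range N, ∑ i ∈ Finset.range N, badAverage b G₃ (e q) (x i) (y j) := by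
      have hc₃' : (G₃.card : ℂ) ≠ 0 := by exact_mod_cast hc₃.ne'
      simp only [badAverage, ← Finset.sum_div]
      rw [mul_div_cancel₀ _ hc₃']
      simp only [hS, Nat.cast_sum, Finset.sum_mul]
      rw [Finset.sum_comm]
      exact Finset.sum_congr rfl fun j _ => Finset.sum_comm
    have a2 : ∑ z ∈ G₃, ((h z : ℝ) : ℂ) * e q z = G₃.card *
        (N ^ 2 * ((∑ u ∈ G₁, ∑ v ∈ G₂, badAverage b G₃ (e q) u v) / (G₁.card * G₂.card))) := by
      have hc₃' : (G₃.card : ℂ) ≠ 0 := by exact_mod_cast hc₃.ne'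
      simp only [badAverage, ← Finset.sum_div]
      have : ∑ u ∈ G₁, ∑ v ∈ G₂, ∑ z ∈ G₃, (badCount b u v z : ℂ) * e q z =
          ∑ z ∈ G₃, (∑ u ∈ G₁, ∑ v ∈ G₂, (badCount b u v z : ℂ)) * e q z := by
        simp only [Finset.sum_mul]
        rw [Finset.sum_comm]
        rw [Finset.sum_comm (s := G₃)]
        rw [Finset.sum_comm]
        exact Finset.sum_congr rfl fun u _ => Finset.sum_comm
      rw [this, div_div, ← mul_div_assoc, ← mul_div_assoc, Finset.mul_sum, Finset.mul_sum,
        Finset.sum_div]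
      refine Finset.sum_congr rfl fun z _ => ?_
      simp only [hh]
      push_cast
      field_simp
    have a3 : ∑ z ∈ G₃, ((h z - S z : ℝ) : ℂ) * e q z =
        ∑ z ∈ G₃, ((h z : ℝ) : ℂ) * e q z - ∑ z ∈ G₃, (S z : ℂ) * e q z := by
      rw [← Finset.sum_sub_distrib]
      exact Finset.sum_congr rfl fun z _ => by push_cast; ring
    rw [a3, a1, a2, ← mul_sub, norm_mul, Complex.norm_natCast, norm_sub_rev]
    refine mul_le_mul_of_nonneg_left ((hxy q hq).trans ?_) hc₃.le
    nlinarith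
  obtain ⟨z, hz, hz1⟩ := exists_thinned_sample G₃ hG₃ S h Q e hq₀ (fun z _ => he₀ z)
    (fun q hq z _ => he q hq z) (by linarith) hh0 hhη hS1 hS2 hk hsmall hN
  refine ⟨x, y, z, hx, hy, fun j => (hz j).1, ?_, hx1, hy1, fun q hq => (hz1 q hq).trans ?_⟩
  · intro i hi j hj k _
    have h0 := (hz k).2
    simp only [hS, Finset.sum_eq_zero_iff, Finset.mem_range] at h0
    exact badCount_eq_zero.mp (h0 j hj i hi)
  · have : 2 * (Real.log (8 * Q.card) + 4) / √N ≤ t := by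
      rw [← ht]
      gcongr
      norm_num
    linarith

end AvoidingSamples

/-! ### Growth of distances along an almost straight arc -/

section Geometry

variable {V : Type*} [NormedAddCommGroup V] [InnerProductSpace ℝ V]

/-- Expanding around `x • v` and `y • v`, the error terms cost at most `1/4 + 1/4 + 1/16` of the
main term, whence `7/16`. -/
theorem inner_ge_of_near_smul {v a b : V} {x y : ℝ} (hx : 0 ≤ x) (hy : 0 ≤ y)
    (ha : ‖a - x • v‖ ≤ ‖v‖ / 4 * x) (hb : ‖b - y • v‖ ≤ ‖v‖ / 4 * y) :
    7 / 16 * ‖v‖ ^ 2 * (x * y) ≤ inner ℝ a b := by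
  set e := a - x • v with he
  set f := b - y • v with hf
  have ha' : a = x • v + e := by rw [he]; abel
  have hb' : b = y • v + f := by rw [hf]; abel
  have hexp : inner ℝ a b = x * y * ‖v‖ ^ 2 + x * inner ℝ v f + y * inner ℝ e v + inner ℝ e f := by
    rw [ha', hb', inner_add_left, inner_add_right, inner_add_right, real_inner_smul_left,
      real_inner_smul_left, real_inner_smul_right, real_inner_smul_right, real_inner_self_eq_norm_sq]
    ring
  have h1 : -(‖v‖ * (‖v‖ / 4 * y)) ≤ inner ℝ v f := by
    have := (abs_le.mp (abs_real_inner_le_norm v f)).1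
    have := mul_le_mul_of_nonneg_left hb (norm_nonneg v)
    linarith
  have h2 : -((‖v‖ / 4 * x) * ‖v‖) ≤ inner ℝ e v := by
    have := (abs_le.mp (abs_real_inner_le_norm e v)).1
    have := mul_le_mul_of_nonneg_right ha (norm_nonneg v)
    linarith
  have h3 : -((‖v‖ / 4 * x) * (‖v‖ / 4 * y)) ≤ inner ℝ e f := by
    have := (abs_le.mp (abs_real_inner_le_norm e f)).1
    have := mul_le_mul ha hb (norm_nonneg _) (by positivity)
    linarith
  have h1' := mul_le_mul_of_nonneg_left h1 hx
  have h2' := mul_le_mul_of_nonneg_left h2 hy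
  rw [hexp]
  nlinarith

/-- Here `‖a + b‖² - ‖b‖² = ‖a‖² + 2⟪a, b⟫ ≥ 7/16 ‖v‖² x (x + 2y)`, while `‖a + b‖ + ‖b‖ ≤ 5/4 ‖v‖
(x + 2y)`; the quotient `7/20 ‖v‖ x` leaves room to spare. For consecutive chords `a`, `b` of the
curve this is the growth of distances. -/
theorem norm_add_sub_norm_ge {v a b : V} {x y : ℝ} (hx : 0 ≤ x) (hy : 0 ≤ y)
    (ha : ‖a - x • v‖ ≤ ‖v‖ / 4 * x) (hb : ‖b - y • v‖ ≤ ‖v‖ / 4 * y) :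
    ‖v‖ / 4 * x ≤ ‖a + b‖ - ‖b‖ := by
  rcases hx.eq_or_lt with rfl | hx0
  · have : a = 0 := by
      have h0 : ‖a‖ ≤ 0 := by simpa using ha
      exact norm_le_zero_iff.mp h0
    simp [this]
  rcases (norm_nonneg v).eq_or_lt with hv | hv
  · have ha0 : a = 0 := by
      have hv0 : v = 0 := norm_eq_zero.mp hv.symm
      have h0 : ‖a‖ ≤ 0 := by simpa [hv0] using ha
      exact norm_le_zero_iff.mp h0
    simp [ha0, ← hv]
  have h1 := inner_ge_of_near_smul hx hx ha ha
  have h2 := inner_ge_of_near_smul hx hy ha hb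
  rw [real_inner_self_eq_norm_sq] at h1
  have h3 : ‖a + b‖ ^ 2 = ‖a‖ ^ 2 + 2 * inner ℝ a b + ‖b‖ ^ 2 := norm_add_sq_real a b
  have na : ‖a‖ ≤ 5 / 4 * ‖v‖ * x := by
    have := norm_add_le (a - x • v) (x • v)
    rw [sub_add_cancel, norm_smul, Real.norm_eq_abs, abs_of_nonneg hx] at this
    linarith
  have nb : ‖b‖ ≤ 5 / 4 * ‖v‖ * y := by
    have := norm_add_le (b - y • v) (y • v)
    rw [sub_add_cancel, norm_smul, Real.norm_eq_abs, abs_of_nonneg hy] at this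
    linarith
  have nab := norm_add_le a b
  have hY : ‖a + b‖ + ‖b‖ ≤ 5 / 4 * ‖v‖ * (x + 2 * y) := by linarith
  by_contra! hlt
  have hprod : (‖a + b‖ - ‖b‖) * (‖a + b‖ + ‖b‖) ≥ 7 / 16 * ‖v‖ ^ 2 * (x * (x + 2 * y)) := by
    have : (‖a + b‖ - ‖b‖) * (‖a + b‖ + ‖b‖) = ‖a + b‖ ^ 2 - ‖b‖ ^ 2 := by ring
    rw [this, h3]
    linarith
  have hup : (‖a + b‖ - ‖b‖) * (‖a + b‖ + ‖b‖) ≤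
      (‖v‖ / 4 * x) * (5 / 4 * ‖v‖ * (x + 2 * y)) := by
    refine (mul_le_mul_of_nonneg_right hlt.le (by positivity)).trans ?_
    exact mul_le_mul_of_nonneg_left hY (by positivity)
  have hpos : 0 < ‖v‖ ^ 2 * (x * (x + 2 * y)) := by positivity
  nlinarith

/-- On a short interval around `1 / 2` the distances along a regular curve are Lipschitz and
strictly monotone at a definite rate. -/
theorem exists_interval_distances {d : ℕ} {γ : ℝ → EuclideanSpace ℝ (Fin d)}
    (hγ : ContDiffOn ℝ ∞ γ (Icc (0 : ℝ) 1))
    (hγ' : ∀ t ∈ Icc (0 : ℝ) 1, derivWithin γ (Icc (0 : ℝ) 1) t ≠ 0) :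
    ∃ η c K : ℝ, 0 < η ∧ η ≤ 1 / 4 ∧ 0 < c ∧ 0 < K ∧
      (∀ s ∈ Icc (1 / 2 - η) (1 / 2 + η), ∀ t ∈ Icc (1 / 2 - η) (1 / 2 + η),
        ‖γ s - γ t‖ ≤ K * |s - t|) ∧
      ∀ s ∈ Icc (1 / 2 - η) (1 / 2 + η), ∀ t ∈ Icc (1 / 2 - η) (1 / 2 + η),
        ∀ u ∈ Icc (1 / 2 - η) (1 / 2 + η), s ≤ t → t ≤ u →
          c * (u - t) ≤ ‖γ s - γ u‖ - ‖γ s - γ t‖ ∧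
          c * (t - s) ≤ ‖γ s - γ u‖ - ‖γ t - γ u‖ := by
  have hmem : ∀ t ∈ Ioo (0 : ℝ) 1, Icc (0 : ℝ) 1 ∈ nhds t := fun t ht => Icc_mem_nhds ht.1 ht.2
  have hhalf : (1 / 2 : ℝ) ∈ Ioo (0 : ℝ) 1 := by constructor <;> norm_num
  set v := deriv γ (1 / 2) with hv
  have hv0 : v ≠ 0 := by
    have := hγ' (1 / 2) (Ioo_subset_Icc_self hhalf)
    rwa [derivWithin_of_mem_nhds (hmem _ hhalf)] at this
  have hvpos : 0 < ‖v‖ := norm_pos_iff.mpr hv0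
  have hcont : ContinuousAt (deriv γ) (1 / 2) := by
    have h1 : ContDiffOn ℝ ∞ γ (Ioo (0 : ℝ) 1) := hγ.mono Ioo_subset_Icc_self
    have h2 := h1.continuousOn_deriv_of_isOpen isOpen_Ioo (by simp)
    exact h2.continuousAt (isOpen_Ioo.mem_nhds hhalf)
  obtain ⟨δ, hδ, hδ'⟩ := Metric.continuousAt_iff.mp hcont (‖v‖ / 4) (by positivity)
  set η := min (δ / 2) (1 / 4) with hη
  have hη0 : 0 < η := by positivity
  have hη1 : η ≤ 1 / 4 := min_le_right _ _
  have hη2 : η < δ := lt_of_le_of_lt (min_le_left _ _) (by linarith)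
  set I := Icc (1 / 2 - η) (1 / 2 + η) with hI
  have hI01 : ∀ t ∈ I, t ∈ Ioo (0 : ℝ) 1 := fun t ht =>
    ⟨by linarith [ht.1], by linarith [ht.2]⟩
  have hder : ∀ t ∈ I, HasDerivWithinAt (fun t => γ t - t • v) (deriv γ t - v) I t := by
    intro t ht
    have h1 : DifferentiableAt ℝ γ t :=
      (hγ.differentiableOn (by simp)).differentiableAt (hmem t (hI01 t ht))
    have h2 : HasDerivAt (fun t : ℝ => t • v) v t := by
      simpa using (hasDerivAt_id t).smul_const v
    exact (h1.hasDerivAt.sub h2).hasDerivWithinAt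
  have hbound : ∀ t ∈ I, ‖deriv γ t - v‖ ≤ ‖v‖ / 4 := by
    intro t ht
    have : dist t (1 / 2) < δ := by
      rw [Real.dist_eq]
      refine lt_of_le_of_lt (abs_le.mpr ⟨?_, ?_⟩) hη2
      · linarith [ht.1]
      · linarith [ht.2]
    rw [← dist_eq_norm]
    exact (hδ' this).le
  -- The mean value inequality for `γ t - t • v`, whose derivative has norm at most `‖v‖ / 4` on
  -- `I`, makes all chords nearly parallel to `v`.
  have hmv : ∀ s ∈ I, ∀ t ∈ I, s ≤ t → ‖(γ t - γ s) - (t - s) • v‖ ≤ ‖v‖ / 4 * (t - s) := by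
    intro s hs t ht hst
    have := (convex_Icc (1 / 2 - η) (1 / 2 + η)).norm_image_sub_le_of_norm_hasDerivWithin_le
      hder hbound hs ht
    rw [Real.norm_eq_abs, abs_of_nonneg (by linarith : 0 ≤ t - s)] at this
    have e : (γ t - γ s) - (t - s) • v = γ t - t • v - (γ s - s • v) := by
      rw [sub_smul]
      abel
    rw [e]
    exact this
  have hlip : ∀ s ∈ I, ∀ t ∈ I, s ≤ t → ‖γ t - γ s‖ ≤ 2 * ‖v‖ * (t - s) := by
    intro s hs t ht hst
    have h1 := hmv s hs t ht hst
    have h2 := norm_add_le ((γ t - γ s) - (t - s) • v) ((t - s) • v)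
    have h0 : 0 ≤ t - s := by linarith
    rw [sub_add_cancel, norm_smul, Real.norm_eq_abs, abs_of_nonneg h0] at h2
    nlinarith [mul_nonneg hvpos.le h0]
  refine ⟨η, ‖v‖ / 4, 2 * ‖v‖, hη0, hη1, by positivity, by positivity, ?_, ?_⟩
  · intro s hs t ht
    rcases le_total s t with h | h
    · rw [norm_sub_rev, abs_sub_comm, abs_of_nonneg (by linarith)]
      exact hlip s hs t ht h
    · rw [abs_of_nonneg (by linarith)]
      exact hlip t ht s hs h
  · intro s hs t ht u hu hst htu
    have h1 := hmv s hs t ht hst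
    have h2 := hmv t ht u hu htu
    constructor
    · have := norm_add_sub_norm_ge (by linarith) (by linarith) h2 h1
      rwa [sub_add_sub_cancel, norm_sub_rev (γ u), norm_sub_rev (γ t)] at this
    · have := norm_add_sub_norm_ge (by linarith) (by linarith) h1 h2
      rwa [add_comm, sub_add_sub_cancel, norm_sub_rev (γ u), norm_sub_rev (γ u)] at this

end Geometry

/-! ### Counting and exponential sums on the grid `k / M` -/

section Grid

theorem card_le_of_diff_le (F : Finset ℕ) {L : ℝ} (hL : 0 ≤ L)
    (h : ∀ k ∈ F, ∀ k' ∈ F, |(k : ℝ) - k'| ≤ L) : (F.card : ℝ) ≤ L + 1 := by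
  rcases F.eq_empty_or_nonempty with rfl | hF
  · simp; linarith
  · set m := F.min' hF with hm
    have hsub : F ⊆ Finset.Icc m (m + ⌊L⌋₊) := by
      intro k hk
      have h1 : m ≤ k := F.min'_le k hk
      have h2 : ((k - m : ℕ) : ℝ) ≤ L := by
        rw [Nat.cast_sub h1]
        exact (le_abs_self _).trans (h k hk m (F.min'_mem hF))
      have h3 : k - m ≤ ⌊L⌋₊ := Nat.le_floor h2
      rw [Finset.mem_Icc]
      omega
    have := Finset.card_le_card hsub
    rw [Nat.card_Icc] at this
    have h4 : (F.card : ℝ) ≤ (⌊L⌋₊ : ℝ) + 1 := by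
      exact_mod_cast (by omega : F.card ≤ ⌊L⌋₊ + 1)
    linarith [Nat.floor_le hL]

/-- The grid points `k / M` of `[0, 1)` at distance at most `ρ` from `c`. -/
noncomputable def gridBall (M : ℕ) (c ρ : ℝ) : Finset ℕ :=
  open Classical in (Finset.range M).filter fun k => |(k : ℝ) / M - c| ≤ ρ

theorem mem_gridBall {M : ℕ} {c ρ : ℝ} {k : ℕ} :
    k ∈ gridBall M c ρ ↔ k < M ∧ |(k : ℝ) / M - c| ≤ ρ := by
  simp [gridBall]

/-- Half of the ball suffices: from the first grid point to the right of `c - ρ`, about `ρ * M`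
further steps stay inside, because the rounding loss is at most `1 ≤ ρ * M`. -/
theorem le_card_gridBall {M : ℕ} {c ρ : ℝ} (hM : 0 < M) (hρ : 0 < ρ) (hρM : 1 ≤ ρ * M)
    (h0 : 0 ≤ c - ρ) (h1 : c + ρ < 1) : ρ * M ≤ (gridBall M c ρ).card := by
  have hM' : (0 : ℝ) < M := by exact_mod_cast hM
  set a := ⌈M * (c - ρ)⌉₊ with ha
  have hsub : (Finset.range (⌊ρ * M⌋₊ + 1)).map (addLeftEmbedding a) ⊆ gridBall M c ρ := by
    intro k hk
    simp only [Finset.mem_map, Finset.mem_range, addLeftEmbedding_apply] at hk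
    obtain ⟨i, hi, rfl⟩ := hk
    have hi' : (i : ℝ) ≤ ρ * M := by
      have : i ≤ ⌊ρ * M⌋₊ := by omega
      exact (Nat.cast_le.mpr this).trans (Nat.floor_le (by positivity))
    have a1 : M * (c - ρ) ≤ a := Nat.le_ceil _
    have a2 : (a : ℝ) < M * (c - ρ) + 1 := Nat.ceil_lt_add_one (by positivity)
    have hi0 : (0 : ℝ) ≤ i := Nat.cast_nonneg _
    have b1 : ((a + i : ℕ) : ℝ) / M ≤ c + ρ := by
      rw [div_le_iff₀ hM']; push_cast; nlinarith
    have b2 : c - ρ ≤ ((a + i : ℕ) : ℝ) / M := by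
      rw [le_div_iff₀ hM']; push_cast; nlinarith
    rw [mem_gridBall]
    refine ⟨?_, abs_le.mpr ⟨by linarith, by linarith⟩⟩
    have : ((a + i : ℕ) : ℝ) < M := by
      rw [div_le_iff₀ hM'] at b1
      nlinarith
    exact_mod_cast this
  have := Finset.card_le_card hsub
  rw [Finset.card_map, Finset.card_range] at this
  have h2 : ((⌊ρ * M⌋₊ + 1 : ℕ) : ℝ) ≤ (gridBall M c ρ).card := by exact_mod_cast this
  push_cast at h2
  linarith [Nat.lt_floor_add_one (ρ * M)]

/-- A geometric sum over powers of an `M`-th root of unity, which is not `1` because `M` cannot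
divide a nonzero `ξ` with `|ξ| < M`. -/
theorem sum_fourier_grid_eq_zero {M : ℕ} (hM : 0 < M) {ξ : ℤ} (h0 : ξ ≠ 0) (h1 : |ξ| < M) :
    ∑ k ∈ Finset.range M, fourier (-ξ) (((k : ℝ) / M : ℝ) : UnitAddCircle) = 0 := by
  have hM' : (M : ℂ) ≠ 0 := by exact_mod_cast hM.ne'
  set z : ℂ := Complex.exp (2 * Real.pi * Complex.I * ((-ξ : ℤ) / M)) with hz
  have hk : ∀ k : ℕ, fourier (-ξ) (((k : ℝ) / M : ℝ) : UnitAddCircle) = z ^ k := by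
    intro k
    rw [fourier_coe_apply, hz, ← Complex.exp_nat_mul]
    congr 1
    push_cast
    ring
  simp only [hk]
  have hz1 : z ≠ 1 := by
    intro h
    obtain ⟨n, hn⟩ := Complex.exp_eq_one_iff.mp h
    have h2 : ((-ξ : ℤ) : ℂ) / M = n := by
      have hpi : (2 * Real.pi * Complex.I : ℂ) ≠ 0 := Complex.two_pi_I_ne_zero
      rw [mul_comm] at hn
      exact mul_right_cancel₀ hpi hn
    have h3 : -ξ = n * M := by
      rw [div_eq_iff hM'] at h2
      exact_mod_cast h2
    have hn0 : n ≠ 0 := by rintro rfl; simp at h3; exact h0 h3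
    have h4 : |ξ| = |n| * M := by
      rw [← abs_neg, h3, abs_mul, Nat.abs_cast]
    have h5 : (1 : ℤ) ≤ |n| := Int.one_le_abs hn0
    nlinarith
  have hzM : z ^ M = 1 := by
    rw [hz, ← Complex.exp_nat_mul]
    rw [Complex.exp_eq_one_iff]
    exact ⟨-ξ, by push_cast; field_simp⟩
  have := mul_geom_sum z M
  rw [hzM, sub_self] at this
  exact (mul_eq_zero.mp this).resolve_left (sub_ne_zero.mpr hz1)

end Grid

/-! ### Confinement of approximate isosceles triples -/

section DistanceMonotone

variable {V : Type*} [NormedAddCommGroup V]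

/-- The distances between points of the curve `γ` with parameters in `I` grow at rate at least
`c` and at most `K`. -/
structure RegularDistances (γ : ℝ → V) (I : Set ℝ) (c K : ℝ) : Prop where
  c_pos : 0 < c
  K_pos : 0 < K
  lipschitz : ∀ s ∈ I, ∀ t ∈ I, ‖γ s - γ t‖ ≤ K * |s - t|
  growth_right : ∀ s ∈ I, ∀ t ∈ I, ∀ u ∈ I, s ≤ t → t ≤ u →
    c * (u - t) ≤ ‖γ s - γ u‖ - ‖γ s - γ t‖
  growth_left : ∀ s ∈ I, ∀ t ∈ I, ∀ u ∈ I, s ≤ t → t ≤ u →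
    c * (t - s) ≤ ‖γ s - γ u‖ - ‖γ t - γ u‖

namespace RegularDistances

variable {γ : ℝ → V} {I : Set ℝ} {c K : ℝ}

/-- The distance from `s` is strictly monotone on each side of `s`. With `s` the apex of a triple,
this confines either of the other two points. -/
theorem growth_same_side (h : RegularDistances γ I c K) {s t u : ℝ} (hs : s ∈ I) (ht : t ∈ I)
    (hu : u ∈ I) (hside : (s ≤ t ∧ s ≤ u) ∨ (t ≤ s ∧ u ≤ s)) :
    c * |t - u| ≤ |‖γ s - γ t‖ - ‖γ s - γ u‖| := by
  wlog htu : t ≤ u generalizing t u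
  · rw [abs_sub_comm t, abs_sub_comm ‖γ s - γ t‖]
    exact this hu ht (hside.imp And.symm And.symm) (le_of_not_ge htu)
  rw [abs_sub_comm t, abs_of_nonneg (sub_nonneg.mpr htu)]
  rcases hside with ⟨h1, h2⟩ | ⟨h1, h2⟩
  · rw [abs_sub_comm]
    exact (h.growth_right s hs t ht u hu h1 htu).trans (le_abs_self _)
  · have := h.growth_left t ht u hu s hs htu h2
    rw [norm_sub_rev (γ t), norm_sub_rev (γ u)] at this
    exact this.trans (le_abs_self _)

/-- As `y` moves from `x` to `z`, the distance to `x` grows and the distance to `z` shrinks, so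
their difference is monotone. One of the two gains already yields the constant. -/
theorem growth_between (h : RegularDistances γ I c K) {x y y' z : ℝ} (hx : x ∈ I) (hy : y ∈ I)
    (hy' : y' ∈ I) (hz : z ∈ I) (h1 : x ≤ y) (h2 : x ≤ y') (h3 : y ≤ z) (h4 : y' ≤ z) :
    c * |y - y'| ≤
      |(‖γ x - γ y‖ - ‖γ y - γ z‖) - (‖γ x - γ y'‖ - ‖γ y' - γ z‖)| := by
  wlog hyy : y ≤ y' generalizing y y'
  · rw [abs_sub_comm y, abs_sub_comm (‖γ x - γ y‖ - _)]
    exact this hy' hy h2 h1 h4 h3 (le_of_not_ge hyy)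
  rw [abs_sub_comm y, abs_of_nonneg (sub_nonneg.mpr hyy), abs_sub_comm]
  have a1 := h.growth_right x hx y hy y' hy' h1 hyy
  have a2 := h.growth_left y hy y' hy' z hz hyy h4
  have a3 : 0 ≤ c * (y' - y) := mul_nonneg h.c_pos.le (sub_nonneg.mpr hyy)
  refine le_trans ?_ (le_abs_self _)
  linarith

/-- Approximate isosceles triples with apex in the second place have their second entry confined
to a short interval. -/
theorem apex_confined (h : RegularDistances γ I c K) {x y y' z ρ l : ℝ} (hx : x ∈ I) (hy : y ∈ I)
    (hy' : y' ∈ I) (hz : z ∈ I) (hl : l < c * ρ) (hρ : ρ ≤ |x - z|)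
    (hside : (x ≤ y ∧ x ≤ y') ∨ (y ≤ x ∧ y' ≤ x)) (hside' : (z ≤ y ∧ z ≤ y') ∨ (y ≤ z ∧ y' ≤ z))
    (hb : |‖γ x - γ y‖ - ‖γ y - γ z‖| ≤ l) (hb' : |‖γ x - γ y'‖ - ‖γ y' - γ z‖| ≤ l) :
    c * |y - y'| ≤ 2 * l := by
  have key : |(‖γ x - γ y‖ - ‖γ y - γ z‖) - (‖γ x - γ y'‖ - ‖γ y' - γ z‖)| ≤ 2 * l := by
    have := abs_sub (‖γ x - γ y‖ - ‖γ y - γ z‖) (‖γ x - γ y'‖ - ‖γ y' - γ z‖)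
    linarith
  -- With both ends on the same side of `y`, the two distances would differ by at least `c * ρ > l`.
  -- So the apex lies between the ends.
  have noside : ¬ ((y ≤ x ∧ y ≤ z) ∨ (x ≤ y ∧ z ≤ y)) := by
    intro hs
    have := h.growth_same_side hy hx hz hs
    rw [norm_sub_rev (γ y) (γ x)] at this
    have h1 := mul_le_mul_of_nonneg_left hρ h.c_pos.le
    linarith
  rcases hside with ⟨h1, h2⟩ | ⟨h1, h2⟩ <;> rcases hside' with ⟨h3, h4⟩ | ⟨h3, h4⟩
  · exact absurd (Or.inr ⟨h1, h3⟩) noside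
  · exact (h.growth_between hx hy hy' hz h1 h2 h3 h4).trans key
  · have := h.growth_between hz hy hy' hx h3 h4 h1 h2
    refine this.trans (le_trans (le_of_eq ?_) key)
    rw [norm_sub_rev (γ z) (γ y), norm_sub_rev (γ y) (γ x), norm_sub_rev (γ z) (γ y'),
      norm_sub_rev (γ y') (γ x), ← abs_neg]
    congr 1
    ring
  · exact absurd (Or.inl ⟨h1, h3⟩) noside

theorem dist_perturb (h : RegularDistances γ I c K) {s s' t t' r : ℝ} (hs : s ∈ I) (hs' : s' ∈ I)
    (ht : t ∈ I) (ht' : t' ∈ I) (h1 : |s - s'| ≤ r) (h2 : |t - t'| ≤ r) :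
    |‖γ s - γ t‖ - ‖γ s' - γ t'‖| ≤ 2 * K * r := by
  have a1 := abs_norm_sub_norm_le (γ s - γ t) (γ s' - γ t')
  have a2 : γ s - γ t - (γ s' - γ t') = (γ s - γ s') - (γ t - γ t') := by abel
  rw [a2] at a1
  have a3 := norm_sub_le (γ s - γ s') (γ t - γ t')
  have a4 := (h.lipschitz s hs s' hs').trans (mul_le_mul_of_nonneg_left h1 h.K_pos.le)
  have a5 := (h.lipschitz t ht t' ht').trans (mul_le_mul_of_nonneg_left h2 h.K_pos.le)
  linarith

end RegularDistances

/-- Two intervals of radius `ρ` whose centres are `3ρ`-separated are ordered. -/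
theorem same_side_of_separated {a b ρ s t u : ℝ} (hab : 3 * ρ ≤ |a - b|) (hs : |s - a| ≤ ρ)
    (ht : |t - b| ≤ ρ) (hu : |u - b| ≤ ρ) : (s ≤ t ∧ s ≤ u) ∨ (t ≤ s ∧ u ≤ s) := by
  rw [abs_le] at hs ht hu
  rcases abs_cases (a - b) with ⟨e, _⟩ | ⟨e, _⟩ <;> rw [e] at hab
  · right; constructor <;> linarith
  · left; constructor <;> linarith

theorem le_abs_sub_of_separated {a b ρ s t : ℝ} (hab : 3 * ρ ≤ |a - b|) (hs : |s - a| ≤ ρ)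
    (ht : |t - b| ≤ ρ) : ρ ≤ |s - t| := by
  have : a - b = -(s - a) + (s - t) + (t - b) := by ring
  rw [this] at hab
  have := abs_add_three (-(s - a)) (s - t) (t - b)
  rw [abs_neg] at this
  linarith

end DistanceMonotone

/-! ### Avoiding samples taken from grid points on the curve -/

section GridPoints

variable {V : Type*} [NormedAddCommGroup V]

/-- Three well separated intervals of radius `ρ` inside `I`. -/
structure IsSeparatedTriple (I : Set ℝ) (a : Fin 3 → ℝ) (ρ : ℝ) : Prop where
  pos : 0 < ρ
  subset : ∀ i, Icc (a i - ρ) (a i + ρ) ⊆ I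
  sep : ∀ i j, i ≠ j → 3 * ρ ≤ |a i - a j|

theorem IsSeparatedTriple.mem {I : Set ℝ} {a : Fin 3 → ℝ} {ρ : ℝ} (h : IsSeparatedTriple I a ρ)
    {i : Fin 3} {s : ℝ} (hs : |s - a i| ≤ ρ) : s ∈ I := by
  rw [abs_le] at hs
  exact h.subset i ⟨by linarith, by linarith⟩

theorem sum_boole_le_of_diff_le (G : Finset ℕ) (p : ℕ → Prop) (f : ℕ → ℝ)
    (hf : ∀ k, f k = open Classical in if p k then 1 else 0) {M : ℕ} (hM : 0 < M)
    {L : ℝ} (hL : 0 ≤ L) (h : ∀ k ∈ G, ∀ k' ∈ G, p k → p k' → |(k : ℝ) / M - k' / M| ≤ L) :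
    ∑ k ∈ G, f k ≤ L * M + 1 := by
  classical
  have hM' : (0 : ℝ) < M := by exact_mod_cast hM
  simp only [hf]
  rw [Finset.sum_boole]
  refine card_le_of_diff_le _ (by positivity) fun k hk k' hk' => ?_
  rw [Finset.mem_filter] at hk hk'
  have := h k hk.1 k' hk'.1 hk.2 hk'.2
  rwa [← sub_div, abs_div, abs_of_pos hM', div_le_iff₀ hM'] at this

set_option maxHeartbeats 1000000 in
/-- Existence of weighted grid points with small exponential sums and no approximate isosceles
configuration, under explicit numerical conditions. -/
theorem exists_grid_points_of_bounds {γ : ℝ → V} {I : Set ℝ} {c K : ℝ}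
    (h : RegularDistances γ I c K) (hI : I ⊆ Icc (1 / 4) (3 / 4)) {a : Fin 3 → ℝ} {ρ : ℝ}
    (ha : IsSeparatedTriple I a ρ) {N M : ℕ} {r σ t : ℝ} (hN : 4 ≤ N) (hM : 0 < M) (hr : 0 < r)
    (hrρ : r ≤ ρ / 2) (hrM : 1 ≤ r * M) (hKr : 4 * K * r < c * ρ)
    (hσ : σ = (16 * K / c + 1) * r / ρ) (hNσ : 2 * N ^ 2 * σ < 1)
    (ht : 2 * (Real.log (16 * (2 * M + 1)) + 4) / √N = t) (hsmall : t + 9 * (N ^ 2 * σ) ^ 2 < 1) :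
    ∃ (w : Fin 4 → ℝ) (q : Fin 4 → ℕ → ℝ), (∀ i, 0 ≤ w i) ∧ ∑ i, w i = 1 ∧
      (∀ i j, q i j ∈ Ico (0 : ℝ) 1) ∧
      (∀ ξ : ℤ, ξ ≠ 0 → |ξ| < M → ‖∑ i, (w i : ℂ) *
        ((∑ j ∈ Finset.range N, fourier (-ξ) (q i j : UnitAddCircle)) / N)‖ ≤
          3 * t + 18 * (N ^ 2 * σ) ^ 2) ∧
      ∀ s : Fin 3 → ℝ, (∀ i, |s i - a i| ≤ ρ / 2) →
        (∀ i, ∃ i', ∃ j < N, |s i - q i' j| ≤ r) →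
        ‖γ (s 0) - γ (s 1)‖ ≠ ‖γ (s 1) - γ (s 2)‖ := by
  classical
  have hM' : (0 : ℝ) < M := by exact_mod_cast hM
  have hMC : (M : ℂ) ≠ 0 := by exact_mod_cast hM.ne'
  have hρ := ha.pos
  have hc := h.c_pos
  have hK := h.K_pos
  have hρM : 1 ≤ ρ * M := by nlinarith
  set G : Fin 3 → Finset ℕ := fun i => gridBall M (a i) ρ with hG
  have hGmem : ∀ i k, k ∈ G i → |(k : ℝ) / M - a i| ≤ ρ := fun i k hk => (mem_gridBall.mp hk).2
  have hcard : ∀ i, ρ * M ≤ (G i).card := fun i => by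
    have h1 := hI (ha.subset i (left_mem_Icc.mpr (by linarith)))
    have h2 := hI (ha.subset i (right_mem_Icc.mpr (by linarith)))
    exact le_card_gridBall hM hρ hρM (by linarith [h1.1]) (by linarith [h2.2])
  have hcpos : ∀ i, (0 : ℝ) < (G i).card := fun i => by linarith [hcard i]
  have hGne : ∀ i, (G i).Nonempty := fun i => Finset.card_pos.mp (by exact_mod_cast hcpos i)
  have hdisj : ∀ i j, i ≠ j → ∀ k, k ∈ G i → k ∉ G j := fun i j hij k hi hj => by
    have := le_abs_sub_of_separated (ha.sep i j hij) (hGmem i k hi) (hGmem j k hj)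
    simp at this
    linarith
  have hσ0 : 0 < σ := by rw [hσ]; positivity
  -- This fixes `σ`: the left side bounds the number of grid points in an interval of length `16 K r
  -- / c`, each family has at least `ρ * M` members, and the extra `1` is absorbed by `r * M ≥ 1`.
  have hσcard : ∀ i, (16 * K / c) * r * M + 1 ≤ σ * (G i).card := fun i => by
    have h1 : σ * (ρ * M) ≤ σ * (G i).card := mul_le_mul_of_nonneg_left (hcard i) hσ0.le
    have h2 : σ * (ρ * M) = (16 * K / c) * r * M + r * M := by
      rw [hσ]; field_simp
    linarith
  have hσcard' : ∀ i, (8 * K / c * r) * M + 1 ≤ σ * (G i).card := fun i => by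
    refine le_trans ?_ (hσcard i)
    have : 0 ≤ K / c * r * M := by positivity
    have e1 : 8 * K / c * r * M = 8 * (K / c * r * M) := by ring
    have e2 : 16 * K / c * r * M = 16 * (K / c * r * M) := by ring
    rw [e1, e2]
    linarith
  -- The tolerance `4 K r` lets each of the two distances change by `2 K r`, as happens when
  -- parameters move by at most `r`.
  set b : ℕ → ℕ → ℕ → Prop := fun x y z =>
    |‖γ ((x : ℝ) / M) - γ ((y : ℝ) / M)‖ - ‖γ ((y : ℝ) / M) - γ ((z : ℝ) / M)‖| ≤ 4 * K * r with hb
  have hconf : ∀ {u v : ℝ}, c * |u - v| ≤ 2 * (4 * K * r) → |u - v| ≤ 8 * K / c * r := by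
    intro u v huv
    rw [show 8 * K / c * r = (8 * K * r) / c by ring, le_div_iff₀ hc]
    linarith
  have hI' : ∀ i k, k ∈ G i → (k : ℝ) / M ∈ I := fun i k hk => ha.mem (hGmem i k hk)
  have hL0 : 0 ≤ 8 * K / c * r := by positivity
  set near : ℕ → ℕ → Prop := fun x x' => |(x : ℝ) / M - x' / M| ≤ 8 * K / c * r with hnear
  have h₃ : ∀ x ∈ G 0, ∀ y ∈ G 1, ∑ z ∈ G 2, (badCount b x y z : ℝ) ≤ σ * (G 2).card := by
    intro x hx y hy
    refine (sum_boole_le_of_diff_le (G 2) (b x y) _ (fun k => by simp [badCount]) hM hL0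
      fun z hz z' hz' hbz hbz' => hconf ?_).trans (hσcard' 2)
    have := h.growth_same_side (hI' 1 y hy) (hI' 2 z hz) (hI' 2 z' hz')
      (same_side_of_separated (ha.sep 1 2 (by decide)) (hGmem 1 y hy) (hGmem 2 z hz)
        (hGmem 2 z' hz'))
    refine this.trans ?_
    rw [hb] at hbz hbz'
    rw [abs_le] at hbz hbz' ⊢
    constructor <;> linarith [hbz.1, hbz.2, hbz'.1, hbz'.2]
  have h₂ : ∀ x ∈ G 0, ∀ z ∈ G 2, ∑ y ∈ G 1, (badCount b x y z : ℝ) ≤ σ * (G 1).card := by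
    intro x hx z hz
    refine (sum_boole_le_of_diff_le (G 1) (fun y => b x y z) _ (fun k => by simp [badCount]) hM hL0
      fun y hy y' hy' hby hby' => hconf ?_).trans (hσcard' 1)
    exact h.apex_confined (hI' 0 x hx) (hI' 1 y hy) (hI' 1 y' hy') (hI' 2 z hz) hKr
      (le_abs_sub_of_separated (ha.sep 0 2 (by decide)) (hGmem 0 x hx) (hGmem 2 z hz))
      (same_side_of_separated (ha.sep 0 1 (by decide)) (hGmem 0 x hx) (hGmem 1 y hy)
        (hGmem 1 y' hy'))
      (same_side_of_separated (ha.sep 2 1 (by decide)) (hGmem 2 z hz) (hGmem 1 y hy)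
        (hGmem 1 y' hy')) hby hby'
  -- Points near a common `x` are within twice that distance of each other, hence `16` instead of
  -- `8` in `σ`.
  have h₁ : ∀ x ∈ G 0, (((G 0).filter (fun x' => near x x')).card : ℝ) ≤ σ * (G 0).card := by
    intro x hx
    have := sum_boole_le_of_diff_le (G 0) (fun x' => near x x')
      (fun x' => if near x x' then (1 : ℝ) else 0) (fun k => by simp) hM
      (L := 2 * (8 * K / c * r)) (by positivity)
      fun k hk k' hk' h1 h2 => by
        have e : (k : ℝ) / M - k' / M = ((x : ℝ) / M - k' / M) - ((x : ℝ) / M - k / M) := by ring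
        rw [e]
        refine (abs_sub _ _).trans ?_
        simp only [hnear] at h1 h2
        linarith
    rw [Finset.sum_boole] at this
    refine this.trans (le_trans (le_of_eq ?_) (hσcard 0))
    ring
  have hnear' : ∀ x ∈ G 0, ∀ x' ∈ G 0, ∀ y ∈ G 1, ∀ z ∈ G 2, b x y z → b x' y z → near x x' := by
    intro x hx x' hx' y hy z hz hbx hbx'
    refine hconf ?_
    have := h.growth_same_side (hI' 1 y hy) (hI' 0 x hx) (hI' 0 x' hx')
      (same_side_of_separated (ha.sep 1 0 (by decide)) (hGmem 1 y hy) (hGmem 0 x hx)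
        (hGmem 0 x' hx'))
    refine this.trans ?_
    rw [hb] at hbx hbx'
    rw [norm_sub_rev (γ ((y : ℝ) / M)) (γ ((x : ℝ) / M)),
      norm_sub_rev (γ ((y : ℝ) / M)) (γ ((x' : ℝ) / M))]
    rw [abs_le] at hbx hbx' ⊢
    constructor <;> linarith [hbx.1, hbx.2, hbx'.1, hbx'.2]
  set Q : Finset ℤ := Finset.Icc (-M : ℤ) M with hQ
  have hQcard : (Q.card : ℝ) = 2 * M + 1 := by
    have : Q.card = 2 * M + 1 := by rw [hQ, Int.card_Icc]; omega
    rw [this]; push_cast; ring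
  have h0Q : (0 : ℤ) ∈ Q := by simp [hQ]
  set e : ℤ → ℕ → ℂ := fun ξ k => fourier (-ξ) (((k : ℝ) / M : ℝ) : UnitAddCircle) with he
  have he1 : ∀ ξ k, ‖e ξ k‖ ≤ 1 := fun ξ k => by
    simp only [he, fourier_apply, Circle.norm_coe, le_refl]
  rw [← hQcard] at ht
  obtain ⟨x, y, z, hx, hy, hz, havoid, ex, ey, ez⟩ := exists_avoiding_samples (G 0) (G 1) (G 2)
    (hGne 0) (hGne 1) (hGne 2) b near hσ0 h₃ h₂ h₁ hnear' Q e (fun ξ _ k => he1 ξ k) h0Q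
    (fun k => by simp [he]) hN hNσ ht hsmall
  -- The remaining grid points form a fourth family, sampled without constraint. With weights
  -- proportional to the sizes, the four uniform averages recombine to the full grid, whose
  -- exponential sums vanish; only sampling errors are left.
  set G' : Finset ℕ := Finset.range M \ (G 0 ∪ G 1 ∪ G 2) with hG'
  have h0G' : 0 ∈ G' := by
    have h0 : ∀ i, 0 ∉ G i := fun i hi => by
      have := (hI (hI' i 0 hi)).1
      norm_num at this
    simp [hG', h0, hM]
  have hc' : (0 : ℝ) < G'.card := by exact_mod_cast Finset.card_pos.mpr ⟨0, h0G'⟩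
  obtain ⟨u, hu, eu, -⟩ := exists_sample_complex G' (fun _ => (G'.card : ℝ)⁻¹)
    (fun _ _ => by positivity)
    (by rw [Finset.sum_const, nsmul_eq_mul, mul_inv_cancel₀ hc'.ne']) Q ⟨0, h0Q⟩ e
    (fun ξ _ k _ => he1 ξ k) (fun _ _ => 0) (fun _ _ _ _ => le_rfl) one_pos
    (fun _ _ => by simp) hN
  have ht8 : 2 * (Real.log (8 * Q.card) + 4) / √N ≤ t := by
    have : (0 : ℝ) < Q.card := by rw [hQcard]; positivity
    rw [← ht]
    gcongr
    norm_num
  have eu' : ∀ ξ ∈ Q, ‖(∑ j ∈ Finset.range N, e ξ (u j)) / N - (∑ k ∈ G', e ξ k) / G'.card‖ ≤ t := by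
    intro ξ hξ
    have := (eu ξ hξ).trans ht8
    rw [← Finset.mul_sum] at this
    push_cast at this
    rwa [← div_eq_inv_mul] at this
  have hGsub : ∀ i, G i ⊆ Finset.range M := fun i k hk =>
    Finset.mem_range.mpr (mem_gridBall.mp hk).1
  have hsplit : ∀ f : ℕ → ℂ, ∑ k ∈ Finset.range M, f k =
      ∑ k ∈ G 0, f k + ∑ k ∈ G 1, f k + ∑ k ∈ G 2, f k + ∑ k ∈ G', f k := by
    intro f
    have d1 : Disjoint (G 0) (G 1) := Finset.disjoint_left.mpr fun k => hdisj 0 1 (by decide) k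
    have d2 : Disjoint (G 0 ∪ G 1) (G 2) := by
      rw [Finset.disjoint_union_left]
      exact ⟨Finset.disjoint_left.mpr fun k => hdisj 0 2 (by decide) k,
        Finset.disjoint_left.mpr fun k => hdisj 1 2 (by decide) k⟩
    have hsub : G 0 ∪ G 1 ∪ G 2 ⊆ Finset.range M :=
      Finset.union_subset (Finset.union_subset (hGsub 0) (hGsub 1)) (hGsub 2)
    rw [← Finset.sum_union d1, ← Finset.sum_union d2, hG', add_comm, Finset.sum_sdiff hsub]
  have hcards : (M : ℝ) = (G 0).card + (G 1).card + (G 2).card + G'.card := by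
    have := hsplit (fun _ => 1)
    simp only [Finset.sum_const, nsmul_eq_mul, mul_one, Finset.card_range] at this
    exact_mod_cast this
  set k : Fin 4 → ℕ → ℕ := ![x, y, z, u] with hk
  have hkM : ∀ i j, k i j < M := by
    intro i j
    fin_cases i
    · exact Finset.mem_range.mp (hGsub 0 (hx j))
    · exact Finset.mem_range.mp (hGsub 1 (hy j))
    · exact Finset.mem_range.mp (hGsub 2 (hz j))
    · exact Finset.mem_range.mp (Finset.mem_sdiff.mp (hu j).1).1
  refine ⟨![(G 0).card / M, (G 1).card / M, (G 2).card / M, G'.card / M],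
    fun i j => (k i j : ℝ) / M, ?_, ?_, ?_, ?_, ?_⟩
  · intro i
    fin_cases i <;> simp <;> positivity
  · simp only [Fin.sum_univ_four, Matrix.cons_val_zero, Matrix.cons_val_one, Matrix.cons_val]
    rw [← add_div, ← add_div, ← add_div, ← hcards, div_self hM'.ne']
  · intro i j
    refine ⟨by positivity, ?_⟩
    rw [div_lt_one hM']
    exact_mod_cast hkM i j
  · intro ξ hξ0 hξM
    have hξQ : ξ ∈ Q := by
      rw [hQ, Finset.mem_Icc]
      exact abs_le.mp hξM.le
    have hzero := sum_fourier_grid_eq_zero hM hξ0 hξM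
    have hzero' : ∑ k ∈ G 0, e ξ k + ∑ k ∈ G 1, e ξ k + ∑ k ∈ G 2, e ξ k + ∑ k ∈ G', e ξ k = 0 := by
      rw [← hsplit]; exact hzero
    simp only [Fin.sum_univ_four, Matrix.cons_val_zero, Matrix.cons_val_one, Matrix.cons_val, hk]
    change ‖_ * ((∑ j ∈ Finset.range N, e ξ (x j)) / N) + _ * ((∑ j ∈ Finset.range N, e ξ (y j)) / N)
      + _ * ((∑ j ∈ Finset.range N, e ξ (z j)) / N) + _ * ((∑ j ∈ Finset.range N, e ξ (u j)) / N)‖ ≤ _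
    have bx := ex ξ hξQ
    have by' := ey ξ hξQ
    have bz := ez ξ hξQ
    have bu := eu' ξ hξQ
    set B := 3 * t + 18 * (N ^ 2 * σ) ^ 2 with hB
    have ht0 : 0 ≤ t := (norm_nonneg _).trans bx
    have hBt : t ≤ B := by
      have : 0 ≤ (N ^ 2 * σ) ^ 2 := by positivity
      linarith
    have hBz : t + 2 * (t + 9 * (N ^ 2 * σ) ^ 2) ≤ B := by linarith
    have hw : ∀ (n : ℕ) (A Z : ℂ), (0 : ℝ) < n → ‖A - Z / n‖ ≤ B →
        ‖((n / M : ℝ) : ℂ) * A - Z / M‖ ≤ (n / M) * B := by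
      intro n A Z hn hA
      have hn' : (n : ℂ) ≠ 0 := by exact_mod_cast hn.ne'
      have : ((n / M : ℝ) : ℂ) * A - Z / M = ((n / M : ℝ) : ℂ) * (A - Z / n) := by
        push_cast; field_simp
      rw [this, norm_mul, Complex.norm_real, Real.norm_eq_abs, abs_of_nonneg (by positivity)]
      exact mul_le_mul_of_nonneg_left hA (by positivity)
    have c1 := hw _ _ _ (hcpos 0) (bx.trans hBt)
    have c2 := hw _ _ _ (hcpos 1) (by'.trans hBt)
    have c3 := hw _ _ _ (hcpos 2) (bz.trans hBz)
    have c4 := hw _ _ _ hc' (bu.trans hBt)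
    set A1 := (((G 0).card / M : ℝ) : ℂ) * ((∑ j ∈ Finset.range N, e ξ (x j)) / N)
    set A2 := (((G 1).card / M : ℝ) : ℂ) * ((∑ j ∈ Finset.range N, e ξ (y j)) / N)
    set A3 := (((G 2).card / M : ℝ) : ℂ) * ((∑ j ∈ Finset.range N, e ξ (z j)) / N)
    set A4 := ((G'.card / M : ℝ) : ℂ) * ((∑ j ∈ Finset.range N, e ξ (u j)) / N)
    have hdec : A1 + A2 + A3 + A4 = (A1 - (∑ k ∈ G 0, e ξ k) / M) + (A2 - (∑ k ∈ G 1, e ξ k) / M)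
        + (A3 - (∑ k ∈ G 2, e ξ k) / M) + (A4 - (∑ k ∈ G', e ξ k) / M) := by
      have : ((∑ k ∈ G 0, e ξ k + ∑ k ∈ G 1, e ξ k + ∑ k ∈ G 2, e ξ k + ∑ k ∈ G', e ξ k) : ℂ) / M
        = 0 := by rw [hzero', zero_div]
      rw [add_div, add_div, add_div] at this
      linear_combination this
    rw [hdec]
    refine norm_add₄_le.trans ?_
    have hone : (G 0).card / M + (G 1).card / M + (G 2).card / M + G'.card / M = (1 : ℝ) := by
      rw [← add_div, ← add_div, ← add_div, ← hcards, div_self hM'.ne']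
    calc _ ≤ (G 0).card / M * B + (G 1).card / M * B + (G 2).card / M * B + G'.card / M * B := by
          linarith
      _ = B := by rw [← add_mul, ← add_mul, ← add_mul, hone, one_mul]
  · intro s hs hq heq
    have hlast : ∀ i j, u j ∉ G i := by
      intro i j hj
      have := (Finset.mem_sdiff.mp (hu j).1).2
      apply this
      fin_cases i
      · exact Finset.mem_union_left _ (Finset.mem_union_left _ hj)
      · exact Finset.mem_union_left _ (Finset.mem_union_right _ hj)
      · exact Finset.mem_union_right _ hj
    -- A sample within `r ≤ ρ / 2` of `s i` lies in the ball of radius `ρ` about `a i`. The four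
    -- sets are disjoint, so it comes from the family of index `i`.
    have hloc : ∀ i : Fin 3, ∃ j < N, |s i - (k i.castSucc j : ℝ) / M| ≤ r ∧ k i.castSucc j ∈ G i := by
      intro i
      obtain ⟨i', j, hj, hle⟩ := hq i
      have hmem : k i' j ∈ G i := by
        refine mem_gridBall.mpr ⟨hkM i' j, ?_⟩
        have : (k i' j : ℝ) / M - a i = (s i - a i) - (s i - (k i' j : ℝ) / M) := by ring
        rw [this]
        refine (abs_sub _ _).trans ?_
        linarith [hs i]
      have hi' : i' = i.castSucc := by
        by_contra hne
        have hk0 : k 0 j ∈ G 0 := hx j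
        have hk1 : k 1 j ∈ G 1 := hy j
        have hk2 : k 2 j ∈ G 2 := hz j
        have hk3 : ∀ i, k 3 j ∉ G i := fun i => hlast i j
        fin_cases i' <;> fin_cases i <;>
          first
          | exact hne rfl
          | exact hk3 _ hmem
          | exact hdisj _ _ (by decide) _ hk0 hmem
          | exact hdisj _ _ (by decide) _ hk1 hmem
          | exact hdisj _ _ (by decide) _ hk2 hmem
      subst hi'
      exact ⟨j, hj, hle, hmem⟩
    obtain ⟨j0, hj0, d0, m0⟩ := hloc 0
    obtain ⟨j1, hj1, d1, m1⟩ := hloc 1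
    obtain ⟨j2, hj2, d2, m2⟩ := hloc 2
    have hsI : ∀ i, s i ∈ I := fun i => ha.mem ((hs i).trans (by linarith))
    have hnb := havoid j0 hj0 j1 hj1 j2 hj2
    apply hnb
    have p1 := h.dist_perturb (hsI 0) (hI' 0 _ m0) (hsI 1) (hI' 1 _ m1) d0 d1
    have p2 := h.dist_perturb (hsI 1) (hI' 1 _ m1) (hsI 2) (hI' 2 _ m2) d1 d2
    change |‖γ ((k 0 j0 : ℝ) / M) - γ ((k 1 j1 : ℝ) / M)‖ -
      ‖γ ((k 1 j1 : ℝ) / M) - γ ((k 2 j2 : ℝ) / M)‖| ≤ 4 * K * r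
    rw [heq] at p1
    simp only [Fin.castSucc_zero, Fin.castSucc_one] at p1 p2
    change |‖γ (s 1) - γ (s 2)‖ - ‖γ ((k 0 j0 : ℝ) / M) - γ ((k 1 j1 : ℝ) / M)‖| ≤ _ at p1
    change |‖γ (s 1) - γ (s 2)‖ - ‖γ ((k 1 j1 : ℝ) / M) - γ ((k 2 j2 : ℝ) / M)‖| ≤ _ at p2
    rw [abs_le] at p1 p2 ⊢
    constructor <;> linarith [p1.1, p1.2, p2.1, p2.2]

end GridPoints

/-! ### Choice of the scales `r = N ^ (-9/4)` and `M = N ^ 3` -/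

section GridAsymptotics

open Filter Topology

variable {V : Type*} [NormedAddCommGroup V]

theorem eventually_log_cube_add_const_le (B : ℝ) {ε : ℝ} (hε : 0 < ε) :
    ∀ᶠ N : ℕ in atTop, 6 * (Real.log (16 * (2 * (N : ℝ) ^ 3 + 1)) + 4) + B ≤ (N : ℝ) ^ ε := by
  have h1 : ∀ᶠ N : ℕ in atTop, Real.log N ≤ (1 / 36) * (N : ℝ) ^ ε := by
    have := (isLittleO_log_rpow_atTop hε).bound (show (0 : ℝ) < 1 / 36 by norm_num)
    filter_upwards [tendsto_natCast_atTop_atTop.eventually this,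
      eventually_ge_atTop 1] with N hN hN1
    rw [Real.norm_eq_abs, Real.norm_eq_abs, abs_of_nonneg (by positivity : (0 : ℝ) ≤ (N : ℝ) ^ ε)]
      at hN
    exact (le_abs_self _).trans hN
  have h2 : ∀ᶠ N : ℕ in atTop, 2 * (6 * (Real.log 48 + 4) + B) ≤ (N : ℝ) ^ ε :=
    ((tendsto_rpow_atTop hε).comp tendsto_natCast_atTop_atTop).eventually_ge_atTop _
  filter_upwards [h1, h2, eventually_ge_atTop 1] with N hN1 hN2 hN
  have hN' : (1 : ℝ) ≤ N := by exact_mod_cast hN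
  have hcube : (1 : ℝ) ≤ (N : ℝ) ^ 3 := one_le_pow₀ hN'
  have h3 : Real.log (16 * (2 * (N : ℝ) ^ 3 + 1)) ≤ Real.log 48 + 3 * Real.log N := by
    calc _ ≤ Real.log (48 * (N : ℝ) ^ 3) := Real.log_le_log (by positivity) (by linarith)
      _ = Real.log 48 + 3 * Real.log N := by
        rw [Real.log_mul (by norm_num) (by positivity), Real.log_pow]
        norm_num
  linarith

/-- For large `N` there are `4 * N` weighted points with exponential sums of size at most
`N ^ (-1/2 + ε)` and no approximate isosceles configuration at scale `N ^ (-9/4)`. -/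
theorem eventually_exists_grid_points {γ : ℝ → V} {I : Set ℝ} {c K : ℝ}
    (h : RegularDistances γ I c K) (hI : I ⊆ Icc (1 / 4) (3 / 4)) {a : Fin 3 → ℝ} {ρ : ℝ}
    (ha : IsSeparatedTriple I a ρ) {ε : ℝ} (hε : 0 < ε) :
    ∀ᶠ N : ℕ in atTop, ∃ (w : Fin 4 → ℝ) (q : Fin 4 → ℕ → ℝ), (∀ i, 0 ≤ w i) ∧ ∑ i, w i = 1 ∧
      (∀ i j, q i j ∈ Ico (0 : ℝ) 1) ∧
      (∀ ξ : ℤ, ξ ≠ 0 → |ξ| < (N ^ 3 : ℕ) → ‖∑ i, (w i : ℂ) *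
        ((∑ j ∈ Finset.range N, fourier (-ξ) (q i j : UnitAddCircle)) / N)‖ ≤
          (N : ℝ) ^ (-(1 / 2) + ε)) ∧
      ∀ s : Fin 3 → ℝ, (∀ i, |s i - a i| ≤ ρ / 2) →
        (∀ i, ∃ i', ∃ j < N, |s i - q i' j| ≤ (N : ℝ) ^ (-(9 / 4) : ℝ)) →
        ‖γ (s 0) - γ (s 1)‖ ≠ ‖γ (s 1) - γ (s 2)‖ := by
  have hρ := ha.pos
  have hc := h.c_pos
  have hK := h.K_pos
  set C := (16 * K / c + 1) / ρ with hC
  have hC0 : 0 < C := by positivity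
  have hlim : ∀ y : ℝ, 0 < y → Tendsto (fun N : ℕ => (N : ℝ) ^ (-y)) atTop (𝓝 0) := fun y hy =>
    (tendsto_rpow_neg_atTop hy).comp tendsto_natCast_atTop_atTop
  -- The cap at `1/4` keeps the total error at most `N ^ (-1/4) < 1`, as the thinning requires.
  set ε' := min ε (1 / 4) with hε'
  have hε'0 : 0 < ε' := by positivity
  filter_upwards [eventually_ge_atTop 4,
    (hlim (9 / 4) (by norm_num)).eventually_lt_const (show 0 < ρ / 2 by positivity),
    (hlim (9 / 4) (by norm_num)).eventually_lt_const (show 0 < c * ρ / (4 * K) by positivity),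
    (hlim (1 / 4) (by norm_num)).eventually_lt_const (show 0 < 1 / (2 * C) by positivity),
    eventually_log_cube_add_const_le (18 * C ^ 2) hε'0] with N hN h1 h2 h3 h4
  have hN' : (4 : ℝ) ≤ N := by exact_mod_cast hN
  have hN0 : (0 : ℝ) < N := by linarith
  set r := (N : ℝ) ^ (-(9 / 4) : ℝ) with hr
  have hr0 : 0 < r := Real.rpow_pos_of_pos hN0 _
  have hN2r : (N : ℝ) ^ 2 * r = (N : ℝ) ^ (-(1 / 4) : ℝ) := by
    rw [hr, ← Real.rpow_natCast, ← Real.rpow_add hN0]; norm_num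
  have hN3r : r * (N : ℝ) ^ 3 = (N : ℝ) ^ (3 / 4 : ℝ) := by
    rw [hr, ← Real.rpow_natCast, ← Real.rpow_add hN0]; norm_num
  set σ := (16 * K / c + 1) * r / ρ with hσ
  have hσC : (N : ℝ) ^ 2 * σ = C * (N : ℝ) ^ (-(1 / 4) : ℝ) := by
    rw [← hN2r, hσ, hC]; ring
  -- The origin of the exponent `9/4`: the second-order thinning error has the order `N ^ (-1/2)` of
  -- the sampling error.
  have hσC2 : ((N : ℝ) ^ 2 * σ) ^ 2 = C ^ 2 * (N : ℝ) ^ (-(1 / 2) : ℝ) := by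
    rw [hσC, mul_pow, ← Real.rpow_natCast (_ ^ _), ← Real.rpow_mul hN0.le]; norm_num
  have hsq : ∀ y : ℝ, y / √N = y * (N : ℝ) ^ (-(1 / 2) : ℝ) := fun y => by
    rw [Real.sqrt_eq_rpow, Real.rpow_neg hN0.le, div_eq_mul_inv]
  set t := 2 * (Real.log (16 * (2 * ((N ^ 3 : ℕ) : ℝ) + 1)) + 4) / √N with ht
  have hhalf : 0 < (N : ℝ) ^ (-(1 / 2) : ℝ) := Real.rpow_pos_of_pos hN0 _
  have htot : 3 * t + 18 * (N ^ 2 * σ) ^ 2 ≤ (N : ℝ) ^ (-(1 / 2) + ε') := by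
    rw [ht, hsq, hσC2, Real.rpow_add hN0]
    push_cast
    calc _ = (N : ℝ) ^ (-(1 / 2) : ℝ) * (6 * (Real.log (16 * (2 * (N : ℝ) ^ 3 + 1)) + 4)
            + 18 * C ^ 2) := by ring
      _ ≤ _ := mul_le_mul_of_nonneg_left h4 hhalf.le
  have ht0 : 0 ≤ t := by
    rw [ht]
    have : 0 ≤ Real.log (16 * (2 * ((N ^ 3 : ℕ) : ℝ) + 1)) := Real.log_nonneg (by
      have : (0 : ℝ) ≤ ((N ^ 3 : ℕ) : ℝ) := Nat.cast_nonneg _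
      linarith)
    positivity
  have hsmall : t + 9 * (N ^ 2 * σ) ^ 2 < 1 := by
    have e1 : (N : ℝ) ^ (-(1 / 2) + ε') ≤ (N : ℝ) ^ (-(1 / 4) : ℝ) :=
      Real.rpow_le_rpow_of_exponent_le (by linarith) (by linarith [min_le_right ε (1 / 4)])
    have e2 : (N : ℝ) ^ (-(1 / 4) : ℝ) < 1 :=
      Real.rpow_lt_one_of_one_lt_of_neg (by linarith) (by norm_num)
    have e3 : 0 ≤ (N ^ 2 * σ) ^ 2 := by positivity
    linarith
  have hNσ : 2 * (N : ℝ) ^ 2 * σ < 1 := by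
    rw [mul_assoc, hσC]
    rw [lt_div_iff₀ (by positivity)] at h3
    linarith
  -- A polynomial grid size costs only a logarithm, and `3 > 9/4` gives `r * M ≥ 1`.
  obtain ⟨w, q, hw0, hw1, hq, hξ, hav⟩ := exists_grid_points_of_bounds h hI ha hN
    (M := N ^ 3) (by positivity) hr0 h1.le
    (by
      push_cast
      rw [hN3r]
      exact Real.one_le_rpow (by linarith) (by norm_num))
    (by rw [lt_div_iff₀ (by positivity)] at h2; linarith) hσ hNσ ht.symm hsmall
  refine ⟨w, q, hw0, hw1, hq, fun ξ h0 hM => (hξ ξ h0 hM).trans (htot.trans ?_), hav⟩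
  exact Real.rpow_le_rpow_of_exponent_le (by linarith) (by linarith [min_le_left ε (1 / 4)])

end GridAsymptotics

/-! ### Fourier coefficients on the circle and of the tent function -/

section Tent

open AddCircle

theorem norm_fourier_apply (n : ℤ) (x : UnitAddCircle) : ‖fourier n x‖ = 1 := by
  simp only [fourier_apply, Circle.norm_coe]

theorem fourier_apply_add (n : ℤ) (x y : UnitAddCircle) :
    fourier n (x + y) = fourier n x * fourier n y := by
  simp only [fourier_apply, smul_add, AddCircle.toCircle_add, Circle.coe_mul]

/-- The Fourier coefficients of a real-valued function on the circle. -/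
noncomputable def realFourierCoeff (f : UnitAddCircle → ℝ) (n : ℤ) : ℂ :=
  fourierCoeff (fun x => (f x : ℂ)) n

theorem integrable_of_continuous {E : Type*} [NormedAddCommGroup E] {f : UnitAddCircle → E}
    (hf : Continuous f) {μ : Measure UnitAddCircle} [IsFiniteMeasure μ] : Integrable f μ :=
  hf.integrable_of_hasCompactSupport (HasCompactSupport.of_compactSpace f)

theorem realFourierCoeff_zero (f : UnitAddCircle → ℝ) :
    realFourierCoeff f 0 = ((∫ x, f x ∂haarAddCircle : ℝ) : ℂ) := by
  rw [realFourierCoeff, fourierCoeff, ← integral_complex_ofReal]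
  simp

theorem norm_realFourierCoeff_le {f : UnitAddCircle → ℝ} (hf : ∀ x, 0 ≤ f x) (n : ℤ) :
    ‖realFourierCoeff f n‖ ≤ ∫ x, f x ∂haarAddCircle := by
  rw [realFourierCoeff, fourierCoeff]
  refine (norm_integral_le_integral_norm _).trans (le_of_eq ?_)
  refine integral_congr_ae (Filter.Eventually.of_forall fun x => ?_)
  simp only [norm_smul, norm_fourier_apply, one_mul, Complex.norm_real, Real.norm_eq_abs,
    abs_of_nonneg (hf x)]

theorem realFourierCoeff_const_mul (c : ℝ) (f : UnitAddCircle → ℝ) (n : ℤ) :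
    realFourierCoeff (fun x => c * f x) n = c * realFourierCoeff f n := by
  simp only [realFourierCoeff, Complex.ofReal_mul]
  exact fourierCoeff.const_mul _ _ _

theorem realFourierCoeff_sum {ι : Type*} (s : Finset ι) (f : ι → UnitAddCircle → ℝ)
    (hf : ∀ i ∈ s, Continuous (f i)) (n : ℤ) :
    realFourierCoeff (fun x => ∑ i ∈ s, f i x) n = ∑ i ∈ s, realFourierCoeff (f i) n := by
  simp only [realFourierCoeff]
  have h := fourierCoeff.sum s (fun i x => ((f i x : ℝ) : ℂ)) (fun i hi =>
    integrable_of_continuous (Complex.continuous_ofReal.comp (hf i hi)))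
  have h2 : (fun x => ((∑ i ∈ s, f i x : ℝ) : ℂ)) = ∑ i ∈ s, fun x => ((f i x : ℝ) : ℂ) := by
    ext x; simp
  rw [h2, h, Finset.sum_apply]

theorem realFourierCoeff_translate (f : UnitAddCircle → ℝ) (a : UnitAddCircle) (n : ℤ) :
    realFourierCoeff (fun x => f (x - a)) n = fourier (-n) a * realFourierCoeff f n := by
  rw [realFourierCoeff, fourierCoeff, realFourierCoeff, fourierCoeff, ← integral_const_mul,
    ← integral_sub_right_eq_self (fun x => fourier (-n) a * (fourier (-n) x • (f x : ℂ))) a]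
  refine integral_congr_ae (Filter.Eventually.of_forall fun x => ?_)
  have : fourier (-n) x = fourier (-n) (x - a) * fourier (-n) a := by
    rw [← fourier_apply_add, sub_add_cancel]
  simp only [smul_eq_mul]
  rw [this]
  ring

/-- The tent function of radius `r` and integral `1` on the circle. -/
noncomputable def tent (r : ℝ) (x : UnitAddCircle) : ℝ := max 0 (r - ‖x‖) / r ^ 2

theorem continuous_tent (r : ℝ) : Continuous (tent r) := by
  unfold tent
  fun_prop

theorem tent_nonneg (r : ℝ) (x : UnitAddCircle) : 0 ≤ tent r x := by
  unfold tent
  positivity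

theorem tent_eq_zero {r : ℝ} {x : UnitAddCircle} (h : r ≤ ‖x‖) : tent r x = 0 := by
  unfold tent
  rw [max_eq_left (by linarith), zero_div]

theorem tent_coe {r x : ℝ} (hx : |x| ≤ 1 / 2) :
    tent r (x : UnitAddCircle) = max 0 (r - |x|) / r ^ 2 := by
  unfold tent
  rw [(AddCircle.norm_coe_eq_abs_iff 1 one_ne_zero).mpr (by simpa using hx)]

theorem realFourierCoeff_tent_eq {r : ℝ} (hr : 0 < r) (hr2 : r ≤ 1 / 2) (n : ℤ) :
    realFourierCoeff (tent r) n = ((∫ x in (-r)..0, Complex.exp (-(2 * Real.pi * Complex.I * n) * x)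
        * ((r + x : ℝ) : ℂ)) + ∫ x in (0 : ℝ)..r, Complex.exp (-(2 * Real.pi * Complex.I * n) * x)
        * ((r - x : ℝ) : ℂ)) / r ^ 2 := by
  set E : ℝ → ℂ := fun x => Complex.exp (-(2 * Real.pi * Complex.I * n) * x) with hE
  set φ : ℝ → ℂ := fun x => E x * ((max 0 (r - |x|) / r ^ 2 : ℝ) : ℂ) with hφ
  have hcE : Continuous E := by fun_prop
  have hcφ : Continuous φ := by fun_prop
  have hintg : ∀ a b : ℝ, IntervalIntegrable φ volume a b := fun a b => hcφ.intervalIntegrable a b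
  have h1 : realFourierCoeff (tent r) n = ∫ x in (-(1 / 2) : ℝ)..(1 / 2), φ x := by
    rw [realFourierCoeff, fourierCoeff_eq_intervalIntegral _ n (-(1 / 2) : ℝ)]
    have : (-(1 / 2) : ℝ) + 1 = 1 / 2 := by norm_num
    rw [this, div_one, one_smul]
    refine intervalIntegral.integral_congr fun x hx => ?_
    rw [uIcc_of_le (by norm_num)] at hx
    simp only [hφ, hE, smul_eq_mul]
    rw [tent_coe (abs_le.mpr ⟨hx.1, hx.2⟩), fourier_coe_apply]
    congr 2
    push_cast
    ring
  have h2 : ∫ x in (-(1 / 2) : ℝ)..(1 / 2), φ x = (∫ x in (-(1 / 2) : ℝ)..(-r), φ x) +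
      (∫ x in (-r)..0, φ x) + (∫ x in (0 : ℝ)..r, φ x) + ∫ x in r..(1 / 2), φ x := by
    rw [intervalIntegral.integral_add_adjacent_intervals (hintg _ _) (hintg _ _),
      intervalIntegral.integral_add_adjacent_intervals (hintg _ _) (hintg _ _),
      intervalIntegral.integral_add_adjacent_intervals (hintg _ _) (hintg _ _)]
  have hz : ∀ x : ℝ, r ≤ |x| → φ x = 0 := fun x hx => by
    simp only [hφ]
    rw [max_eq_left (by linarith)]
    simp
  have h3 : ∫ x in (-(1 / 2) : ℝ)..(-r), φ x = 0 := by
    rw [intervalIntegral.integral_congr (g := fun _ => (0 : ℂ)), intervalIntegral.integral_zero]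
    intro x hx
    rw [uIcc_of_le (by linarith)] at hx
    exact hz x (by rw [abs_of_nonpos (by linarith [hx.2])]; linarith [hx.2])
  have h4 : ∫ x in r..(1 / 2), φ x = 0 := by
    rw [intervalIntegral.integral_congr (g := fun _ => (0 : ℂ)), intervalIntegral.integral_zero]
    intro x hx
    rw [uIcc_of_le (by linarith)] at hx
    exact hz x (by rw [abs_of_nonneg (by linarith [hx.1])]; linarith [hx.1])
  rw [h1, h2, h3, h4, zero_add, add_zero, add_div, ← intervalIntegral.integral_div,
    ← intervalIntegral.integral_div]
  congr 1
  · refine intervalIntegral.integral_congr fun x hx => ?_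
    rw [uIcc_of_le (by linarith)] at hx
    simp only [hφ]
    rw [abs_of_nonpos hx.2, max_eq_right (by linarith [hx.1])]
    push_cast
    ring
  · refine intervalIntegral.integral_congr fun x hx => ?_
    rw [uIcc_of_le (by linarith)] at hx
    simp only [hφ]
    rw [abs_of_nonneg hx.1, max_eq_right (by linarith [hx.2])]
    push_cast
    ring

theorem integral_tent {r : ℝ} (hr : 0 < r) (hr2 : r ≤ 1 / 2) :
    ∫ x, tent r x ∂haarAddCircle = 1 := by
  have h := realFourierCoeff_tent_eq hr hr2 0
  rw [realFourierCoeff_zero] at h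
  have h1 : (∫ x in (-r)..0, Complex.exp (-(2 * Real.pi * Complex.I * (0 : ℤ)) * x)
      * ((r + x : ℝ) : ℂ)) = ((r ^ 2 / 2 : ℝ) : ℂ) := by
    simp only [Int.cast_zero, mul_zero, neg_zero, zero_mul, Complex.exp_zero, one_mul]
    rw [intervalIntegral.integral_ofReal, intervalIntegral.integral_add (by simp) (by simp)]
    simp
    ring
  have h2 : (∫ x in (0 : ℝ)..r, Complex.exp (-(2 * Real.pi * Complex.I * (0 : ℤ)) * x)
      * ((r - x : ℝ) : ℂ)) = ((r ^ 2 / 2 : ℝ) : ℂ) := by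
    simp only [Int.cast_zero, mul_zero, neg_zero, zero_mul, Complex.exp_zero, one_mul]
    rw [intervalIntegral.integral_ofReal, intervalIntegral.integral_sub (by simp) (by simp)]
    simp
    ring
  rw [h1, h2] at h
  have h3 : ((r ^ 2 / 2 : ℝ) : ℂ) + ((r ^ 2 / 2 : ℝ) : ℂ) = (r : ℂ) ^ 2 := by push_cast; ring
  have hr' : (r : ℂ) ^ 2 ≠ 0 := by exact_mod_cast (pow_pos hr 2).ne'
  rw [h3, div_self hr'] at h
  exact_mod_cast h

theorem norm_realFourierCoeff_tent_le_one {r : ℝ} (hr : 0 < r) (hr2 : r ≤ 1 / 2) (n : ℤ) :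
    ‖realFourierCoeff (tent r) n‖ ≤ 1 :=
  (norm_realFourierCoeff_le (tent_nonneg r) n).trans (integral_tent hr hr2).le

/-- Explicit primitives on the two linear pieces give `(e^{lr} + e^{-lr} - 2) / (l r)²` with `|l| =
2π|n|`; the numerator is at most `4 ≤ 4π²`. -/
theorem norm_realFourierCoeff_tent_le {r : ℝ} (hr : 0 < r) (hr2 : r ≤ 1 / 2) {n : ℤ} (hn : n ≠ 0) :
    ‖realFourierCoeff (tent r) n‖ ≤ 1 / (r * |(n : ℝ)|) ^ 2 := by
  rw [realFourierCoeff_tent_eq hr hr2]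
  set l : ℂ := 2 * Real.pi * Complex.I * n with hl
  have hn' : (n : ℂ) ≠ 0 := by exact_mod_cast hn
  have hl0 : l ≠ 0 := mul_ne_zero Complex.two_pi_I_ne_zero hn'
  have hexp : ∀ x : ℝ, HasDerivAt (fun x : ℝ => Complex.exp (-l * x)) (Complex.exp (-l * x) * -l) x := by
    intro x
    have h1 : HasDerivAt (fun x : ℝ => -l * (x : ℂ)) (-l) x := by
      simpa using (Complex.ofRealCLM.hasDerivAt (x := x)).const_mul (-l)
    exact h1.cexp
  have hid : ∀ x : ℝ, HasDerivAt (fun x : ℝ => (x : ℂ)) 1 x := fun x =>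
    Complex.ofRealCLM.hasDerivAt (x := x)
  have h1 : (∫ x in (-r)..0, Complex.exp (-l * x) * ((r + x : ℝ) : ℂ)) =
      -(r / l) - 1 / l ^ 2 + Complex.exp (l * r) / l ^ 2 := by
    have hd : ∀ x ∈ uIcc (-r) 0, HasDerivAt
        (fun x : ℝ => Complex.exp (-l * x) * (-((r + x) / l) - 1 / l ^ 2))
        (Complex.exp (-l * x) * ((r + x : ℝ) : ℂ)) x := by
      intro x _
      have := (hexp x).mul (((((hid x).const_add (r : ℂ)).div_const l).neg).sub_const (1 / l ^ 2))
      convert! this using 1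
      simp only [Pi.neg_apply]
      push_cast
      field_simp
      ring
    rw [intervalIntegral.integral_eq_sub_of_hasDerivAt hd
      (Continuous.intervalIntegrable (by fun_prop) _ _)]
    push_cast
    simp only [mul_zero, Complex.exp_zero, neg_mul_neg]
    ring
  have h2 : (∫ x in (0 : ℝ)..r, Complex.exp (-l * x) * ((r - x : ℝ) : ℂ)) =
      Complex.exp (-l * r) / l ^ 2 + r / l - 1 / l ^ 2 := by
    have hd : ∀ x ∈ uIcc 0 r, HasDerivAt
        (fun x : ℝ => Complex.exp (-l * x) * (-((r - x) / l) + 1 / l ^ 2))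
        (Complex.exp (-l * x) * ((r - x : ℝ) : ℂ)) x := by
      intro x _
      have := (hexp x).mul (((((hid x).const_sub (r : ℂ)).div_const l).neg).add_const (1 / l ^ 2))
      convert! this using 1
      simp only [Pi.neg_apply]
      push_cast
      field_simp
      ring
    rw [intervalIntegral.integral_eq_sub_of_hasDerivAt hd
      (Continuous.intervalIntegrable (by fun_prop) _ _)]
    push_cast
    simp only [mul_zero, Complex.exp_zero]
    ring
  rw [h1, h2]
  have h3 : -(r / l) - 1 / l ^ 2 + Complex.exp (l * r) / l ^ 2 +
      (Complex.exp (-l * r) / l ^ 2 + r / l - 1 / l ^ 2) =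
        (Complex.exp (l * r) + Complex.exp (-l * r) - 2) / l ^ 2 := by ring
  have hnorm : ∀ y : ℝ, ‖Complex.exp (((2 * Real.pi * n * y : ℝ) : ℂ) * Complex.I)‖ = 1 := fun y =>
    Complex.norm_exp_ofReal_mul_I _
  have e1 : ‖Complex.exp (l * r)‖ = 1 := by
    rw [← hnorm r]; congr 2; rw [hl]; push_cast; ring
  have e2 : ‖Complex.exp (-l * r)‖ = 1 := by
    rw [← hnorm (-r)]; congr 2; rw [hl]; push_cast; ring
  have e3 : ‖Complex.exp (l * r) + Complex.exp (-l * r) - 2‖ ≤ 4 := by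
    refine (norm_sub_le _ _).trans ?_
    have := norm_add_le (Complex.exp (l * r)) (Complex.exp (-l * r))
    rw [e1, e2] at this
    have : ‖(2 : ℂ)‖ = 2 := by simp
    linarith
  have hln : ‖l‖ = 2 * Real.pi * |(n : ℝ)| := by
    rw [hl]
    simp [abs_of_pos Real.pi_pos]
  have hnpos : 0 < |(n : ℝ)| := abs_pos.mpr (by exact_mod_cast hn)
  rw [h3, norm_div, norm_div, norm_pow, norm_pow, hln, Complex.norm_real, Real.norm_eq_abs,
    abs_of_pos hr, div_div, div_le_div_iff₀ (by positivity) (by positivity), one_mul]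
  have hpi : (1 : ℝ) ≤ Real.pi ^ 2 := one_le_pow₀ (by linarith [Real.pi_gt_three])
  have : 0 ≤ (r * |(n : ℝ)|) ^ 2 := by positivity
  calc _ ≤ 4 * (r * |(n : ℝ)|) ^ 2 := mul_le_mul_of_nonneg_right e3 this
    _ ≤ 4 * (r * |(n : ℝ)|) ^ 2 * Real.pi ^ 2 := le_mul_of_one_le_right (by positivity) hpi
    _ = _ := by ring

/-- Interpolation between the two bounds for the coefficients of the tent function. -/
theorem norm_realFourierCoeff_tent_le_rpow {r : ℝ} (hr : 0 < r) (hr2 : r ≤ 1 / 2) {n : ℤ}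
    (hn : n ≠ 0) {s : ℝ} (hs0 : 0 ≤ s) (hs2 : s ≤ 2) :
    ‖realFourierCoeff (tent r) n‖ ≤ (r * |(n : ℝ)|) ^ (-s) := by
  have hnpos : 0 < |(n : ℝ)| := abs_pos.mpr (by exact_mod_cast hn)
  have hy : 0 < r * |(n : ℝ)| := by positivity
  rcases le_total 1 (r * |(n : ℝ)|) with h1 | h1
  · refine (norm_realFourierCoeff_tent_le hr hr2 hn).trans ?_
    rw [one_div, ← Real.rpow_natCast, ← Real.rpow_neg hy.le]
    exact Real.rpow_le_rpow_of_exponent_le h1 (by push_cast; linarith)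
  · exact (norm_realFourierCoeff_tent_le_one hr hr2 n).trans
      (Real.one_le_rpow_of_pos_of_le_one_of_nonpos hy h1 (by linarith))

end Tent

/-! ### Fourier coefficients of products -/

section Products

open AddCircle Filter

theorem summable_one_add_abs_int_rpow {p : ℝ} (hp : 1 < p) :
    Summable fun n : ℤ => (1 + |(n : ℝ)|) ^ (-p) := by
  refine Summable.of_norm_bounded_eventually (Real.summable_abs_int_rpow hp) ?_
  have : ({0} : Set ℤ)ᶜ ∈ (cofinite : Filter ℤ) := (finite_singleton 0).compl_mem_cofinite
  filter_upwards [this] with n hn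
  have hn' : 0 < |(n : ℝ)| := abs_pos.mpr (by exact_mod_cast hn)
  rw [Real.norm_of_nonneg (by positivity)]
  exact Real.rpow_le_rpow_of_nonpos hn' (by linarith) (by linarith)

theorem summable_one_div_one_add_abs_int_sq :
    Summable fun n : ℤ => 1 / (1 + |(n : ℝ)|) ^ 2 := by
  have := summable_one_add_abs_int_rpow (p := 2) (by norm_num)
  refine this.congr fun n => ?_
  rw [Real.rpow_neg (by positivity), one_div, ← Real.rpow_natCast]
  norm_num

/-- The Fourier coefficients of `f` decay at least quadratically. -/
def HasQuadraticDecay (f : UnitAddCircle → ℝ) : Prop :=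
  ∃ C : ℝ, ∀ n : ℤ, ‖realFourierCoeff f n‖ ≤ C * (1 / (1 + |(n : ℝ)|) ^ 2)

theorem HasQuadraticDecay.summable {f : UnitAddCircle → ℝ} (h : HasQuadraticDecay f) :
    Summable (realFourierCoeff f) := by
  obtain ⟨C, hC⟩ := h
  exact Summable.of_norm_bounded (summable_one_div_one_add_abs_int_sq.mul_left C) hC

/-- Expand `F` in its absolutely convergent Fourier series and integrate term by term. -/
theorem hasSum_realFourierCoeff_mul {f F : UnitAddCircle → ℝ} (hf : Continuous f)
    (hF : Continuous F) (hs : Summable (realFourierCoeff F)) (ξ : ℤ) :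
    HasSum (fun η => realFourierCoeff F η * realFourierCoeff f (ξ - η))
      (realFourierCoeff (fun x => f x * F x) ξ) := by
  let FC : C(UnitAddCircle, ℂ) := ⟨fun x => (F x : ℂ), Complex.continuous_ofReal.comp hF⟩
  have hFC : ∀ x, HasSum (fun η => realFourierCoeff F η * fourier η x) (F x : ℂ) := fun x => by
    have := has_pointwise_sum_fourier_series_of_summable (f := FC) hs x
    simpa [FC, realFourierCoeff] using this
  have hcont : ∀ η : ℤ, Continuous fun x : UnitAddCircle =>
      fourier (-ξ) x * ((f x : ℂ) * (realFourierCoeff F η * fourier η x)) := fun η => by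
    have h1 : Continuous fun x : UnitAddCircle => (f x : ℂ) := Complex.continuous_ofReal.comp hf
    have h2 := (fourier (T := (1 : ℝ)) (-ξ)).continuous
    have h3 := (fourier (T := (1 : ℝ)) η).continuous
    exact h2.mul (h1.mul (continuous_const.mul h3))
  have hnorm : ∀ η : ℤ, ∫ x : UnitAddCircle,
      ‖fourier (-ξ) x * ((f x : ℂ) * (realFourierCoeff F η * fourier η x))‖ ∂haarAddCircle =
        ‖realFourierCoeff F η‖ * ∫ x : UnitAddCircle, |f x| ∂haarAddCircle := fun η => by
    rw [← integral_const_mul]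
    refine integral_congr_ae (Eventually.of_forall fun x => ?_)
    simp only [norm_mul, norm_fourier_apply, Complex.norm_real, Real.norm_eq_abs]
    ring
  have key := hasSum_integral_of_summable_integral_norm
    (μ := (haarAddCircle : Measure UnitAddCircle))
    (F := fun (η : ℤ) (x : UnitAddCircle) =>
      fourier (-ξ) x * ((f x : ℂ) * (realFourierCoeff F η * fourier η x)))
    (fun η => integrable_of_continuous (hcont η))
    (by simp only [hnorm]; exact hs.norm.mul_right _)
  have e1 : ∫ x : UnitAddCircle, ∑' η : ℤ,
      fourier (-ξ) x * ((f x : ℂ) * (realFourierCoeff F η * fourier η x)) ∂haarAddCircle =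
      realFourierCoeff (fun x => f x * F x) ξ := by
    rw [realFourierCoeff, fourierCoeff]
    refine integral_congr_ae (Eventually.of_forall fun x => ?_)
    simp only [tsum_mul_left, (hFC x).tsum_eq, smul_eq_mul, Complex.ofReal_mul]
  rw [e1] at key
  refine key.congr_fun ?_
  intro η
  have hfc : realFourierCoeff f (ξ - η) =
      ∫ x : UnitAddCircle, fourier (-(ξ - η)) x • (f x : ℂ) ∂haarAddCircle := rfl
  rw [hfc, ← integral_const_mul]
  refine integral_congr_ae (Eventually.of_forall fun x => ?_)
  have : fourier (-(ξ - η)) x = fourier (-ξ) x * fourier η x := by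
    rw [← fourier_add]; congr 2; ring
  simp only [this, smul_eq_mul]
  ring

/-- One of `η`, `ξ - η` has size at least half that of `ξ`, which extracts the quadratic factor in
`ξ` and leaves a summable one. This closure under products is what allows the construction to be
iterated. -/
theorem HasQuadraticDecay.mul {f F : UnitAddCircle → ℝ} (hf : Continuous f) (hF : Continuous F)
    (hfd : HasQuadraticDecay f) (hFd : HasQuadraticDecay F) :
    HasQuadraticDecay fun x => f x * F x := by
  have hsum := hFd.summable
  obtain ⟨C, hC⟩ := hfd
  obtain ⟨D, hD⟩ := hFd
  have hC0 : 0 ≤ C := by simpa using (norm_nonneg _).trans (hC 0)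
  have hD0 : 0 ≤ D := by simpa using (norm_nonneg _).trans (hD 0)
  obtain ⟨T, hT1⟩ := summable_one_div_one_add_abs_int_sq
  refine ⟨4 * C * D * T, fun ξ => ?_⟩
  have hT2 : HasSum (fun n : ℤ => 1 / (1 + |((ξ - n : ℤ) : ℝ)|) ^ 2) T := by
    have := ((Equiv.subLeft ξ).hasSum_iff (f := fun n : ℤ => 1 / (1 + |(n : ℝ)|) ^ 2)).mpr hT1
    simpa only [Function.comp_def, Equiv.subLeft_apply] using this
  have hbound := (hT1.add hT2).mul_left (2 * C * D * (1 / (1 + |(ξ : ℝ)|) ^ 2))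
  have hle : ∀ η : ℤ, ‖realFourierCoeff F η * realFourierCoeff f (ξ - η)‖ ≤
      2 * C * D * (1 / (1 + |(ξ : ℝ)|) ^ 2) *
        (1 / (1 + |(η : ℝ)|) ^ 2 + 1 / (1 + |((ξ - η : ℤ) : ℝ)|) ^ 2) := by
    intro η
    rw [norm_mul]
    refine (mul_le_mul (hD η) (hC (ξ - η)) (norm_nonneg _) (by positivity)).trans ?_
    set x := 1 + |(η : ℝ)| with hx
    set y := 1 + |((ξ - η : ℤ) : ℝ)| with hy
    set z := 1 + |(ξ : ℝ)| with hz
    have hx0 : 0 < x := by positivity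
    have hy0 : 0 < y := by positivity
    have hz0 : 0 < z := by positivity
    have hxyz : z ≤ x + y := by
      have : (ξ : ℝ) = η + ((ξ - η : ℤ) : ℝ) := by push_cast; ring
      have h2 := abs_add_le (η : ℝ) ((ξ - η : ℤ) : ℝ)
      rw [← this] at h2
      linarith
    have hsq : z ^ 2 ≤ 2 * (x ^ 2 + y ^ 2) := by nlinarith [sq_nonneg (x - y)]
    have : 1 / x ^ 2 * (1 / y ^ 2) ≤ 2 * (1 / z ^ 2) * (1 / x ^ 2 + 1 / y ^ 2) := by
      have e : 2 * (1 / z ^ 2) * (1 / x ^ 2 + 1 / y ^ 2) =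
          (2 * (x ^ 2 + y ^ 2) / z ^ 2) * (1 / x ^ 2 * (1 / y ^ 2)) := by
        field_simp
        ring
      rw [e]
      exact le_mul_of_one_le_left (by positivity) ((one_le_div (by positivity)).mpr hsq)
    calc D * (1 / x ^ 2) * (C * (1 / y ^ 2)) = C * D * (1 / x ^ 2 * (1 / y ^ 2)) := by ring
      _ ≤ C * D * (2 * (1 / z ^ 2) * (1 / x ^ 2 + 1 / y ^ 2)) :=
        mul_le_mul_of_nonneg_left this (by positivity)
      _ = _ := by ring
  have := (hasSum_realFourierCoeff_mul hf hF hsum ξ).norm_le_of_bounded hbound hle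
  refine this.trans (le_of_eq ?_)
  ring

/-- Multiplying by a function whose nonzero Fourier coefficients are small changes the Fourier
coefficients of `f` only slightly. -/
theorem HasQuadraticDecay.exists_norm_mul_sub_le {f : UnitAddCircle → ℝ} (hf : Continuous f)
    (hfd : HasQuadraticDecay f) :
    ∃ A : ℝ, 0 < A ∧ ∀ (F : UnitAddCircle → ℝ) (δ s : ℝ), Continuous F →
      Summable (realFourierCoeff F) → realFourierCoeff F 0 = 1 → 0 ≤ s → s ≤ 1 / 2 → 0 ≤ δ →
      (∀ n : ℤ, n ≠ 0 → ‖realFourierCoeff F n‖ ≤ δ * |(n : ℝ)| ^ (-s)) →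
      ∀ ξ : ℤ, ‖realFourierCoeff (fun x => f x * F x) ξ - realFourierCoeff f ξ‖ ≤
        A * δ * (1 + |(ξ : ℝ)|) ^ (-s) := by
  obtain ⟨C, hC⟩ := hfd
  have hC0 : 0 ≤ C := by simpa using (norm_nonneg _).trans (hC 0)
  set T := ∑' n : ℤ, (1 + |(n : ℝ)|) ^ (-(3 / 2) : ℝ) with hT
  have hT1 : HasSum (fun n : ℤ => (1 + |(n : ℝ)|) ^ (-(3 / 2) : ℝ)) T :=
    (summable_one_add_abs_int_rpow (by norm_num)).hasSum
  have hT0 : 0 ≤ T := tsum_nonneg fun n => by positivity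
  refine ⟨2 * C * T + 1, by positivity, fun F δ s hF hsum h0 hs0 hs2 hδ hdec ξ => ?_⟩
  have hT2 : HasSum (fun n : ℤ => (1 + |((ξ - n : ℤ) : ℝ)|) ^ (-(3 / 2) : ℝ)) T := by
    have := ((Equiv.subLeft ξ).hasSum_iff
      (f := fun n : ℤ => (1 + |(n : ℝ)|) ^ (-(3 / 2) : ℝ))).mpr hT1
    simpa only [Function.comp_def, Equiv.subLeft_apply] using this
  have hbound := hT2.mul_left (2 * C * δ * (1 + |(ξ : ℝ)|) ^ (-s))
  -- The term `η = 0` of the convolution is the coefficient of `f` itself, as the mean of `F` is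
  -- `1`; the remaining terms are the perturbation.
  have hdiff := hasSum_ite_sub_hasSum (hasSum_realFourierCoeff_mul hf hF hsum ξ) 0
  rw [h0, one_mul, sub_zero] at hdiff
  have hz0 : 0 < 1 + |(ξ : ℝ)| := by positivity
  refine (hdiff.norm_le_of_bounded hbound fun η => ?_).trans ?_
  · split_ifs with hη
    · simp only [norm_zero]; positivity
    rw [norm_mul]
    have hη' : 1 ≤ |(η : ℝ)| := by exact_mod_cast Int.one_le_abs hη
    set y := 1 + |((ξ - η : ℤ) : ℝ)| with hy
    set z := 1 + |(ξ : ℝ)| with hz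
    have hy1 : 1 ≤ y := by rw [hy]; linarith [abs_nonneg ((ξ - η : ℤ) : ℝ)]
    have hy0 : 0 < y := by linarith
    -- For `|η| ≥ 1` this trades `|η| ^ (-s)` for `z ^ (-s)` at the cost of `y ^ s`. The quadratic
    -- decay of `f` absorbs it, since `s - 2 ≤ -3/2` is still summable.
    have hzy : z ≤ 2 * |(η : ℝ)| * y := by
      have : (ξ : ℝ) = η + ((ξ - η : ℤ) : ℝ) := by push_cast; ring
      have h2 := abs_add_le (η : ℝ) ((ξ - η : ℤ) : ℝ)
      rw [← this] at h2
      nlinarith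
    have hpow : |(η : ℝ)| ^ (-s) ≤ 2 * y ^ s * z ^ (-s) := by
      have h1 : z ^ s ≤ 2 ^ s * |(η : ℝ)| ^ s * y ^ s := by
        rw [← Real.mul_rpow (by norm_num) (by positivity), ← Real.mul_rpow (by positivity) hy0.le]
        exact Real.rpow_le_rpow hz0.le hzy hs0
      have h2 : (2 : ℝ) ^ s ≤ 2 := by
        calc (2 : ℝ) ^ s ≤ 2 ^ (1 : ℝ) :=
              Real.rpow_le_rpow_of_exponent_le (by norm_num) (by linarith)
          _ = 2 := Real.rpow_one 2
      have h3 : 0 < |(η : ℝ)| ^ s := Real.rpow_pos_of_pos (by linarith) _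
      have h4 : 0 < y ^ s := Real.rpow_pos_of_pos hy0 _
      have h5 : 0 < z ^ s := Real.rpow_pos_of_pos hz0 _
      rw [Real.rpow_neg (by positivity), Real.rpow_neg hz0.le, ← div_eq_mul_inv, ← one_div,
        div_le_div_iff₀ h3 h5, one_mul]
      calc z ^ s ≤ 2 ^ s * |(η : ℝ)| ^ s * y ^ s := h1
        _ ≤ 2 * |(η : ℝ)| ^ s * y ^ s := by gcongr
        _ = _ := by ring
    have hyy : y ^ s * (1 / y ^ 2) ≤ y ^ (-(3 / 2) : ℝ) := by
      rw [one_div, ← Real.rpow_natCast, ← Real.rpow_neg hy0.le, ← Real.rpow_add hy0]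
      exact Real.rpow_le_rpow_of_exponent_le hy1 (by push_cast; linarith)
    have hzs : 0 ≤ z ^ (-s) := by positivity
    calc ‖realFourierCoeff F η‖ * ‖realFourierCoeff f (ξ - η)‖
        ≤ (δ * (2 * y ^ s * z ^ (-s))) * (C * (1 / y ^ 2)) := by
          refine mul_le_mul ((hdec η hη).trans (mul_le_mul_of_nonneg_left hpow hδ)) (hC _)
            (norm_nonneg _) (by positivity)
      _ = (2 * C * δ * z ^ (-s)) * (y ^ s * (1 / y ^ 2)) := by ring
      _ ≤ (2 * C * δ * z ^ (-s)) * y ^ (-(3 / 2) : ℝ) :=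
        mul_le_mul_of_nonneg_left hyy (by positivity)
  · have : 0 ≤ δ * (1 + |(ξ : ℝ)|) ^ (-s) := by positivity
    nlinarith

end Products

/-! ### The multiplier: tents at avoiding samples -/

section Multiplier

open AddCircle Filter Topology

variable {V : Type*} [NormedAddCommGroup V]

/-- The difference `s - q` lies in `(-3/4, 3/4]`, at distance at least `1/4 > r` from every nonzero
integer, so the circle distance does not wrap around. -/
theorem abs_sub_le_of_norm_coe_sub_le {s q r : ℝ} (hs : s ∈ Icc (1 / 4 : ℝ) (3 / 4))
    (hq : q ∈ Ico (0 : ℝ) 1) (hr : r < 1 / 4) (h : ‖(s : UnitAddCircle) - (q : UnitAddCircle)‖ ≤ r) :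
    |s - q| ≤ r := by
  rw [← AddCircle.coe_sub, UnitAddCircle.norm_eq] at h
  have h0 : round (s - q) = 0 := by
    have h1 := abs_le.mp h
    have h2 : (round (s - q) : ℝ) < 1 := by linarith [hs.2, hq.1, h1.1]
    have h3 : (-1 : ℝ) < round (s - q) := by linarith [hs.1, hq.2, h1.2]
    have h2' : round (s - q) < 1 := by exact_mod_cast h2
    have h3' : -1 < round (s - q) := by exact_mod_cast h3
    omega
  rwa [h0, Int.cast_zero, sub_zero] at h

/-- The normalised superposition of tents of radius `r` centred at the points `q i j`. -/
noncomputable def tentSum (N : ℕ) (r : ℝ) (w : Fin 4 → ℝ) (q : Fin 4 → ℕ → ℝ)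
    (x : UnitAddCircle) : ℝ :=
  ∑ i, w i * ((N : ℝ)⁻¹ * ∑ j ∈ Finset.range N, tent r (x - (q i j : UnitAddCircle)))

theorem continuous_tentSum (N : ℕ) (r : ℝ) (w : Fin 4 → ℝ) (q : Fin 4 → ℕ → ℝ) :
    Continuous (tentSum N r w q) := by
  have := continuous_tent r
  unfold tentSum
  fun_prop

theorem tentSum_nonneg {N : ℕ} {r : ℝ} {w : Fin 4 → ℝ} (hw : ∀ i, 0 ≤ w i) (q : Fin 4 → ℕ → ℝ)
    (x : UnitAddCircle) : 0 ≤ tentSum N r w q x :=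
  Finset.sum_nonneg fun i _ => mul_nonneg (hw i) <| mul_nonneg (by positivity) <|
    Finset.sum_nonneg fun _ _ => tent_nonneg _ _

theorem exists_of_tentSum_ne_zero {N : ℕ} {r : ℝ} {w : Fin 4 → ℝ} {q : Fin 4 → ℕ → ℝ}
    {x : UnitAddCircle} (h : tentSum N r w q x ≠ 0) :
    ∃ i, ∃ j < N, ‖x - (q i j : UnitAddCircle)‖ ≤ r := by
  by_contra! hcon
  apply h
  refine Finset.sum_eq_zero fun i _ => ?_
  rw [Finset.sum_eq_zero fun j hj => tent_eq_zero (hcon i j (Finset.mem_range.mp hj)).le]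
  simp

theorem realFourierCoeff_tentSum (N : ℕ) (r : ℝ) (w : Fin 4 → ℝ) (q : Fin 4 → ℕ → ℝ) (n : ℤ) :
    realFourierCoeff (tentSum N r w q) n = (∑ i, (w i : ℂ) *
      ((∑ j ∈ Finset.range N, fourier (-n) (q i j : UnitAddCircle)) / N)) *
        realFourierCoeff (tent r) n := by
  have hc : ∀ a : UnitAddCircle, Continuous fun x => tent r (x - a) := fun a =>
    (continuous_tent r).comp (continuous_sub_right a)
  unfold tentSum
  rw [realFourierCoeff_sum _ _ (fun i _ => by fun_prop), Finset.sum_mul]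
  refine Finset.sum_congr rfl fun i _ => ?_
  rw [realFourierCoeff_const_mul, realFourierCoeff_const_mul,
    realFourierCoeff_sum _ _ (fun j _ => hc _)]
  simp only [realFourierCoeff_translate]
  rw [← Finset.sum_mul]
  push_cast
  ring

theorem norm_exponential_average_le_one (N : ℕ) {w : Fin 4 → ℝ} (hw : ∀ i, 0 ≤ w i)
    (hw1 : ∑ i, w i = 1) (q : Fin 4 → ℕ → ℝ) (n : ℤ) :
    ‖∑ i, (w i : ℂ) * ((∑ j ∈ Finset.range N, fourier (-n) (q i j : UnitAddCircle)) / N)‖ ≤ 1 := by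
  refine ((norm_sum_le _ _).trans ?_).trans hw1.le
  refine (Finset.sum_le_sum fun i _ => ?_)
  rw [norm_mul, Complex.norm_real, Real.norm_eq_abs, abs_of_nonneg (hw i), norm_div,
    Complex.norm_natCast]
  refine mul_le_of_le_one_right (hw i) (div_le_one_of_le₀ ?_ (Nat.cast_nonneg _))
  exact (norm_sum_le_of_le _ fun j _ => (norm_fourier_apply (-n) (q i j)).le).trans (by simp)

/-- Existence of a nonnegative multiplier with small nonzero Fourier coefficients, supported on
few small balls, whose support contains no isosceles configuration in the given intervals. -/
theorem exists_multiplier {γ : ℝ → V} {I : Set ℝ} {c K : ℝ}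
    (h : RegularDistances γ I c K) (hI : I ⊆ Icc (1 / 4) (3 / 4)) {a : Fin 3 → ℝ} {ρ : ℝ}
    (ha : IsSeparatedTriple I a ρ) {s p δ : ℝ} (hs0 : 0 ≤ s) (hs : s < 2 / 9) (hp : 4 / 9 < p)
    (hδ : 0 < δ) :
    ∃ (F : UnitAddCircle → ℝ) (r : ℝ) (P : Finset UnitAddCircle), Continuous F ∧ (∀ x, 0 ≤ F x) ∧
      HasQuadraticDecay F ∧ realFourierCoeff F 0 = 1 ∧
      (∀ n : ℤ, n ≠ 0 → ‖realFourierCoeff F n‖ ≤ δ * |(n : ℝ)| ^ (-s)) ∧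
      0 < r ∧ r ≤ δ ∧ P.card * r ^ p ≤ δ ∧ (∀ x, F x ≠ 0 → ∃ y ∈ P, dist x y ≤ r) ∧
      ∀ t : Fin 3 → ℝ, (∀ i, |t i - a i| ≤ ρ / 2) →
        (∀ i, ∃ y ∈ P, dist (t i : UnitAddCircle) y ≤ r) →
        ‖γ (t 0) - γ (t 1)‖ ≠ ‖γ (t 1) - γ (t 2)‖ := by
  classical
  -- Half of the available gap: then `N ^ (-1/2 + ε) * r ^ (-s) = N ^ (-ε)`, which tends to `0`.
  set ε := (1 / 2 - 9 / 4 * s) / 2 with hε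
  have hε0 : 0 < ε := by rw [hε]; linarith
  have hlim : ∀ y : ℝ, 0 < y → Tendsto (fun N : ℕ => (N : ℝ) ^ (-y)) atTop (𝓝 0) := fun y hy =>
    (tendsto_rpow_neg_atTop hy).comp tendsto_natCast_atTop_atTop
  have hev := (eventually_exists_grid_points h hI ha hε0).and <|
    (eventually_ge_atTop 1).and <|
    ((hlim (9 / 4) (by norm_num)).eventually_lt_const (show (0 : ℝ) < 1 / 4 by norm_num)).and <|
    ((hlim (9 / 4) (by norm_num)).eventually_lt_const hδ).and <|
    ((hlim ε hε0).eventually_lt_const hδ).and <|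
    ((hlim (1 / 2) (by norm_num)).eventually_lt_const hδ).and <|
    ((hlim (9 / 4 * p - 1) (by linarith)).eventually_lt_const (show (0 : ℝ) < δ / 4 by linarith))
  obtain ⟨N, ⟨w, q, hw0, hw1, hq, hexp, hav⟩, hN, hr4, hrδ, hεδ, hhδ, hpδ⟩ := hev.exists
  have hN1 : (1 : ℝ) ≤ N := by exact_mod_cast hN
  have hN0 : (0 : ℝ) < N := by linarith
  set r := (N : ℝ) ^ (-(9 / 4) : ℝ) with hr
  have hr0 : 0 < r := Real.rpow_pos_of_pos hN0 _
  have hr2 : r ≤ 1 / 2 := by linarith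
  have hrpow : ∀ y : ℝ, r ^ y = (N : ℝ) ^ (-(9 / 4) * y) := fun y => by
    rw [hr, Real.rpow_mul hN0.le]
  set P : Finset UnitAddCircle := Finset.univ.biUnion fun i : Fin 4 =>
    (Finset.range N).image fun j => (q i j : UnitAddCircle) with hP
  have hmemP : ∀ y, y ∈ P ↔ ∃ i, ∃ j < N, (q i j : UnitAddCircle) = y := fun y => by
    simp [hP]
  have hcardP : (P.card : ℝ) ≤ 4 * N := by
    have h1 : P.card ≤ ∑ _i : Fin 4, N := Finset.card_biUnion_le.trans
      (Finset.sum_le_sum fun i _ => Finset.card_image_le.trans (Finset.card_range N).le)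
    simp only [Finset.sum_const, Finset.card_univ, Fintype.card_fin, smul_eq_mul] at h1
    exact_mod_cast h1
  refine ⟨tentSum N r w q, r, P, continuous_tentSum _ _ _ _, tentSum_nonneg hw0 q, ?_, ?_, ?_,
    hr0, hrδ.le, ?_, ?_, ?_⟩
  · refine ⟨4 / r ^ 2, fun n => ?_⟩
    rw [realFourierCoeff_tentSum, norm_mul]
    refine (mul_le_of_le_one_left (norm_nonneg _)
      (norm_exponential_average_le_one N hw0 hw1 q n)).trans ?_
    rcases eq_or_ne n 0 with rfl | hn
    · refine (norm_realFourierCoeff_tent_le_one hr0 hr2 0).trans ?_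
      simp only [Int.cast_zero, abs_zero, add_zero, one_pow, div_one, mul_one]
      rw [one_le_div (by positivity)]
      nlinarith
    · refine (norm_realFourierCoeff_tent_le hr0 hr2 hn).trans ?_
      have hn1 : 1 ≤ |(n : ℝ)| := by exact_mod_cast Int.one_le_abs hn
      rw [div_mul_div_comm, mul_one, mul_pow, div_le_div_iff₀ (by positivity) (by positivity),
        one_mul]
      have : (1 + |(n : ℝ)|) ^ 2 ≤ 4 * |(n : ℝ)| ^ 2 := by nlinarith
      calc r ^ 2 * (1 + |(n : ℝ)|) ^ 2 ≤ r ^ 2 * (4 * |(n : ℝ)| ^ 2) := by gcongr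
        _ = _ := by ring
  · rw [realFourierCoeff_tentSum, realFourierCoeff_zero, integral_tent hr0 hr2]
    have hN' : (N : ℂ) ≠ 0 := by exact_mod_cast hN0.ne'
    simp only [neg_zero, fourier_zero, Finset.sum_const, Finset.card_range, nsmul_eq_mul, mul_one,
      div_self hN', Complex.ofReal_one]
    exact_mod_cast hw1
  · intro n hn
    have hn1 : 1 ≤ |(n : ℝ)| := by exact_mod_cast Int.one_le_abs hn
    have hn0 : 0 < |(n : ℝ)| := by linarith
    rw [realFourierCoeff_tentSum, norm_mul]
    -- Below `N³` the sampling bound applies. Above it the tent alone suffices, as `(r |n|)^(-2) ≤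
    -- N^(9/2 - 3(2 - s)) |n|^(-s)`, with exponent of `N` below `-1/2`.
    by_cases hnM : |n| < (N ^ 3 : ℕ)
    · have h1 := hexp n hn hnM
      have h2 := norm_realFourierCoeff_tent_le_rpow hr0 hr2 hn hs0 (by linarith : s ≤ 2)
      refine (mul_le_mul h1 h2 (norm_nonneg _) (by positivity)).trans ?_
      rw [Real.mul_rpow hr0.le hn0.le, ← mul_assoc, hrpow, ← Real.rpow_add hN0]
      refine mul_le_mul_of_nonneg_right (le_trans (le_of_eq ?_) hεδ.le) (by positivity)
      congr 1
      rw [hε]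
      ring
    · push Not at hnM
      have hnM' : (N : ℝ) ^ (3 : ℝ) ≤ |(n : ℝ)| := by
        have : ((N ^ 3 : ℕ) : ℝ) ≤ ((|n| : ℤ) : ℝ) := by exact_mod_cast hnM
        rw [Int.cast_abs] at this
        rw [show (3 : ℝ) = ((3 : ℕ) : ℝ) by norm_num, Real.rpow_natCast]
        exact_mod_cast this
      have h1 := norm_exponential_average_le_one N hw0 hw1 q n
      have h2 := norm_realFourierCoeff_tent_le_rpow hr0 hr2 hn (by norm_num : (0 : ℝ) ≤ 2) le_rfl
      refine (mul_le_mul h1 h2 (norm_nonneg _) zero_le_one).trans ?_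
      rw [one_mul, Real.mul_rpow hr0.le hn0.le, hrpow,
        show (-2 : ℝ) = -(2 - s) + -s by ring, Real.rpow_add hn0, ← mul_assoc]
      refine mul_le_mul_of_nonneg_right (le_trans ?_ hhδ.le) (by positivity)
      have h3 : |(n : ℝ)| ^ (-(2 - s)) ≤ (N : ℝ) ^ (3 * (-(2 - s))) := by
        rw [Real.rpow_mul hN0.le]
        exact Real.rpow_le_rpow_of_nonpos (by positivity) hnM' (by linarith)
      calc _ ≤ (N : ℝ) ^ (-(9 / 4) * (-(2 - s) + -s)) * (N : ℝ) ^ (3 * (-(2 - s))) := by gcongr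
        _ = (N : ℝ) ^ (-(9 / 4) * (-(2 - s) + -s) + 3 * (-(2 - s))) := (Real.rpow_add hN0 _ _).symm
        _ ≤ _ := Real.rpow_le_rpow_of_exponent_le hN1 (by linarith)
  · rw [hrpow]
    calc _ ≤ 4 * N * (N : ℝ) ^ (-(9 / 4) * p) := by gcongr
      _ = 4 * (N : ℝ) ^ (-(9 / 4 * p - 1)) := by
        rw [mul_assoc]
        congr 1
        nth_rewrite 1 [← Real.rpow_one (N : ℝ)]
        rw [← Real.rpow_add hN0]
        congr 1
        ring
      _ ≤ δ := by linarith
  · intro x hx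
    obtain ⟨i, j, hj, hle⟩ := exists_of_tentSum_ne_zero hx
    exact ⟨_, (hmemP _).mpr ⟨i, j, hj, rfl⟩, by rwa [dist_eq_norm]⟩
  · intro t ht hclose
    refine hav t ht fun i => ?_
    obtain ⟨y, hy, hd⟩ := hclose i
    obtain ⟨i', j, hj, rfl⟩ := (hmemP y).mp hy
    rw [dist_eq_norm] at hd
    exact ⟨i', j, hj, abs_sub_le_of_norm_coe_sub_le
      (hI (ha.mem ((ht i).trans (by linarith [ha.pos])))) (hq i' j) hr4 hd⟩

end Multiplier

/-! ### Energy of measures with Fourier decay -/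

section Energy

open AddCircle Filter

/-- Close to the origin the Dirichlet-type sum is comparable with its number of terms. -/
theorem sq_div_four_le_norm_sum_fourier {M : ℕ} {x : UnitAddCircle} (hx : ‖x‖ ≤ 1 / (8 * M)) :
    (M : ℝ) ^ 2 / 4 ≤ ‖∑ n ∈ Finset.range M, fourier (n : ℤ) x‖ ^ 2 := by
  rcases Nat.eq_zero_or_pos M with rfl | hM
  · simp
  have hM' : (0 : ℝ) < M := by exact_mod_cast hM
  obtain ⟨y, rfl⟩ := QuotientAddGroup.mk_surjective x
  obtain ⟨z, hz, hzx⟩ : ∃ z : ℝ, |z| ≤ 1 / (8 * M) ∧ (z : UnitAddCircle) = (y : UnitAddCircle) := by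
    refine ⟨y - round y, ?_, ?_⟩
    · rwa [← UnitAddCircle.norm_eq]
    · rw [AddCircle.coe_sub]
      have : ((round y : ℝ) : UnitAddCircle) = 0 := by
        have := AddCircle.coe_period (p := (1 : ℝ))
        rw [← zsmul_one (round y), AddCircle.coe_zsmul, this, smul_zero]
      rw [this, sub_zero]
  change (M : ℝ) ^ 2 / 4 ≤ ‖∑ n ∈ Finset.range M, fourier (n : ℤ) (y : UnitAddCircle)‖ ^ 2
  rw [← hzx]
  -- The phases `2π n z` are at most `π/4 < π/3` in absolute value.
  have hre : ∀ n ∈ Finset.range M, (1 / 2 : ℝ) ≤ (fourier (n : ℤ) (z : UnitAddCircle)).re := by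
    intro n hn
    have hn' : (n : ℝ) ≤ M := by exact_mod_cast (Finset.mem_range.mp hn).le
    rw [fourier_coe_apply]
    have e : (2 * Real.pi * Complex.I * (n : ℤ) * z / (1 : ℝ) : ℂ) =
        ((2 * Real.pi * n * z : ℝ) : ℂ) * Complex.I := by
      push_cast; ring
    rw [e, Complex.exp_ofReal_mul_I_re, ← Real.cos_abs, ← Real.cos_pi_div_three]
    have hb : |2 * Real.pi * n * z| ≤ Real.pi / 4 := by
      rw [abs_mul, abs_of_nonneg (by positivity)]
      calc 2 * Real.pi * n * |z| ≤ 2 * Real.pi * M * (1 / (8 * M)) := by gcongr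
        _ = Real.pi / 4 := by field_simp; ring
    exact Real.cos_le_cos_of_nonneg_of_le_pi (abs_nonneg _) (by linarith [Real.pi_pos])
      (by linarith [Real.pi_pos])
  have h1 : (M : ℝ) / 2 ≤ (∑ n ∈ Finset.range M, fourier (n : ℤ) (z : UnitAddCircle)).re := by
    rw [Complex.re_sum]
    calc (M : ℝ) / 2 = ∑ n ∈ Finset.range M, (1 / 2 : ℝ) := by simp; ring
      _ ≤ _ := Finset.sum_le_sum hre
  have h2 := h1.trans (Complex.re_le_norm _)
  calc (M : ℝ) ^ 2 / 4 = (M / 2) ^ 2 := by ring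
    _ ≤ _ := pow_le_pow_left₀ (by positivity) h2 2

variable (ν : Measure UnitAddCircle) [IsProbabilityMeasure ν]

theorem norm_measureFourierCoeff_le_one (k : ℤ) : ‖measureFourierCoeff ν k‖ ≤ 1 := by
  refine (norm_integral_le_integral_norm _).trans ?_
  simp only [norm_fourier_apply]
  simp

/-- Expanding the squared Dirichlet sum separates the two variables. As this kernel is at least `M²
/ 4` near the diagonal, Markov's inequality then bounds the mass of pairs at distance `O(1/M)`. -/
theorem integral_sq_norm_sum_fourier_le (M : ℕ) :
    ∫ p : UnitAddCircle × UnitAddCircle,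
      ‖∑ n ∈ Finset.range M, fourier (n : ℤ) (p.1 - p.2)‖ ^ 2 ∂(ν.prod ν) ≤
    ∑ n ∈ Finset.range M, ∑ m ∈ Finset.range M,
      ‖measureFourierCoeff ν ((m : ℤ) - n)‖ * ‖measureFourierCoeff ν ((n : ℤ) - m)‖ := by
  have hexp : ∀ p : UnitAddCircle × UnitAddCircle,
      ((‖∑ n ∈ Finset.range M, fourier (n : ℤ) (p.1 - p.2)‖ ^ 2 : ℝ) : ℂ) =
      ∑ n ∈ Finset.range M, ∑ m ∈ Finset.range M,
        fourier (-((m : ℤ) - n)) p.1 * fourier (-((n : ℤ) - m)) p.2 := by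
    intro p
    have : ((‖∑ n ∈ Finset.range M, fourier (n : ℤ) (p.1 - p.2)‖ ^ 2 : ℝ) : ℂ) =
        (∑ n ∈ Finset.range M, fourier (n : ℤ) (p.1 - p.2)) *
          (starRingEnd ℂ) (∑ m ∈ Finset.range M, fourier (m : ℤ) (p.1 - p.2)) := by
      rw [Complex.mul_conj, Complex.normSq_eq_norm_sq]
    rw [this, map_sum, Finset.sum_mul_sum]
    refine Finset.sum_congr rfl fun n _ => Finset.sum_congr rfl fun m _ => ?_
    rw [← fourier_neg, ← fourier_add, sub_eq_add_neg p.1, fourier_apply_add]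
    have e1 : (n : ℤ) + -(m : ℤ) = -((m : ℤ) - n) := by ring
    rw [e1]
    congr 1
    have e2 : -((n : ℤ) - m) = -(-((m : ℤ) - n)) := by ring
    rw [e2]
    simp only [fourier_apply]
    rw [smul_neg, neg_smul (-((m : ℤ) - n))]
  have hcont : ∀ n m : ℤ, Continuous fun p : UnitAddCircle × UnitAddCircle =>
      fourier (-(m - n)) p.1 * fourier (-(n - m)) p.2 := fun n m =>
    ((fourier (T := (1 : ℝ)) _).continuous.comp continuous_fst).mul
      ((fourier (T := (1 : ℝ)) _).continuous.comp continuous_snd)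
  have hintg : ∀ n m : ℕ, Integrable (fun p : UnitAddCircle × UnitAddCircle =>
      fourier (-((m : ℤ) - n)) p.1 * fourier (-((n : ℤ) - m)) p.2) (ν.prod ν) := fun n m =>
    (hcont n m).integrable_of_hasCompactSupport (HasCompactSupport.of_compactSpace _)
  have hval : ((∫ p : UnitAddCircle × UnitAddCircle,
      ‖∑ n ∈ Finset.range M, fourier (n : ℤ) (p.1 - p.2)‖ ^ 2 ∂(ν.prod ν) : ℝ) : ℂ) =
      ∑ n ∈ Finset.range M, ∑ m ∈ Finset.range M,
        measureFourierCoeff ν ((m : ℤ) - n) * measureFourierCoeff ν ((n : ℤ) - m) := by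
    rw [← integral_complex_ofReal]
    simp only [hexp]
    rw [integral_finsetSum _ fun n _ => integrable_finsetSum _ fun m _ => hintg n m]
    refine Finset.sum_congr rfl fun n _ => ?_
    rw [integral_finsetSum _ fun m _ => hintg n m]
    refine Finset.sum_congr rfl fun m _ => ?_
    exact integral_prod_mul (fun x => fourier (-((m : ℤ) - n)) x) (fun x => fourier (-((n : ℤ) - m)) x)
  have hnn : 0 ≤ ∫ p : UnitAddCircle × UnitAddCircle,
      ‖∑ n ∈ Finset.range M, fourier (n : ℤ) (p.1 - p.2)‖ ^ 2 ∂(ν.prod ν) :=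
    integral_nonneg fun p => by positivity
  rw [← abs_of_nonneg hnn, ← Real.norm_eq_abs, ← Complex.norm_real, hval]
  refine norm_sum_le_of_le _ fun n _ => norm_sum_le_of_le _ fun m _ => ?_
  rw [norm_mul]

/-- The energy of a measure with polynomial Fourier decay at scale `1 / M`. -/
theorem exists_energy_bound {s : ℝ} (hs1 : s ≤ 1) {C : ℝ}
    (hC : ∀ ξ : ℤ, ‖measureFourierCoeff ν ξ‖ * |(ξ : ℝ)| ^ (s / 2) ≤ C) {ε : ℝ} (hε : 0 < ε) :
    ∃ A : ℝ, 0 < A ∧ ∀ M : ℕ, 0 < M →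
      (ν.prod ν).real {p | dist p.1 p.2 ≤ 1 / (8 * M)} ≤ A * (M : ℝ) ^ (ε - s) := by
  obtain ⟨Z, hZ⟩ := Real.summable_abs_int_rpow (b := 1 + ε) (by linarith)
  have hZ0 : 0 ≤ Z := hZ.nonneg fun n => by positivity
  refine ⟨4 * (1 + C ^ 2 * Z), by positivity, fun M hM => ?_⟩
  have hM1 : (1 : ℝ) ≤ M := by exact_mod_cast hM
  have hM0 : (0 : ℝ) < M := by linarith
  -- As `|k| ≤ M` and `s ≤ 1`, part of the power of `|k|` is exchanged for a power of `M`, so that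
  -- the summable `|k| ^ (-(1 + ε))` remains.
  have hterm : ∀ k : ℤ, k ≠ 0 → |(k : ℝ)| ≤ M →
      ‖measureFourierCoeff ν (-k)‖ * ‖measureFourierCoeff ν k‖ ≤
        C ^ 2 * (M : ℝ) ^ (1 + ε - s) * |(k : ℝ)| ^ (-(1 + ε)) := by
    intro k hk hkM
    have hk0 : 0 < |(k : ℝ)| := abs_pos.mpr (by exact_mod_cast hk)
    have hp : 0 < |(k : ℝ)| ^ (s / 2) := Real.rpow_pos_of_pos hk0 _
    have h1 := hC k
    have h2 := hC (-k)
    rw [Int.cast_neg, abs_neg] at h2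
    have h3 := mul_le_mul h2 h1 (by positivity) ((by positivity : (0 : ℝ) ≤ _).trans h2)
    have e1 : |(k : ℝ)| ^ (s / 2) * |(k : ℝ)| ^ (s / 2) = |(k : ℝ)| ^ s := by
      rw [← Real.rpow_add hk0]; congr 1; ring
    have h4 : ‖measureFourierCoeff ν (-k)‖ * ‖measureFourierCoeff ν k‖ * |(k : ℝ)| ^ s ≤ C ^ 2 := by
      rw [← e1]; nlinarith
    have hps : 0 < |(k : ℝ)| ^ s := Real.rpow_pos_of_pos hk0 _
    have h5 : ‖measureFourierCoeff ν (-k)‖ * ‖measureFourierCoeff ν k‖ ≤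
        C ^ 2 * |(k : ℝ)| ^ (-s) := by
      rw [Real.rpow_neg hk0.le, ← div_eq_mul_inv, le_div_iff₀ hps]
      exact h4
    refine h5.trans ?_
    rw [mul_assoc]
    refine mul_le_mul_of_nonneg_left ?_ (sq_nonneg C)
    calc |(k : ℝ)| ^ (-s) = |(k : ℝ)| ^ (1 + ε - s) * |(k : ℝ)| ^ (-(1 + ε)) := by
          rw [← Real.rpow_add hk0]; congr 1; ring
      _ ≤ (M : ℝ) ^ (1 + ε - s) * |(k : ℝ)| ^ (-(1 + ε)) := by
        refine mul_le_mul_of_nonneg_right ?_ (by positivity)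
        exact Real.rpow_le_rpow hk0.le hkM (by linarith)
  have hinner : ∀ n ∈ Finset.range M, ∑ m ∈ Finset.range M,
      ‖measureFourierCoeff ν ((m : ℤ) - n)‖ * ‖measureFourierCoeff ν ((n : ℤ) - m)‖ ≤
        (1 + C ^ 2 * Z) * (M : ℝ) ^ (1 + ε - s) := by
    intro n hn
    have hMp : 1 ≤ (M : ℝ) ^ (1 + ε - s) := Real.one_le_rpow hM1 (by linarith)
    set B := C ^ 2 * (M : ℝ) ^ (1 + ε - s) with hB
    have hB0 : 0 ≤ B := by positivity
    have h1 : ∀ m ∈ Finset.range M,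
        ‖measureFourierCoeff ν ((m : ℤ) - n)‖ * ‖measureFourierCoeff ν ((n : ℤ) - m)‖ ≤
        (if m = n then 1 else 0) + B * |(((n : ℤ) - m : ℤ) : ℝ)| ^ (-(1 + ε)) := by
      intro m hm
      split_ifs with hmn
      · have h2 := norm_measureFourierCoeff_le_one ν ((m : ℤ) - n)
        have h3 := norm_measureFourierCoeff_le_one ν ((n : ℤ) - m)
        have h4 : 0 ≤ B * |(((n : ℤ) - m : ℤ) : ℝ)| ^ (-(1 + ε)) := by positivity
        have := mul_le_one₀ h2 (norm_nonneg _) h3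
        linarith
      · have hk : (n : ℤ) - m ≠ 0 := by omega
        have hle : |(((n : ℤ) - m : ℤ) : ℝ)| ≤ M := by
          have : |(n : ℤ) - m| ≤ M := by
            have := Finset.mem_range.mp hn
            have := Finset.mem_range.mp hm
            rw [abs_le]; constructor <;> omega
          exact_mod_cast this
        have := hterm _ hk hle
        rw [neg_sub] at this
        linarith
    refine (Finset.sum_le_sum h1).trans ?_
    rw [Finset.sum_add_distrib, Finset.sum_ite_eq' , if_pos hn, ← Finset.mul_sum]
    have hinj : Function.Injective fun m : ℕ => (n : ℤ) - m := fun a b hab => by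
      simpa using hab
    have h2 : ∑ m ∈ Finset.range M, |(((n : ℤ) - m : ℤ) : ℝ)| ^ (-(1 + ε)) ≤ Z := by
      have := sum_le_hasSum ((Finset.range M).map ⟨_, hinj⟩)
        (fun k _ => by positivity) hZ
      rwa [Finset.sum_map] at this
    have h3 := mul_le_mul_of_nonneg_left h2 hB0
    calc _ ≤ 1 + B * Z := by linarith
      _ ≤ (M : ℝ) ^ (1 + ε - s) + B * Z := by linarith
      _ = _ := by rw [hB]; ring
  have hE := (integral_sq_norm_sum_fourier_le ν M).trans (Finset.sum_le_sum hinner)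
  rw [Finset.sum_const, Finset.card_range, nsmul_eq_mul] at hE
  have hcont : Continuous fun p : UnitAddCircle × UnitAddCircle =>
      ‖∑ n ∈ Finset.range M, fourier (n : ℤ) (p.1 - p.2)‖ ^ 2 := by
    refine Continuous.pow (Continuous.norm (continuous_finsetSum _ fun n _ => ?_)) 2
    exact (fourier (T := (1 : ℝ)) _).continuous.comp (continuous_fst.sub continuous_snd)
  have hmarkov := mul_meas_ge_le_integral_of_nonneg (μ := ν.prod ν)
    (f := fun p : UnitAddCircle × UnitAddCircle =>
      ‖∑ n ∈ Finset.range M, fourier (n : ℤ) (p.1 - p.2)‖ ^ 2)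
    (Eventually.of_forall fun p => by positivity)
    (hcont.integrable_of_hasCompactSupport (HasCompactSupport.of_compactSpace _)) ((M : ℝ) ^ 2 / 4)
  have hsub : {p : UnitAddCircle × UnitAddCircle | dist p.1 p.2 ≤ 1 / (8 * M)} ⊆
      {p | (M : ℝ) ^ 2 / 4 ≤ ‖∑ n ∈ Finset.range M, fourier (n : ℤ) (p.1 - p.2)‖ ^ 2} := by
    intro p hp
    rw [mem_ofPred_eq, dist_eq_norm] at hp
    exact sq_div_four_le_norm_sum_fourier hp
  have hle := measureReal_mono (μ := ν.prod ν) hsub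
  have h1 : (M : ℝ) ^ 2 / 4 * (ν.prod ν).real {p | dist p.1 p.2 ≤ 1 / (8 * M)} ≤
      M * ((1 + C ^ 2 * Z) * (M : ℝ) ^ (1 + ε - s)) :=
    (mul_le_mul_of_nonneg_left hle (by positivity)).trans (hmarkov.trans hE)
  have e2 : (M : ℝ) ^ (1 + ε - s) = M * (M : ℝ) ^ (ε - s) := by
    rw [show 1 + ε - s = 1 + (ε - s) by ring, Real.rpow_add hM0, Real.rpow_one]
  rw [e2] at h1
  have hMM : 0 < (M : ℝ) ^ 2 / 4 := by positivity
  refine le_of_mul_le_mul_left (h1.trans (le_of_eq ?_)) hMM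
  ring

end Energy

/-! ### Fourier dimension is at most Hausdorff dimension -/

section FourierDimLeHausdorffDim

open AddCircle Filter

variable (ν : Measure UnitAddCircle) [IsProbabilityMeasure ν]

/-- A measure with Fourier decay exponent `s` satisfies a Frostman condition of any exponent
`t < s` on a set of positive measure. -/
theorem exists_frostman_set {s t : ℝ} (hs : s ∈ fourierDecayExponents ν) (hts : t < s) :
    ∃ (S : Set UnitAddCircle) (B : ℝ), MeasurableSet S ∧ 0 < ν S ∧ 0 < B ∧
      ∀ x ∈ S, ∀ k : ℕ, ν.real (Metric.closedBall x (1 / (8 * 2 ^ k))) ≤ B * (1 / 2 ^ k : ℝ) ^ t := by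
  obtain ⟨⟨hs0, hs1⟩, C, hC⟩ := hs
  -- One half of the gap is lost in the energy bound; the other half yields the geometric factor `q
  -- ^ k` that makes the exceptional sets summable.
  set ε := (s - t) / 2 with hε
  have hε0 : 0 < ε := by rw [hε]; linarith
  obtain ⟨A, hA, hE⟩ := exists_energy_bound ν hs1 hC hε0
  set q : ℝ := (1 / 2 : ℝ) ^ ε with hq
  have hq0 : 0 < q := by positivity
  have hq1 : q < 1 := Real.rpow_lt_one (by norm_num) (by norm_num) hε0
  have hgeom := hasSum_geometric_of_lt_one hq0.le hq1
  -- With this `B` the bounds on the exceptional sets add up to `1/2`, so a set of positive measure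
  -- is left.
  set B := 2 * A * (1 - q)⁻¹ with hB
  have hB0 : 0 < B := by
    have : 0 < 1 - q := by linarith
    positivity
  set g : ℕ → UnitAddCircle → ℝ≥0∞ := fun k x => ν (Metric.closedBall x (1 / (8 * 2 ^ k))) with hg
  set D : ℕ → Set (UnitAddCircle × UnitAddCircle) := fun k =>
    {p | dist p.1 p.2 ≤ 1 / (8 * 2 ^ k)} with hD
  have hDm : ∀ k, MeasurableSet (D k) := fun k =>
    (isClosed_le (continuous_fst.dist continuous_snd) continuous_const).measurableSet
  have hslice : ∀ k x, Prod.mk x ⁻¹' (D k) = Metric.closedBall x (1 / (8 * 2 ^ k)) := fun k x => by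
    ext y
    simp [hD, dist_comm]
  have hgm : ∀ k, Measurable (g k) := fun k => by
    have := measurable_measure_prodMk_left (ν := ν) (hDm k)
    simpa only [hslice] using this
  have hintg : ∀ k, ∫⁻ x, g k x ∂ν = (ν.prod ν) (D k) := fun k => by
    rw [Measure.prod_apply (hDm k)]
    simp only [hslice, hg]
  have hpow : ∀ (k : ℕ) (y : ℝ), ((2 : ℝ) ^ k) ^ y = ((2 : ℝ) ^ y) ^ k := fun k y => by
    rw [← Real.rpow_natCast, ← Real.rpow_natCast, ← Real.rpow_mul (by norm_num),
      ← Real.rpow_mul (by norm_num), mul_comm]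
  have hpow' : ∀ (k : ℕ) (y : ℝ), (1 / (2 : ℝ) ^ k) ^ y = ((2 : ℝ) ^ k) ^ (-y) := fun k y => by
    rw [one_div, Real.inv_rpow (by positivity), Real.rpow_neg (by positivity)]
  have hen : ∀ k, (ν.prod ν).real (D k) ≤ A * ((1 / 2 ^ k : ℝ) ^ t * q ^ k) := fun k => by
    have h1 := hE (2 ^ k) (by positivity)
    push_cast at h1
    refine h1.trans (le_of_eq ?_)
    have e1 : q ^ k = ((2 : ℝ) ^ k) ^ (-ε) := by
      rw [hpow, hq, one_div, Real.inv_rpow (by norm_num), Real.rpow_neg (by norm_num)]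
    rw [hpow', e1, ← Real.rpow_add (by positivity)]
    congr 2
    rw [hε]; ring
  set bad : ℕ → Set UnitAddCircle := fun k =>
    {x | ENNReal.ofReal (B * (1 / 2 ^ k : ℝ) ^ t) ≤ g k x} with hbad
  have hbadm : ∀ k, MeasurableSet (bad k) := fun k => measurableSet_le measurable_const (hgm k)
  have hbadν : ∀ k, ν (bad k) ≤ ENNReal.ofReal ((A / B) * q ^ k) := fun k => by
    have hpos : 0 < B * (1 / 2 ^ k : ℝ) ^ t := by positivity
    have h1 := meas_ge_le_lintegral_div (hgm k).aemeasurable (μ := ν)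
      (ε := ENNReal.ofReal (B * (1 / 2 ^ k : ℝ) ^ t)) (by simpa using hpos) ENNReal.ofReal_ne_top
    refine h1.trans ?_
    rw [hintg, ← ofReal_measureReal, ← ENNReal.ofReal_div_of_pos hpos]
    refine ENNReal.ofReal_le_ofReal ?_
    rw [div_le_iff₀ hpos]
    refine (hen k).trans (le_of_eq ?_)
    field_simp
  have hunion : ν (⋃ k, bad k) ≤ ENNReal.ofReal (1 / 2) := by
    have hsum : HasSum (fun k => (A / B) * q ^ k) (1 / 2) := by
      have := hgeom.mul_left (A / B)
      convert! this using 1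
      have : (1 - q) ≠ 0 := by linarith
      rw [hB]
      field_simp
    refine (measure_iUnion_le _).trans ((ENNReal.tsum_le_tsum hbadν).trans (le_of_eq ?_))
    rw [← ENNReal.ofReal_tsum_of_nonneg (fun k => by positivity) hsum.summable, hsum.tsum_eq]
  refine ⟨(⋃ k, bad k)ᶜ, B, (MeasurableSet.iUnion hbadm).compl, ?_, hB0, ?_⟩
  · rw [measure_compl (MeasurableSet.iUnion hbadm) (measure_ne_top _ _), measure_univ, tsub_pos_iff_lt]
    refine hunion.trans_lt ?_
    rw [← ENNReal.ofReal_one]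
    exact (ENNReal.ofReal_lt_ofReal_iff one_pos).mpr (by norm_num)
  · intro x hx k
    have hxk : x ∉ bad k := fun h => hx (mem_iUnion.mpr ⟨k, h⟩)
    simp only [hbad, mem_ofPred_eq, not_le] at hxk
    exact ENNReal.toReal_le_of_le_ofReal (by positivity) hxk.le

/-- The support of a measure with Fourier decay exponent `s` has Hausdorff dimension at
least `s`. -/
theorem le_dimH_of_mem_fourierDecayExponents {s : ℝ} (hs : s ∈ fourierDecayExponents ν)
    {A : Set UnitAddCircle} (hA : ν.support ⊆ A) : ENNReal.ofReal s ≤ dimH A := by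
  refine le_of_forall_lt fun t' ht' => ?_
  obtain ⟨t, ht1, ht2⟩ := ENNReal.lt_iff_exists_nnreal_btwn.mp ht'
  refine ht1.trans_le ?_
  have ht0 : (0 : ℝ) < t := by
    have : (0 : ℝ≥0∞) < t := zero_le.trans_lt ht1
    exact_mod_cast this
  have hts : (t : ℝ) < s := by
    rwa [← ENNReal.ofReal_coe_nnreal, ENNReal.ofReal_lt_ofReal_iff_of_nonneg ht0.le] at ht2
  obtain ⟨S, B, hSm, hS, hB, hfr⟩ := exists_frostman_set ν hs hts
  refine le_dimH_of_hausdorffMeasure_ne_zero ?_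
  set c : ℝ := 1 / (B * 16 ^ (t : ℝ)) with hc
  have hc0 : 0 < c := by positivity
  -- The mass distribution principle, for sets of diameter at most `1/8`, the scale of `k = 0`.
  have key : ENNReal.ofReal c • ν.restrict S ≤ Measure.hausdorffMeasure (t : ℝ) := by
    refine Measure.le_hausdorffMeasure _ _ (ENNReal.ofReal (1 / 8)) (by simp) fun U hU => ?_
    rw [Measure.smul_apply, smul_eq_mul, Measure.restrict_apply' hSm]
    rcases (U ∩ S).eq_empty_or_nonempty with he | ⟨x, hxU, hxS⟩
    · simp [he]
    have hUtop : Metric.ediam U ≠ ⊤ := (hU.trans_lt ENNReal.ofReal_lt_top).ne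
    set δ := (Metric.ediam U).toReal with hδ
    have hδU : Metric.ediam U = ENNReal.ofReal δ := (ENNReal.ofReal_toReal hUtop).symm
    have hδ0 : 0 ≤ δ := ENNReal.toReal_nonneg
    have hδ1 : δ ≤ 1 / 8 := by
      rw [hδU] at hU
      exact (ENNReal.ofReal_le_ofReal_iff (by norm_num)).mp hU
    have hball : ∀ k : ℕ, δ ≤ 1 / (8 * 2 ^ k) →
        ν (U ∩ S) ≤ ENNReal.ofReal (B * (1 / 2 ^ k : ℝ) ^ (t : ℝ)) := by
      intro k hk
      have hsub : U ∩ S ⊆ Metric.closedBall x (1 / (8 * 2 ^ k)) := by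
        intro y hy
        rw [Metric.mem_closedBall]
        refine le_trans ?_ hk
        have := Metric.edist_le_ediam_of_mem hy.1 hxU
        rw [hδU, edist_dist] at this
        exact (ENNReal.ofReal_le_ofReal_iff hδ0).mp this
      refine (measure_mono hsub).trans ?_
      rw [← ofReal_measureReal]
      exact ENNReal.ofReal_le_ofReal (hfr x hxS k)
    -- For diameter `0` the right side vanishes as well, so `U ∩ S` must be shown to be null; all
    -- scales `k` are available and the bound tends to `0`.
    rcases hδ0.eq_or_lt with h0 | hpos
    · have hz : ν (U ∩ S) = 0 := by
        have h1 : Tendsto (fun k : ℕ => (1 / 2 ^ k : ℝ)) atTop (nhds 0) := by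
          simpa only [one_div_pow] using
            tendsto_pow_atTop_nhds_zero_of_lt_one (r := (1 / 2 : ℝ)) (by norm_num) (by norm_num)
        have h2 := ENNReal.tendsto_ofReal ((h1.rpow_const (Or.inr ht0.le)).const_mul B)
        rw [Real.zero_rpow ht0.ne', mul_zero, ENNReal.ofReal_zero] at h2
        exact le_antisymm (ge_of_tendsto' h2 fun k => hball k (by rw [← h0]; positivity)) zero_le
      simp [hz]
    -- The dyadic scale with `2^(-k-1) < 8 δ ≤ 2^(-k)`; the loss is the factor `16 ^ t` in `c`.
    · obtain ⟨k, hk1, hk2⟩ := exists_nat_pow_near_of_lt_one (x := 8 * δ) (y := (1 / 2 : ℝ))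
        (by positivity) (by linarith) (by norm_num) (by norm_num)
      have hk' : δ ≤ 1 / (8 * 2 ^ k) := by
        rw [one_div_pow] at hk2
        rw [le_div_iff₀ (by positivity)]
        rw [le_div_iff₀ (by positivity)] at hk2
        linarith
      have hk3 : (1 / 2 ^ k : ℝ) ≤ 16 * δ := by
        rw [pow_succ, one_div_pow] at hk1
        linarith
      calc ENNReal.ofReal c * ν (U ∩ S)
          ≤ ENNReal.ofReal c * ENNReal.ofReal (B * (1 / 2 ^ k : ℝ) ^ (t : ℝ)) := by
            gcongr
            exact hball k hk'
        _ ≤ ENNReal.ofReal (δ ^ (t : ℝ)) := by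
          rw [← ENNReal.ofReal_mul hc0.le]
          refine ENNReal.ofReal_le_ofReal ?_
          have h1 : (1 / 2 ^ k : ℝ) ^ (t : ℝ) ≤ 16 ^ (t : ℝ) * δ ^ (t : ℝ) := by
            rw [← Real.mul_rpow (by norm_num) hδ0]
            exact Real.rpow_le_rpow (by positivity) hk3 ht0.le
          calc c * (B * (1 / 2 ^ k : ℝ) ^ (t : ℝ)) ≤ c * (B * (16 ^ (t : ℝ) * δ ^ (t : ℝ))) := by
                gcongr
            _ = δ ^ (t : ℝ) := by rw [hc]; field_simp
        _ = Metric.ediam U ^ (t : ℝ) := by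
          rw [hδU, ENNReal.ofReal_rpow_of_pos hpos]
  have hpos : 0 < (ENNReal.ofReal c • ν.restrict S) A := by
    have h1 : (ENNReal.ofReal c • ν.restrict S) ν.support = ENNReal.ofReal c * ν S := by
      rw [Measure.smul_apply, smul_eq_mul, Measure.restrict_apply' hSm]
      congr 1
      rw [inter_comm]
      exact measure_inter_conull Measure.measure_compl_support
    refine lt_of_lt_of_le ?_ (measure_mono hA)
    rw [h1]
    exact ENNReal.mul_pos (by simpa using hc0) hS.ne'
  exact (hpos.trans_le (key A)).ne'

theorem setFourierDim_le_dimH (A : Set UnitAddCircle) : setFourierDim A ≤ dimH A := by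
  unfold setFourierDim measureFourierDim
  exact iSup₂_le fun μ hμ => iSup₂_le fun s hs => le_dimH_of_mem_fourierDecayExponents _ hs hμ

end FourierDimLeHausdorffDim

/-! ### Weak limits of normalised densities -/

section LimitMeasure

open AddCircle Filter Topology

/-- The measure with density `f` with respect to the Haar measure, normalised to have mass `1`. -/
noncomputable def normalizedDensity (f : UnitAddCircle → ℝ) : Measure UnitAddCircle :=
  haarAddCircle.withDensity fun x => ENNReal.ofReal (f x / ∫ y, f y ∂haarAddCircle)

theorem isProbabilityMeasure_normalizedDensity {f : UnitAddCircle → ℝ} (hf : Continuous f)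
    (h0 : ∀ x, 0 ≤ f x) (hm : 0 < ∫ x, f x ∂haarAddCircle) :
    IsProbabilityMeasure (normalizedDensity f) := by
  constructor
  rw [normalizedDensity, withDensity_apply _ MeasurableSet.univ, Measure.restrict_univ,
    ← ofReal_integral_eq_lintegral_ofReal ((integrable_of_continuous hf).div_const _)
      (Eventually.of_forall fun x => div_nonneg (h0 x) hm.le),
    integral_div, div_self hm.ne', ENNReal.ofReal_one]

theorem measureFourierCoeff_normalizedDensity {f : UnitAddCircle → ℝ} (hf : Continuous f)
    (h0 : ∀ x, 0 ≤ f x) (hm : 0 < ∫ x, f x ∂haarAddCircle) (ξ : ℤ) :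
    measureFourierCoeff (normalizedDensity f) ξ =
      realFourierCoeff f ξ / ((∫ x, f x ∂haarAddCircle : ℝ) : ℂ) := by
  rw [measureFourierCoeff, normalizedDensity,
    integral_withDensity_eq_integral_toReal_smul (by fun_prop)
      (Eventually.of_forall fun x => ENNReal.ofReal_lt_top), realFourierCoeff, fourierCoeff,
    ← integral_div]
  refine integral_congr_ae (Eventually.of_forall fun x => ?_)
  simp only []
  rw [ENNReal.toReal_ofReal (div_nonneg (h0 x) hm.le), smul_eq_mul, Complex.real_smul]
  push_cast
  ring

theorem normalizedDensity_eq_zero {f : UnitAddCircle → ℝ} {U : Set UnitAddCircle} (hU : IsOpen U)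
    (h : ∀ x ∈ U, f x = 0) : normalizedDensity f U = 0 := by
  rw [normalizedDensity, withDensity_apply _ hU.measurableSet]
  rw [setLIntegral_congr_fun hU.measurableSet (g := fun _ => 0) fun x hx => by simp [h x hx]]
  simp

/-- A weak limit of normalised densities inherits Fourier bounds and support constraints. -/
theorem exists_limit_measure {f : ℕ → UnitAddCircle → ℝ} (hc : ∀ j, Continuous (f j))
    (h0 : ∀ j x, 0 ≤ f j x) (hm : ∀ j, 1 / 2 ≤ ∫ x, f j x ∂haarAddCircle) :
    ∃ ν : ProbabilityMeasure UnitAddCircle,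
      (∀ (ξ : ℤ) (B : ℝ), (∀ᶠ j in atTop, ‖realFourierCoeff (f j) ξ‖ ≤ B) →
        ‖measureFourierCoeff (ν : Measure UnitAddCircle) ξ‖ ≤ 2 * B) ∧
      ∀ S : Set UnitAddCircle, IsClosed S → (∀ᶠ j in atTop, ∀ x, f j x ≠ 0 → x ∈ S) →
        (ν : Measure UnitAddCircle).support ⊆ S := by
  have hm' : ∀ j, 0 < ∫ x, f j x ∂haarAddCircle := fun j => by linarith [hm j]
  set μ : ℕ → ProbabilityMeasure UnitAddCircle := fun j =>
    ⟨normalizedDensity (f j), isProbabilityMeasure_normalizedDensity (hc j) (h0 j) (hm' j)⟩ with hμ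
  -- By compactness of the space of probability measures, an ultrafilter finer than `atTop` replaces
  -- a convergent subsequence; eventual properties pass to it.
  obtain ⟨ν, -, hν⟩ := isCompact_univ.ultrafilter_le_nhds
    ((Ultrafilter.of (atTop : Filter ℕ)).map μ) (by simp)
  have hL : (Ultrafilter.of (atTop : Filter ℕ) : Filter ℕ) ≤ atTop := Ultrafilter.of_le _
  have hlim : Tendsto μ (Ultrafilter.of (atTop : Filter ℕ) : Filter ℕ) (𝓝 ν) := hν
  refine ⟨ν, fun ξ B hB => ?_, fun S hS h => ?_⟩
  · have h1 := (ProbabilityMeasure.tendsto_iff_forall_integral_rclike_tendsto ℂ).mp hlim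
      (BoundedContinuousFunction.mkOfCompact (fourier (-ξ)))
    refine le_of_tendsto h1.norm ?_
    filter_upwards [hL hB] with j hj
    have h2 := measureFourierCoeff_normalizedDensity (hc j) (h0 j) (hm' j) ξ
    rw [measureFourierCoeff] at h2
    simp only [BoundedContinuousFunction.mkOfCompact_apply]
    change ‖∫ x, fourier (-ξ) x ∂(normalizedDensity (f j))‖ ≤ _
    rw [h2, norm_div, Complex.norm_real, Real.norm_of_nonneg (hm' j).le, div_le_iff₀ (hm' j)]
    have := hm j
    have hB0 : 0 ≤ B := (norm_nonneg _).trans hj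
    nlinarith
  · refine Measure.support_subset_of_isClosed hS ?_
    rw [mem_ae_iff]
    -- The limit mass of an open set is at most the lower limit of its masses, so the complement of
    -- `S` is null.
    have h1 := ProbabilityMeasure.le_liminf_measure_open_of_tendsto hlim hS.isOpen_compl
    refine le_antisymm (h1.trans ?_) zero_le
    have h2 : ∀ᶠ j in (Ultrafilter.of (atTop : Filter ℕ) : Filter ℕ),
        (μ j : Measure UnitAddCircle) Sᶜ = 0 := by
      filter_upwards [hL h] with j hj
      exact normalizedDensity_eq_zero hS.isOpen_compl fun x hx => by
        by_contra hne
        exact hx (hj x hne)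
    rw [liminf_congr h2]
    simp

end LimitMeasure

/-! ### Upper bound for the Hausdorff dimension from covers -/

section HausdorffUpperBound

open Filter Topology

/-- A set covered, at arbitrarily small scales `r`, by about `r ^ (-p)` balls for every `p > d` has
Hausdorff dimension at most `d`. -/
theorem dimH_le_of_covers {X : Type*} [MetricSpace X] [MeasurableSpace X] [BorelSpace X]
    {S : Set X} {d : ℝ} (hd : 0 ≤ d) (P : ℕ → Finset X) (r p : ℕ → ℝ) (hr : ∀ k, 0 < r k)
    (hr0 : Tendsto r atTop (𝓝 0)) (hp : Tendsto p atTop (𝓝 d))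
    (hP : ∀ k, (P k).card * r k ^ p k ≤ 1)
    (hS : ∀ k, S ⊆ ⋃ y ∈ P k, Metric.closedBall y (r k)) : dimH S ≤ ENNReal.ofReal d := by
  have key : ∀ q : ℝ, d < q → dimH S ≤ ENNReal.ofReal q := by
    intro q hq
    have hq0 : 0 ≤ q := hd.trans hq.le
    refine dimH_le_of_hausdorffMeasure_ne_top (d := q.toNNReal) ?_
    rw [Real.coe_toNNReal _ hq0]
    have h1 := Measure.hausdorffMeasure_le_liminf_sum (ι := fun k => P k) q S (l := atTop)
      (fun k => ENNReal.ofReal (2 * r k))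
      (by
        have : Tendsto (fun k => 2 * r k) atTop (𝓝 0) := by simpa using hr0.const_mul 2
        simpa using ENNReal.tendsto_ofReal this)
      (fun k y => Metric.closedBall (y : X) (r k))
      (Eventually.of_forall fun k y => by
        refine Metric.ediam_le_of_forall_dist_le fun a ha b hb => ?_
        have h1 := Metric.mem_closedBall.mp ha
        have h2 := Metric.mem_closedBall'.mp hb
        linarith [dist_triangle a (y : X) b])
      (Eventually.of_forall fun k => by
        refine (hS k).trans ?_
        intro x hx
        simp only [mem_iUnion] at hx ⊢
        obtain ⟨y, hy, hx⟩ := hx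
        exact ⟨⟨y, hy⟩, hx⟩)
    have h2 : ∀ᶠ k in atTop, ∑ y : P k, Metric.ediam (Metric.closedBall (y : X) (r k)) ^ q ≤
        ENNReal.ofReal (2 ^ q) := by
      filter_upwards [hp.eventually (gt_mem_nhds hq), hr0.eventually (gt_mem_nhds one_pos)]
        with k hk hk1
      calc ∑ y : P k, Metric.ediam (Metric.closedBall (y : X) (r k)) ^ q
          ≤ ∑ _y : P k, ENNReal.ofReal ((2 * r k) ^ q) := by
            refine Finset.sum_le_sum fun y _ => ?_
            rw [← ENNReal.ofReal_rpow_of_pos (by linarith [hr k])]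
            refine ENNReal.rpow_le_rpow ?_ hq0
            refine Metric.ediam_le_of_forall_dist_le fun a ha b hb => ?_
            have h1 := Metric.mem_closedBall.mp ha
            have h2 := Metric.mem_closedBall'.mp hb
            linarith [dist_triangle a (y : X) b]
        _ = ENNReal.ofReal ((P k).card * (2 * r k) ^ q) := by
            rw [Finset.sum_const, Finset.card_univ, Fintype.card_coe, nsmul_eq_mul,
              ENNReal.ofReal_mul (by positivity), ENNReal.ofReal_natCast]
        _ ≤ ENNReal.ofReal (2 ^ q) := by
            refine ENNReal.ofReal_le_ofReal ?_
            rw [Real.mul_rpow (by norm_num) (hr k).le]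
            -- Once `p k < q` and `r k < 1`, the bound for the exponent `p k` passes to `q`.
            have h3 : r k ^ q ≤ r k ^ p k :=
              Real.rpow_le_rpow_of_exponent_ge (hr k) hk1.le hk.le
            have h4 : ((P k).card : ℝ) * r k ^ q ≤ 1 :=
              (mul_le_mul_of_nonneg_left h3 (by positivity)).trans (hP k)
            have h5 : (0 : ℝ) < 2 ^ q := by positivity
            nlinarith
    refine ne_top_of_le_ne_top (b := ENNReal.ofReal (2 ^ q)) ENNReal.ofReal_ne_top (h1.trans ?_)
    refine (liminf_le_liminf h2).trans ?_
    simp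
  refine ge_of_tendsto (x := 𝓝[>] d) (f := fun q => ENNReal.ofReal q) ?_ ?_
  · exact (ENNReal.continuous_ofReal.tendsto d).mono_left nhdsWithin_le_nhds
  · filter_upwards [self_mem_nhdsWithin] with q hq using key q hq

end HausdorffUpperBound

/-! ### Countably many triples of intervals suffice -/

section Triples

/-- Every triple of distinct points is caught by a separated triple with rational data. -/
theorem exists_rat_isSeparatedTriple {α β : ℝ} {t : Fin 3 → ℝ} (ht : ∀ i, t i ∈ Ioo α β)
    (hinj : Function.Injective t) :
    ∃ (a : Fin 3 → ℚ) (ρ : ℚ), IsSeparatedTriple (Icc α β) (fun i => (a i : ℝ)) ρ ∧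
      ∀ i, |t i - a i| ≤ ρ / 2 := by
  have h1 : ∃ ε : ℝ, 0 < ε ∧ (∀ i, α + ε ≤ t i ∧ t i + ε ≤ β) ∧
      ∀ i j, i ≠ j → ε ≤ |t i - t j| := by
    have hne : ∀ i j, i ≠ j → 0 < |t i - t j| := fun i j hij =>
      abs_pos.mpr (sub_ne_zero.mpr (hinj.ne hij))
    have e1 := fun i => sub_pos.mpr (ht i).1
    have e2 := fun i => sub_pos.mpr (ht i).2
    have hfin : ∀ g : Fin 3 × Fin 3 → ℝ, (∀ p, 0 < g p) → ∃ ε > 0, ∀ p, ε ≤ g p := by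
      intro g hg
      obtain ⟨p, hp⟩ := Finite.exists_min g
      exact ⟨g p, hg p, hp⟩
    obtain ⟨ε, hε, hle⟩ := hfin
      (fun p => min (min (t p.1 - α) (β - t p.1)) (if p.1 = p.2 then 1 else |t p.1 - t p.2|))
      (fun p => by
        refine lt_min (lt_min (e1 _) (e2 _)) ?_
        split_ifs with h
        · exact one_pos
        · exact hne _ _ h)
    refine ⟨ε, hε, fun i => ?_, fun i j hij => ?_⟩
    · have := hle (i, i)
      simp only [le_min_iff] at this
      constructor <;> linarith [this.1.1, this.1.2]
    · have := hle (i, j)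
      simp only [le_min_iff, if_neg hij] at this
      exact this.2
  obtain ⟨ε, hε, hI, hsep⟩ := h1
  -- With `ρ < ε / 4` and centres within `ρ / 2` of the points, the centres stay more than `ε - ρ >
  -- 3ρ` apart and the intervals stay inside.
  obtain ⟨ρ, hρ0, hρ⟩ := exists_rat_btwn (show (0 : ℝ) < ε / 4 by linarith)
  choose a ha using fun i => exists_rat_near (t i) (show (0 : ℝ) < ρ / 2 by linarith)
  refine ⟨a, ρ, ⟨hρ0, fun i x hx => ?_, fun i j hij => ?_⟩, fun i => (ha i).le⟩
  · have h2 := abs_le.mp (ha i).le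
    have h3 := hI i
    constructor <;> linarith [hx.1, hx.2]
  · have h2 := hsep i j hij
    have h3 := ha i
    have h4 := ha j
    have h5 : |t i - t j| ≤ |t i - a i| + |(a i : ℝ) - a j| + |t j - a j| := by
      rw [abs_sub_comm (t j)]
      calc |t i - t j| = |(t i - a i) + ((a i : ℝ) - a j) + (a j - t j)| := by ring_nf
        _ ≤ _ := abs_add_three _ _ _
    linarith

end Triples

/-! ### Iterated refinement of densities -/

section Construction

open AddCircle Filter Topology

variable {V : Type*} [NormedAddCommGroup V]

/-- The properties preserved by the successive densities. -/
structure IsDecayingDensity (f : UnitAddCircle → ℝ) : Prop where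
  continuous : Continuous f
  nonneg : ∀ x, 0 ≤ f x
  decay : HasQuadraticDecay f

/-- `g` refines the density `f`: its Fourier coefficients are close to those of `f`, and its support
is covered by few balls around the points of `P`. -/
structure IsRefinement (f g : UnitAddCircle → ℝ) (r : ℝ) (P : Finset UnitAddCircle)
    (δ s p : ℝ) : Prop where
  coeff : ∀ ξ : ℤ, ‖realFourierCoeff g ξ - realFourierCoeff f ξ‖ ≤ δ * (1 + |(ξ : ℝ)|) ^ (-s)
  pos : 0 < r
  le : r ≤ δ
  card : P.card * r ^ p ≤ δ
  support : ∀ x, g x ≠ 0 → f x ≠ 0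
  cover : ∀ x, g x ≠ 0 → ∃ y ∈ P, dist x y ≤ r

theorem isDecayingDensity_tent {r : ℝ} (hr : 0 < r) (hr2 : r ≤ 1 / 2) (a : UnitAddCircle) :
    IsDecayingDensity fun x => tent r (x - a) where
  continuous := (continuous_tent r).comp (continuous_sub_right a)
  nonneg x := tent_nonneg _ _
  decay := by
    refine ⟨4 / r ^ 2, fun n => ?_⟩
    rw [realFourierCoeff_translate, norm_mul, norm_fourier_apply, one_mul]
    rcases eq_or_ne n 0 with rfl | hn
    · refine (norm_realFourierCoeff_tent_le_one hr hr2 0).trans ?_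
      simp only [Int.cast_zero, abs_zero, add_zero, one_pow, div_one, mul_one]
      rw [le_div_iff₀ (by positivity)]
      nlinarith
    · refine (norm_realFourierCoeff_tent_le hr hr2 hn).trans ?_
      have hn1 : (1 : ℝ) ≤ |(n : ℝ)| := by
        rw [← Int.cast_abs]; exact_mod_cast Int.one_le_abs hn
      rw [div_mul_div_comm, mul_one, div_le_div_iff₀ (by positivity) (by positivity)]
      have : (1 + |(n : ℝ)|) ^ 2 ≤ 4 * |(n : ℝ)| ^ 2 := by nlinarith
      nlinarith [sq_nonneg r]

/-- The new density is `f * F`. The perturbation constant `A` depends on `f`, so `F` is chosen after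
`f`, with accuracy `min δ (δ / A)` to compensate. -/
theorem IsDecayingDensity.exists_refinement {γ : ℝ → V} {I : Set ℝ} {c K : ℝ}
    (h : RegularDistances γ I c K) (hI : I ⊆ Icc (1 / 4) (3 / 4)) {a : Fin 3 → ℝ} {ρ : ℝ}
    (ha : IsSeparatedTriple I a ρ) {s p δ : ℝ} (hs0 : 0 ≤ s) (hs : s < 2 / 9) (hp : 4 / 9 < p)
    (hδ : 0 < δ) {f : UnitAddCircle → ℝ} (hf : IsDecayingDensity f) :
    ∃ g r P, IsDecayingDensity g ∧ IsRefinement f g r P δ s p ∧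
      ∀ t : Fin 3 → ℝ, (∀ i, |t i - a i| ≤ ρ / 2) →
        (∀ i, ∃ y ∈ P, dist (t i : UnitAddCircle) y ≤ r) →
        ‖γ (t 0) - γ (t 1)‖ ≠ ‖γ (t 1) - γ (t 2)‖ := by
  obtain ⟨A, hA, hAf⟩ := hf.decay.exists_norm_mul_sub_le hf.continuous
  have hδ' : 0 < min δ (δ / A) := lt_min hδ (div_pos hδ hA)
  obtain ⟨F, r, P, hFc, hF0, hFd, hF1, hFb, hr0, hr, hP, hcov, hav⟩ :=
    exists_multiplier h hI ha hs0 hs hp hδ'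
  refine ⟨fun x => f x * F x, r, P, ⟨hf.continuous.mul hFc, fun x => mul_nonneg (hf.nonneg x) (hF0 x),
    hf.decay.mul hf.continuous hFc hFd⟩, ⟨fun ξ => ?_, hr0, hr.trans (min_le_left _ _),
    hP.trans (min_le_left _ _), fun x hx => left_ne_zero_of_mul hx,
    fun x hx => hcov x (right_ne_zero_of_mul hx)⟩, hav⟩
  refine (hAf F _ s hFc hFd.summable hF1 hs0 (by linarith) hδ'.le hFb ξ).trans ?_
  gcongr
  calc A * min δ (δ / A) ≤ A * (δ / A) := by gcongr; exact min_le_right _ _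
    _ = δ := by field_simp

theorem exists_refining_sequence {γ : ℝ → V} {I : Set ℝ} {c K : ℝ}
    (h : RegularDistances γ I c K) (hI : I ⊆ Icc (1 / 4) (3 / 4)) {a : ℕ → Fin 3 → ℝ} {ρ : ℕ → ℝ}
    (ha : ∀ k, IsSeparatedTriple I (a k) (ρ k)) {s p δ : ℕ → ℝ} (hs0 : ∀ k, 0 ≤ s k)
    (hs : ∀ k, s k < 2 / 9) (hp : ∀ k, 4 / 9 < p k) (hδ : ∀ k, 0 < δ k)
    {f₀ : UnitAddCircle → ℝ} (hf₀ : IsDecayingDensity f₀) :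
    ∃ (f : ℕ → UnitAddCircle → ℝ) (r : ℕ → ℝ) (P : ℕ → Finset UnitAddCircle), f 0 = f₀ ∧
      (∀ k, IsDecayingDensity (f k)) ∧
      (∀ k, IsRefinement (f k) (f (k + 1)) (r k) (P k) (δ k) (s k) (p k)) ∧
      ∀ k, ∀ t : Fin 3 → ℝ, (∀ i, |t i - a k i| ≤ ρ k / 2) →
        (∀ i, ∃ y ∈ P k, dist (t i : UnitAddCircle) y ≤ r k) →
        ‖γ (t 0) - γ (t 1)‖ ≠ ‖γ (t 1) - γ (t 2)‖ := by
  choose g r P hg hgr hgt using fun (k : ℕ) (f : {f // IsDecayingDensity f}) =>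
    f.2.exists_refinement h hI (ha k) (hs0 k) (hs k) (hp k) (hδ k)
  -- The recursion runs in a subtype because each multiplier depends on the decay of the density
  -- already built.
  let f : ℕ → {f // IsDecayingDensity f} := fun k =>
    Nat.rec ⟨f₀, hf₀⟩ (fun k f => ⟨g k f, hg k f⟩) k
  exact ⟨fun k => (f k).1, fun k => r k (f k), fun k => P k (f k), rfl, fun k => (f k).2,
    fun k => hgr k (f k), fun k => hgt k (f k)⟩

theorem sum_half_pow_le (j : ℕ) : ∑ k ∈ Finset.range j, (1 / 2 : ℝ) ^ (k + 2) ≤ 1 / 2 := by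
  have h : ∑ k ∈ Finset.range j, (1 / 2 : ℝ) ^ (k + 2) = 1 / 2 - (1 / 2) ^ (j + 1) := by
    induction j with
    | zero => norm_num
    | succ j ih => rw [Finset.sum_range_succ, ih]; ring
  rw [h]
  linarith [show (0 : ℝ) < (1 / 2) ^ (j + 1) by positivity]

section Sequence

variable {f : ℕ → UnitAddCircle → ℝ} {r s p : ℕ → ℝ} {P : ℕ → Finset UnitAddCircle}

/-- Stage `k` changes the coefficient at `0` by at most `2^(-k-2)`, hence all stages together by at
most `1/2`. -/
theorem half_le_integral_of_isRefinement
    (hr : ∀ k, IsRefinement (f k) (f (k + 1)) (r k) (P k) ((1 / 2) ^ (k + 2)) (s k) (p k))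
    (h0 : ∫ x, f 0 x ∂haarAddCircle = 1) (j : ℕ) :
    1 / 2 ≤ ∫ x, f j x ∂haarAddCircle := by
  have h1 : ∀ j, |(∫ x, f j x ∂haarAddCircle) - 1| ≤ ∑ k ∈ Finset.range j, (1 / 2 : ℝ) ^ (k + 2) := by
    intro j
    induction j with
    | zero => simp [h0]
    | succ j ih =>
      have h2 := (hr j).coeff 0
      rw [realFourierCoeff_zero, realFourierCoeff_zero, ← Complex.ofReal_sub, Complex.norm_real,
        Real.norm_eq_abs] at h2
      simp only [Int.cast_zero, abs_zero, add_zero, Real.one_rpow, mul_one] at h2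
      rw [Finset.sum_range_succ]
      refine le_trans ?_ (add_le_add ih h2)
      refine le_trans (le_of_eq ?_) (abs_add_le _ _)
      congr 1
      ring
  have h2 := abs_le.mp ((h1 j).trans (sum_half_pow_le j))
  linarith

/-- Stages before `k₀` are harmless for the exponent `s k₀`, since `f k₀` decays quadratically;
later increments have exponents at least `s k₀` and summable constants. Thus `C` depends on `k₀` but
not on `j`. -/
theorem exists_norm_realFourierCoeff_le_of_isRefinement
    (hr : ∀ k, IsRefinement (f k) (f (k + 1)) (r k) (P k) ((1 / 2) ^ (k + 2)) (s k) (p k))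
    (hf : ∀ k, IsDecayingDensity (f k))
    (hs : Monotone s) (hs2 : ∀ k, s k ≤ 2) (k₀ : ℕ) : ∃ C, 0 ≤ C ∧ ∀ j ≥ k₀, ∀ ξ : ℤ,
      ‖realFourierCoeff (f j) ξ‖ ≤ C * (1 + |(ξ : ℝ)|) ^ (-s k₀) := by
  obtain ⟨C, hC⟩ := (hf k₀).decay
  have hC0 : 0 ≤ C := by
    have := (norm_nonneg _).trans (hC 0)
    simpa using this
  refine ⟨C + 1 / 2, by linarith, fun j hj ξ => ?_⟩
  have h1 : (1 : ℝ) ≤ 1 + |(ξ : ℝ)| := by linarith [abs_nonneg (ξ : ℝ)]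
  have h3 : ∀ j ≥ k₀, ‖realFourierCoeff (f j) ξ‖ ≤
      (C + ∑ k ∈ Finset.range j, (1 / 2 : ℝ) ^ (k + 2)) * (1 + |(ξ : ℝ)|) ^ (-s k₀) := by
    intro j hj
    induction j, hj using Nat.le_induction with
    | base =>
      refine (hC ξ).trans ?_
      have h2 : 1 / (1 + |(ξ : ℝ)|) ^ 2 ≤ (1 + |(ξ : ℝ)|) ^ (-s k₀) := by
        rw [one_div, ← Real.rpow_natCast, ← Real.rpow_neg (by linarith)]
        exact Real.rpow_le_rpow_of_exponent_le h1 (by push_cast; linarith [hs2 k₀])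
      refine mul_le_mul (le_add_of_nonneg_right (by positivity)) h2 (by positivity) (by positivity)
    | succ j hj ih =>
      have h4 := (hr j).coeff ξ
      have h5 : (1 + |(ξ : ℝ)|) ^ (-s j) ≤ (1 + |(ξ : ℝ)|) ^ (-s k₀) :=
        Real.rpow_le_rpow_of_exponent_le h1 (neg_le_neg (hs hj))
      have h6 := mul_le_mul_of_nonneg_left h5 (show (0 : ℝ) ≤ (1 / 2) ^ (j + 2) by positivity)
      have h7 := norm_le_norm_add_norm_sub' (realFourierCoeff (f (j + 1)) ξ)
        (realFourierCoeff (f j) ξ)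
      rw [Finset.sum_range_succ]
      linarith
  refine (h3 j hj).trans ?_
  gcongr
  exact sum_half_pow_le j

theorem ne_zero_of_isRefinement
    (hr : ∀ k, IsRefinement (f k) (f (k + 1)) (r k) (P k) ((1 / 2) ^ (k + 2)) (s k) (p k))
    {k j : ℕ} (hkj : k ≤ j) {x : UnitAddCircle} (hx : f j x ≠ 0) :
    f k x ≠ 0 := by
  induction j, hkj using Nat.le_induction with
  | base => exact hx
  | succ j _ ih => exact ih ((hr j).support x hx)

end Sequence

end Construction

/-! ### The Salem measure and the main theorem -/

section MainTheorem

open AddCircle Filter Topology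

theorem ofReal_four_div_nine : ENNReal.ofReal (4 / 9) = 4 / 9 := by
  rw [ENNReal.ofReal_div_of_pos (by norm_num)]
  norm_num

/-- A probability measure all of whose Fourier coefficients decay with every exponent below `d / 2`
has Fourier dimension at least `d`. -/
theorem ofReal_le_measureFourierDim {ν : Measure UnitAddCircle} {d : ℝ} {s : ℕ → ℝ} (hd : d ≤ 1)
    (hs0 : ∀ k, 0 ≤ s k) (hsd : ∀ k, 2 * s k ≤ d) (hs : Tendsto s atTop (𝓝 (d / 2)))
    (h : ∀ k, ∃ C, 0 ≤ C ∧ ∀ ξ : ℤ, ‖measureFourierCoeff ν ξ‖ ≤ C * (1 + |(ξ : ℝ)|) ^ (-s k)) :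
    ENNReal.ofReal d ≤ measureFourierDim ν := by
  have hlim : Tendsto (fun k => ENNReal.ofReal (2 * s k)) atTop (𝓝 (ENNReal.ofReal d)) := by
    refine ENNReal.tendsto_ofReal ?_
    have := hs.const_mul 2
    rwa [show 2 * (d / 2) = d by ring] at this
  refine le_of_tendsto hlim (Eventually.of_forall fun k => ?_)
  refine le_iSup₂ (f := fun (s : ℝ) (_ : s ∈ fourierDecayExponents ν) => ENNReal.ofReal s)
    (2 * s k) ⟨⟨by linarith [hs0 k], (hsd k).trans hd⟩, ?_⟩
  obtain ⟨C, hC0, hC⟩ := h k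
  refine ⟨C, fun ξ => ?_⟩
  have h1 : (0 : ℝ) < 1 + |(ξ : ℝ)| := by positivity
  rw [show 2 * s k / 2 = s k by ring]
  calc ‖measureFourierCoeff ν ξ‖ * |(ξ : ℝ)| ^ s k
      ≤ C * (1 + |(ξ : ℝ)|) ^ (-s k) * (1 + |(ξ : ℝ)|) ^ s k := by
        refine mul_le_mul (hC ξ) ?_ (by positivity) (by positivity)
        exact Real.rpow_le_rpow (abs_nonneg _) (by linarith) (hs0 k)
    _ = C := by rw [mul_assoc, ← Real.rpow_add h1]; simp

theorem injective_vec3 {α : Type*} {x y z : α} (hxy : x ≠ y) (hyz : y ≠ z) (hxz : x ≠ z) :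
    Function.Injective ![x, y, z] := by
  intro i j hij
  fin_cases i <;> fin_cases j <;> simp_all

/-- A curve with regular distances carries a Salem measure whose support avoids isosceles
triangles. -/
theorem RegularDistances.exists_salem_measure {V : Type*} [NormedAddCommGroup V] {γ : ℝ → V}
    {η c K : ℝ} (hη : 0 < η) (hη4 : η ≤ 1 / 4)
    (h : RegularDistances γ (Icc (1 / 2 - η) (1 / 2 + η)) c K) :
    ∃ ν : ProbabilityMeasure UnitAddCircle,
      ENNReal.ofReal (4 / 9) ≤ measureFourierDim (ν : Measure UnitAddCircle) ∧
      dimH (ν : Measure UnitAddCircle).support ≤ ENNReal.ofReal (4 / 9) ∧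
      (ν : Measure UnitAddCircle).support ⊆
        Metric.closedBall ((1 / 2 : ℝ) : UnitAddCircle) (η / 2) ∧
      ∀ t : Fin 3 → ℝ, Function.Injective t → (∀ i, t i ∈ Ioo (1 / 2 - η) (1 / 2 + η)) →
        (∀ i, (t i : UnitAddCircle) ∈ (ν : Measure UnitAddCircle).support) →
        ‖γ (t 0) - γ (t 1)‖ ≠ ‖γ (t 1) - γ (t 2)‖ := by
  have hI : Icc (1 / 2 - η) (1 / 2 + η) ⊆ Icc (1 / 4 : ℝ) (3 / 4) :=
    Icc_subset_Icc (by linarith) (by linarith)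
  -- The separated triples with rational data, which the surjection `e` from `ℕ` distributes over
  -- the stages. One treatment of each is enough, because the final support stays in the cover of
  -- its stage.
  let T := {q : (Fin 3 → ℚ) × ℚ //
    IsSeparatedTriple (Icc (1 / 2 - η) (1 / 2 + η)) (fun i => (q.1 i : ℝ)) q.2}
  have hT : Nonempty T := by
    obtain ⟨a, ρ, h1, -⟩ := exists_rat_isSeparatedTriple (α := 1 / 2 - η) (β := 1 / 2 + η)
      (t := fun i : Fin 3 => 1 / 2 + η * ((i : ℕ) : ℝ) / 4)
      (fun i => by
        have hi : ((i : ℕ) : ℝ) ≤ 2 := by exact_mod_cast Nat.lt_succ_iff.mp i.2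
        have hi0 : (0 : ℝ) ≤ ((i : ℕ) : ℝ) := by positivity
        constructor <;> nlinarith)
      (fun i j hij => by
        have h2 : η * ((i : ℕ) : ℝ) = η * ((j : ℕ) : ℝ) := by
          simp only [] at hij
          linarith
        exact Fin.ext (by exact_mod_cast mul_left_cancel₀ hη.ne' h2))
    exact ⟨⟨(a, ρ), h1⟩⟩
  obtain ⟨e, he⟩ := exists_surjective_nat T
  -- Every stage allows only `s < 2/9` and `p > 4/9`; the critical exponents are reached in the
  -- limit, `s` increasing from `0`.
  set s : ℕ → ℝ := fun k => 2 / 9 - 2 / 9 * (1 / ((k : ℝ) + 1)) with hs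
  set p : ℕ → ℝ := fun k => 4 / 9 + 1 / ((k : ℝ) + 1) with hp
  have hk : ∀ k : ℕ, 0 < 1 / ((k : ℝ) + 1) := fun k => by positivity
  have hk1 : ∀ k : ℕ, 1 / ((k : ℝ) + 1) ≤ 1 := fun k => by
    rw [div_le_one (by positivity)]
    linarith [show (0 : ℝ) ≤ k by positivity]
  have hs0 : ∀ k, 0 ≤ s k := fun k => by simp only [hs]; linarith [hk1 k]
  have hs1 : ∀ k, s k < 2 / 9 := fun k => by simp only [hs]; linarith [hk k]
  have hsm : Monotone s := fun i j hij => by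
    have := one_div_le_one_div_of_le (show (0 : ℝ) < (i : ℝ) + 1 by positivity)
      (show (i : ℝ) + 1 ≤ (j : ℝ) + 1 by exact_mod_cast Nat.succ_le_succ hij)
    simp only [hs]
    linarith
  have hst : Tendsto s atTop (𝓝 (2 / 9)) := by
    simpa [hs] using (tendsto_one_div_add_atTop_nhds_zero_nat (𝕜 := ℝ)).const_mul (2 / 9)
      |>.const_sub (2 / 9)
  have hpt : Tendsto p atTop (𝓝 (4 / 9)) := by
    simpa [hp] using (tendsto_one_div_add_atTop_nhds_zero_nat (𝕜 := ℝ)).const_add (4 / 9)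
  obtain ⟨f, r, P, hf0, hfd, hfr, hav⟩ := exists_refining_sequence h hI (fun k => (e k).2)
    (s := s) (p := p) (δ := fun k => (1 / 2) ^ (k + 2)) hs0 hs1 (fun k => by simp only [hp]; linarith [hk k])
    (fun k => by positivity)
    (isDecayingDensity_tent (r := η / 2) (by linarith) (by linarith) ((1 / 2 : ℝ) : UnitAddCircle))
  have hmass : ∫ x, f 0 x ∂haarAddCircle = 1 := by
    rw [hf0, integral_sub_right_eq_self (tent (η / 2))]
    exact integral_tent (by linarith) (by linarith)
  obtain ⟨ν, hν, hsupp⟩ := exists_limit_measure (fun j => (hfd j).continuous)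
    (fun j => (hfd j).nonneg) (half_le_integral_of_isRefinement hfr hmass)
  -- All later densities vanish outside the closed cover of stage `k`, hence so does `ν`. Both the
  -- dimension bound and the avoidance use only this.
  have hcover : ∀ k, (ν : Measure UnitAddCircle).support ⊆
      ⋃ y ∈ P k, Metric.closedBall y (r k) := fun k => by
    refine hsupp _ ((P k).finite_toSet.isClosed_biUnion fun y _ => Metric.isClosed_closedBall) ?_
    filter_upwards [eventually_ge_atTop (k + 1)] with j hj x hx
    obtain ⟨y, hy, hxy⟩ := (hfr k).cover x (ne_zero_of_isRefinement hfr hj hx)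
    exact mem_biUnion hy hxy
  refine ⟨ν, ?_, ?_, ?_, fun t hinj ht hts => ?_⟩
  · refine ofReal_le_measureFourierDim (s := s) (by norm_num) hs0 (fun k => by linarith [hs1 k])
      (by convert hst using 2; norm_num) fun k => ?_
    obtain ⟨C, hC0, hC⟩ := exists_norm_realFourierCoeff_le_of_isRefinement hfr hfd hsm
      (fun k => by linarith [hs1 k]) k
    refine ⟨2 * C, by linarith, fun ξ => ?_⟩
    rw [mul_assoc]
    refine hν ξ _ ?_
    filter_upwards [eventually_ge_atTop k] with j hj using hC j hj ξ
  · refine dimH_le_of_covers (by norm_num) P r p (fun k => (hfr k).pos) ?_ hpt (fun k => ?_) hcover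
    · refine squeeze_zero (fun k => (hfr k).pos.le) (fun k => (hfr k).le) ?_
      exact (tendsto_pow_atTop_nhds_zero_of_lt_one (by norm_num) (by norm_num)).comp
        (tendsto_add_atTop_nat 2)
    · exact (hfr k).card.trans (pow_le_one₀ (by norm_num) (by norm_num))
  · refine hsupp _ Metric.isClosed_closedBall (Eventually.of_forall fun j x hx => ?_)
    have h1 := ne_zero_of_isRefinement hfr (Nat.zero_le j) hx
    rw [hf0] at h1
    rw [Metric.mem_closedBall, dist_eq_norm]
    by_contra hcon
    exact h1 (tent_eq_zero (not_le.mp hcon).le)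
  · obtain ⟨a, ρ, h1, h2⟩ := exists_rat_isSeparatedTriple ht hinj
    obtain ⟨k, hk⟩ := he ⟨(a, ρ), h1⟩
    refine hav k t ?_ fun i => ?_
    · rw [hk]
      exact h2
    · have h3 := hcover k (hts i)
      simp only [mem_iUnion] at h3
      obtain ⟨y, hy, h4⟩ := h3
      exact ⟨y, hy, h4⟩

end MainTheorem

theorem mainTheorem5 (d : ℕ) (γ : ℝ → EuclideanSpace ℝ (Fin d))
    (hγ : ContDiffOn ℝ ∞ γ (Icc (0 : ℝ) 1))
    (hγ' : ∀ t ∈ Icc (0 : ℝ) 1, derivWithin γ (Icc (0 : ℝ) 1) t ≠ 0) :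
    ∃ E : Set ℝ, E ⊆ Icc (0 : ℝ) 1 ∧ IsSalemSet (circleImage E) ∧
      setFourierDim (circleImage E) = 4 / 9 ∧ AvoidsIsoscelesTriangles γ E := by
  obtain ⟨η, c, K, hη, hη4, hc, hK, hlip, hgrow⟩ := exists_interval_distances hγ hγ'
  have hreg : RegularDistances γ (Icc (1 / 2 - η) (1 / 2 + η)) c K :=
    ⟨hc, hK, hlip, fun s hs t ht u hu h1 h2 => (hgrow s hs t ht u hu h1 h2).1,
      fun s hs t ht u hu h1 h2 => (hgrow s hs t ht u hu h1 h2).2⟩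
  obtain ⟨ν, hF, hH, hsub, hav⟩ := hreg.exists_salem_measure hη hη4
  set S := (ν : Measure UnitAddCircle).support with hS
  -- The support of `ν` lies over `|t - 1/2| ≤ η / 2`, so each of its points has a representative
  -- here, inside the open interval on which triples are controlled.
  set E : Set ℝ := {t | t ∈ Icc (1 / 2 - η / 2) (1 / 2 + η / 2) ∧ (t : UnitAddCircle) ∈ S} with hE
  have himg : circleImage E = S := by
    refine subset_antisymm ?_ fun x hx => ?_
    · rintro _ ⟨t, ht, rfl⟩
      exact ht.2
    · have hxb := hsub hx
      rw [Metric.mem_closedBall, dist_eq_norm] at hxb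
      obtain ⟨u, hu⟩ := QuotientAddGroup.mk_surjective (x - ((1 / 2 : ℝ) : UnitAddCircle))
      have hu' : (u : UnitAddCircle) = x - ((1 / 2 : ℝ) : UnitAddCircle) := hu
      have hx' : ((1 / 2 + (u - round u) : ℝ) : UnitAddCircle) = x := by
        have h1 : ((round u : ℝ) : UnitAddCircle) = 0 := by
          rw [AddCircle.coe_eq_zero_iff]
          exact ⟨round u, by simp⟩
        rw [AddCircle.coe_add, AddCircle.coe_sub, h1, hu']
        abel
      rw [← hu', UnitAddCircle.norm_eq] at hxb
      refine ⟨1 / 2 + (u - round u), ⟨?_, ?_⟩, hx'⟩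
      · have h2 := abs_le.mp hxb
        constructor <;> linarith
      · rw [hx']
        exact hx
  -- The chain `4/9 ≤ dim_F S ≤ dim_H S ≤ 4/9` forces equality throughout.
  have hdim : setFourierDim S = 4 / 9 ∧ dimH S = 4 / 9 := by
    have h1 : ENNReal.ofReal (4 / 9) ≤ setFourierDim S :=
      hF.trans (le_iSup₂ (f := fun (μ : ProbabilityMeasure UnitAddCircle)
        (_ : (μ : Measure UnitAddCircle).support ⊆ S) => measureFourierDim (μ : Measure UnitAddCircle))
        ν subset_rfl)
    have h2 := setFourierDim_le_dimH S
    rw [← ofReal_four_div_nine]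
    exact ⟨le_antisymm (h2.trans hH) h1, le_antisymm hH (h1.trans h2)⟩
  refine ⟨E, fun t ht => ?_, ?_, ?_, ?_⟩
  · constructor <;> linarith [ht.1.1, ht.1.2]
  · rw [himg]
    exact ⟨Measure.isClosed_support.measurableSet, hdim.1.trans hdim.2.symm⟩
  · rw [himg]
    exact hdim.1
  · intro t₁ h₁ t₂ h₂ t₃ h₃ h12 h23 h13
    refine hav ![t₁, t₂, t₃] ?_ ?_ ?_
    · exact injective_vec3 h12 h23 h13
    · have hIoo : ∀ t ∈ E, t ∈ Ioo (1 / 2 - η) (1 / 2 + η) := fun t ht =>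
        ⟨by linarith [ht.1.1], by linarith [ht.1.2]⟩
      intro i
      fin_cases i
      exacts [hIoo _ h₁, hIoo _ h₂, hIoo _ h₃]
    · intro i
      fin_cases i
      exacts [h₁.2, h₂.2, h₃.2]
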